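/- **Setting.** Let $T>0$, $d\in\mathbb N$. All space integrals are over $\mathbb R^d$; functions of time, kernels and weights below are (jointly) measurable in all their variables. Let $(P_t)_{t\ge0}$ and, for each $z\in\mathbb R^d$, $(P^z_t)_{t\ge0}$ be semigroups of linear operators on vector spaces of real functions on $\mathbb R^d$ containing $C_c^\infty(\mathbb R^d)$, with infinitesimal generators $L$ and $L^z$ whose domains contain $C_c^\infty(\mathbb R^d)$ (limits of the difference quotients are taken pointwise). Assume: * for $f\in C_c^\infty$ the map $(t,x)\mapsto P_tf(x)$ is jointly measurable and $\|P_tf\|_\infty\le\|f\|_\infty$ for $t\in[0,T]$; * $P^z_tf(x)=\int f(y)\,p^z_t(x,y)\,dy$ for $f\in C_c^\infty$, $t\in(0,T]$, where $p$ is jointly measurable in $(t,z,x,y)$, $p^z_t(x,\cdot)$ is a probability density, and $p^z$ is continuous on $(0,T]\times\mathbb R^d\times\mathbb R^d$ for every $z$; * $Lf(z)=L^zf(z)$ for $f\in C_c^\infty$, $z\in\mathbb R^d$; * $P^z_tg,\,P_tg\in\bigcap_x\operatorname{Dom}(L^x)$ for $g\in C_c^\infty$, $z\in\mathbb R^d$,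 $t\in[0,T]$. **Weight and kernel bounds.** There is a measurable $\theta:(0,T]\times\mathbb R^d\times\mathbb R^d\to\mathbb R$ with $$\int (L^y-L^x)f(y)\,p^x_t(x,y)\,dy=\int f(y)\,\theta_t(x,y)\,p^x_t(x,y)\,dy,\qquad f\in C_c^\infty,\ (t,x)\in(0,T]\times\mathbb R^d .$$ Put $a_t(x,y)=\theta_t(x,y)p^x_t(x,y)$. There are $\rho\in[0,1)$, $C>0$ and nonnegative measurable $\gamma,\beta$ on $(0,T]\times\mathbb R^d\times\mathbb R^d$ such that $|a_t(x,y)|\le Ct^{-\rho}\gamma_t(x,y)$; $\sup_{t,x}\int\gamma_t(x,y)\,dy<\infty$; for all $n\ge0$, $\delta_0,\dots,\delta_n>0$ with $\sum\delta_i\le T$, and all $y_0,y_{n+1}$, $$\int dy_1\cdots\int dy_n\prod_{i=0}^n\gamma_{\delta_i}(y_i,y_{i+1})\le C^{n+1}\beta_{\delta_0+\dots+\delta_n}(y_0,y_{n+1});$$ $\int_0^tds\int dy\,\beta_{t-s}(x,y)$ is bounded over $(t,x)\in[0,T]\times\mathbb R^d$; and $\int_0^tds\int dz\,|p^z_s(z,y)\beta_{t-s}(x,z)|<\infty$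 for all $t\in[0,T]$, $x,y\in\mathbb R^d$. **Uniform integrability.** For $\zeta>1$, $\kappa\in[0,1)$, a real or vector valued kernel $G$ is said to satisfy $\mathrm{UI}(\zeta,\kappa)$ if there are $r>0$ and $\xi:(0,\infty)\to(0,\infty)$ such that (i) for all $z_0,z_n\in\mathbb R^d$ and $R>0$ there is $C_R>0$ such that for all $n\ge2$, all $\delta_0,\dots,\delta_{n-1}>0$ with $\sum\delta_i\le T$ and all $(y_0,y_n)\in B(z_0,r)\times B(z_n,r)$ $$\int dy_1\cdots\int dy_{n-1}1_{\{\sum_{i=1}^{n-1}|y_i|\le R\}}\prod_{i=0}^{n-2}\gamma_{\delta_i}(y_i,y_{i+1})^\zeta\,|G_{\delta_{n-1}}(y_{n-1},y_n)|^\zeta\le C_R^n\,\xi\Big(\sum\delta_i\Big)\,\delta_{n-1}^{-\kappa\zeta};$$ (ii) for all $z_0,z_n\in\mathbb R^d$ there is $C>0$ such that for every $\varepsilon>0$ there is $R_\varepsilon>0$ such that for all $n\ge1$ and $\delta_i$, $y_0,y_n$ as in (i) $$\int dy_1\cdots\int dy_{n-1}1_{\{\sum_{i=1}^{n-1}|y_i|>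 R_\varepsilon\}}\prod_{i=0}^{n-2}\gamma_{\delta_i}(y_i,y_{i+1})\,|G_{\delta_{n-1}}(y_{n-1},y_n)|\le C^n\,\varepsilon\,\xi\Big(\sum\delta_i\Big)\,\delta_{n-1}^{-\kappa}.$$ Assume that $(t,x,y)\mapsto p^x_t(x,y)$ satisfies $\mathrm{UI}(\zeta,\kappa)$ for some $\kappa\in[0,1)$ and some $\zeta>1$ with $\zeta\rho<1$; that $y\mapsto p^x_t(x,y)$ is differentiable for all $(t,x)\in(0,T]\times\mathbb R^d$; and that $(t,x,y)\mapsto\nabla_yp^x_t(x,y)$ satisfies $\mathrm{UI}(\zeta',\kappa')$, with the same $\gamma$, for some $\zeta'>1$, $\kappa'\in[0,1)$. **Density.** Let $A_1((t,x),(s,y))=a_{t-s}(x,y)$, $A_{n+1}((t,x),(s,y))=\int_s^tds_1\int dy_1\,A_n((t,x),(s_1,y_1))\,a_{s_1-s}(y_1,y)$, and $$p_t(x,y)=p^x_t(x,y)+\sum_{n\ge1}I^n_t(x,y),\qquad I^n_t(x,y)=\int_0^tds\int dz\;p^z_{t-s}(z,y)\,A_n((t,x),(t-s,z)).$$ **Theorem.**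 For every $(t,x)\in(0,T]\times\mathbb R^d$ the series defining $p_t(x,y)$ converges absolutely for every $y$, and $y\mapsto p_t(x,y)$ is differentiable on $\mathbb R^d$. Moreover, let $\tau_0=0$ and let $\tau_1<\tau_2<\cdots$ be the jump times of a Poisson process of rate $1$ on a probability space, $J_T$ its number of jumps in $(0,T]$, and $\tau_T:=\tau_{J_T}$. Let $X^\pi$ be a process with $X^\pi_0=x$, measurable at the grid points $t_k=\tau_k\wedge T$, such that for every $k$, on $\{t_k<T\}$, conditionally on all jump times and on $X^\pi_{t_0},\dots,X^\pi_{t_k}$, the law of $X^\pi_{t_{k+1}}$ is $p^{y}_{t_{k+1}-t_k}(y,y')\,dy'$ with $y=X^\pi_{t_k}$. Let $\Gamma_T(x)=\prod_{j=0}^{J_T-1}\theta_{\tau_{j+1}-\tau_j}(X^\pi_{\tau_j},X^\pi_{\tau_{j+1}})$ (equal to $1$ if $J_T=0$). Then for every $y\in\mathbb R^d$ the random vector below is integrable and $$\nabla_yp_T(x,y)=e^T\,\mathbb E\Big[\nabla_yp^{X^\pi_{\tau_T}}_{T-\tau_T}(X^\pi_{\tau_T},y)\,\Gamma_T(x)\Big].$$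 -/

import Mathlib

open MeasureTheory ProbabilityTheory Filter Topology Set
open scoped ENNReal

noncomputable section

namespace Parametrix

/-- The state space `ℝ^d` with its Euclidean norm. -/
abbrev Space (d : ℕ) : Type := EuclideanSpace ℝ (Fin d)

/-- The class `C_c^∞(ℝ^d)`. -/
def IsTest {d : ℕ} (f : Space d → ℝ) : Prop := ContDiff ℝ (⊤ : ℕ∞) f ∧ HasCompactSupport f

/-! ### Semigroups and generators -/

/-- A semigroup `(S_t)_{t ≥ 0}` of linear operators on a vector space of real functions on `ℝ^d`
that contains `C_c^∞(ℝ^d)`. Only the values `op t f` with `0 ≤ t` and `f ∈ space` matter. -/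
structure FunctionSemigroup (d : ℕ) where
  space : Submodule ℝ (Space d → ℝ)
  op : ℝ → (Space d → ℝ) → Space d → ℝ
  test_mem : ∀ f, IsTest f → f ∈ space
  op_mem : ∀ t, 0 ≤ t → ∀ f ∈ space, op t f ∈ space
  op_add : ∀ t, 0 ≤ t → ∀ f ∈ space, ∀ g ∈ space, op t (f + g) = op t f + op t g
  op_smul : ∀ t, 0 ≤ t → ∀ (c : ℝ), ∀ f ∈ space, op t (c • f) = c • op t f
  op_zero : ∀ f ∈ space, op 0 f = f
  op_semigroup : ∀ s t, 0 ≤ s → 0 ≤ t → ∀ f ∈ space, op (s + t) f = op s (op t f)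

/-- `f` lies in the domain of the generator and is sent to `g` by it:
`(S_h f - f) / h → g` as `h ↓ 0`, at every point. -/
def FunctionSemigroup.HasGenerator {d : ℕ} (S : FunctionSemigroup d) (f g : Space d → ℝ) : Prop :=
  f ∈ S.space ∧ g ∈ S.space ∧
    ∀ x, Tendsto (fun h : ℝ => h⁻¹ * (S.op h f x - f x)) (𝓝[>] 0) (𝓝 (g x))

/-- The domain of the infinitesimal generator. -/
def FunctionSemigroup.dom {d : ℕ} (S : FunctionSemigroup d) : Set (Space d → ℝ) :=
  {f | ∃ g, S.HasGenerator f g}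

/-- The infinitesimal generator (meaningful on `S.dom`). -/
def FunctionSemigroup.gen {d : ℕ} (S : FunctionSemigroup d) (f : Space d → ℝ) : Space d → ℝ :=
  fun x => limUnder (𝓝[>] (0 : ℝ)) (fun h : ℝ => h⁻¹ * (S.op h f x - f x))

/-! ### The standing framework

Functions of a time variable in `(0, T]` are represented by total functions of a real variable
(for instance extended by zero); nothing is required of them at other times except measurability.
The frozen density `p_t^z(x, y)` is written `p t z x y`. -/

/-- The semigroup `P`: `C_c^∞` is in the domain of its generator, `P_t f(x)` is jointly measurable
in `(t, x)`, and `‖P_t f‖_∞ ≤ ‖f‖_∞` for test functions and `t ∈ [0, T]`. -/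
structure SemigroupHyp {d : ℕ} (T : ℝ) (P : FunctionSemigroup d) : Prop where
  test_dom : ∀ f, IsTest f → f ∈ P.dom
  meas : ∀ f, IsTest f → Measurable fun q : Icc (0 : ℝ) T × Space d => P.op q.1 f q.2
  contraction : ∀ f, IsTest f → ∀ t ∈ Icc (0 : ℝ) T, ∀ M : ℝ, (∀ x, |f x| ≤ M) →
    ∀ x, |P.op t f x| ≤ M

/-- The frozen semigroups `P^z`, with jointly measurable probability densities `p_t^z(x, y)`,
continuous in `(t, x, y)` on `(0, T] × ℝ^d × ℝ^d` for every `z`. -/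
structure FrozenHyp {d : ℕ} (T : ℝ) (Pz : Space d → FunctionSemigroup d)
    (p : ℝ → Space d → Space d → Space d → ℝ) : Prop where
  test_dom : ∀ z f, IsTest f → f ∈ (Pz z).dom
  meas : Measurable fun q : ℝ × Space d × Space d × Space d => p q.1 q.2.1 q.2.2.1 q.2.2.2
  cont : ∀ z, ContinuousOn (fun q : ℝ × Space d × Space d => p q.1 z q.2.1 q.2.2)
    (Ioc (0 : ℝ) T ×ˢ univ)
  nonneg : ∀ t ∈ Ioc (0 : ℝ) T, ∀ z x y, 0 ≤ p t z x y
  mass : ∀ t ∈ Ioc (0 : ℝ) T, ∀ z x, ∫⁻ y, ENNReal.ofReal (p t z x y) = 1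
  repr : ∀ f, IsTest f → ∀ t ∈ Ioc (0 : ℝ) T, ∀ z x,
    (Pz z).op t f x = ∫ y, f y * p t z x y

/-- `L f (z) = L^z f (z)` for test functions. -/
def LinkHyp {d : ℕ} (P : FunctionSemigroup d) (Pz : Space d → FunctionSemigroup d) : Prop :=
  ∀ f, IsTest f → ∀ z, P.gen f z = (Pz z).gen f z

/-- `P_t^z g` and `P_t g` lie in the domain of every `L^x`, for test functions `g`. -/
def DomainHyp {d : ℕ} (T : ℝ) (P : FunctionSemigroup d) (Pz : Space d → FunctionSemigroup d) :
    Prop :=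
  ∀ g, IsTest g → ∀ t ∈ Icc (0 : ℝ) T, ∀ x,
    P.op t g ∈ (Pz x).dom ∧ ∀ z, (Pz z).op t g ∈ (Pz x).dom

/-- The density started at its own freezing point, `(t, x, y) ↦ p_t^x(x, y)`. -/
def diag {d : ℕ} (p : ℝ → Space d → Space d → Space d → ℝ) (t : ℝ) (x y : Space d) : ℝ :=
  p t x x y

/-- The gradient `∇_y p_t^x(x, y)`. -/
def diagGrad {d : ℕ} (p : ℝ → Space d → Space d → Space d → ℝ) (t : ℝ) (x y : Space d) :
    Space d :=
  gradient (fun y' => diag p t x y') y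

/-- `a_t(x, y) = θ_t(x, y) p_t^x(x, y)`. -/
def weightedKernel {d : ℕ} (θ : ℝ → Space d → Space d → ℝ)
    (p : ℝ → Space d → Space d → Space d → ℝ) (t : ℝ) (x y : Space d) : ℝ :=
  θ t x y * diag p t x y

/-- The measurable weight `θ` represents the operator
`S_t f(x) = ∫ (L^y - L^x) f(y) p_t^x(x, y) dy` on test functions. -/
structure WeightHyp {d : ℕ} (T : ℝ) (Pz : Space d → FunctionSemigroup d)
    (p : ℝ → Space d → Space d → Space d → ℝ) (θ : ℝ → Space d → Space d → ℝ) : Prop where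
  meas : Measurable fun q : ℝ × Space d × Space d => θ q.1 q.2.1 q.2.2
  integrable : ∀ f, IsTest f → ∀ t ∈ Ioc (0 : ℝ) T, ∀ x,
    Integrable fun y => ((Pz y).gen f y - (Pz x).gen f y) * p t x x y
  repr : ∀ f, IsTest f → ∀ t ∈ Ioc (0 : ℝ) T, ∀ x,
    ∫ y, ((Pz y).gen f y - (Pz x).gen f y) * p t x x y = ∫ y, f y * θ t x y * p t x x y

/-! ### Bounds on kernels -/

/-- `∏_{i=0}^{m-1} γ_{δ_i}(y_i, y_{i+1})` along `y_0, y_1 = w 0, …, y_m = w (m-1)`. -/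
def chain {d m : ℕ} (γ : ℝ → Space d → Space d → ℝ) (δ : Fin (m + 1) → ℝ) (y₀ : Space d)
    (w : Fin m → Space d) : ℝ :=
  ∏ i : Fin m, γ (δ i.castSucc) ((Fin.cons y₀ w : Fin (m + 1) → Space d) i.castSucc) (w i)

/-- The last point `y_m` of the path `y_0, y_1 = w 0, …, y_m = w (m-1)`. -/
def endPoint {d m : ℕ} (y₀ : Space d) (w : Fin m → Space d) : Space d :=
  (Fin.cons y₀ w : Fin (m + 1) → Space d) (Fin.last m)

/-- The class `Γ_β`: for every `n`, all times `δ_0, …, δ_n > 0` of sum at most `T`, and all end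
points, `∫ dy_1 … ∫ dy_n ∏_{i=0}^n γ_{δ_i}(y_i, y_{i+1}) ≤ C^{n+1} β_{δ_0+⋯+δ_n}(y_0, y_{n+1})`. -/
def ClassGamma {d : ℕ} (T : ℝ) (β γ : ℝ → Space d → Space d → ℝ) : Prop :=
  ∃ C : ℝ, 0 < C ∧ ∀ (n : ℕ) (δ : Fin (n + 1) → ℝ), (∀ i, 0 < δ i) → ∑ i, δ i ≤ T →
    ∀ y₀ y₁ : Space d,
      ∫⁻ w : Fin n → Space d,
          ENNReal.ofReal (chain γ δ y₀ w * γ (δ (Fin.last n)) (endPoint y₀ w) y₁)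
        ≤ ENNReal.ofReal (C ^ (n + 1) * β (∑ i, δ i) y₀ y₁)

/-- `|a_t(x, y)| ≤ C t^{-ρ} γ_t(x, y)` with `ρ ∈ [0, 1)`, `γ ∈ Γ_β` and
`sup_{t, x} ∫ γ_t(x, y) dy < ∞`; moreover `∫_0^t ds ∫ dy β_{t-s}(x, y)` is bounded in `(t, x)`. -/
structure KernelHyp {d : ℕ} (T ρ : ℝ) (β γ a : ℝ → Space d → Space d → ℝ) : Prop where
  rho_mem : ρ ∈ Ico (0 : ℝ) 1
  meas_beta : Measurable fun q : ℝ × Space d × Space d => β q.1 q.2.1 q.2.2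
  meas_gamma : Measurable fun q : ℝ × Space d × Space d => γ q.1 q.2.1 q.2.2
  beta_nonneg : ∀ t ∈ Ioc (0 : ℝ) T, ∀ x y, 0 ≤ β t x y
  gamma_nonneg : ∀ t ∈ Ioc (0 : ℝ) T, ∀ x y, 0 ≤ γ t x y
  gamma_mass : ∃ K : ℝ, ∀ t ∈ Ioc (0 : ℝ) T, ∀ x,
    ∫⁻ y, ENNReal.ofReal (γ t x y) ≤ ENNReal.ofReal K
  bound : ∃ C : ℝ, 0 < C ∧ ∀ t ∈ Ioc (0 : ℝ) T, ∀ x y, |a t x y| ≤ C / t ^ ρ * γ t x y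
  gamma_class : ClassGamma T β γ
  beta_mass : ∃ K : ℝ, ∀ t ∈ Icc (0 : ℝ) T, ∀ x,
    ∫⁻ s in Ioo 0 t, ∫⁻ y, ENNReal.ofReal (β (t - s) x y) ≤ ENNReal.ofReal K

/-- The class `𝓜` of kernels `G` with `∫_0^t ds ∫ dz |G_s(z, y) β_{t-s}(x, z)| < ∞`. -/
def ClassM {d : ℕ} (T : ℝ) (β G : ℝ → Space d → Space d → ℝ) : Prop :=
  ∀ t ∈ Icc (0 : ℝ) T, ∀ x y,
    ∫⁻ s in Ioo 0 t, ∫⁻ z, ENNReal.ofReal |G s z y * β (t - s) x z| < ∞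

/-- Uniform integrability of the products of `γ` with a final real or vector valued factor `G`,
with exponent `ζ` and singularity exponent `κ` for the last time increment (for `κ = 0` the time
factors on the right are `1`). With `m = n - 1` intermediate points:

(i) for all `z_0, z_n` and `R > 0` there is `C_R` such that, for `n ≥ 2`, on the region
`∑ |y_i| ≤ R` the integral of `∏ γ^ζ |G|^ζ` is at most `C_R^n ξ(∑ δ_i) δ_{n-1}^{-κζ}`;

(ii) for all `z_0, z_n` there is `C` such that for every `ε > 0` there is `R_ε` such that, for
`n ≥ 1`, on the region `∑ |y_i| > R_ε` the integral of `∏ γ |G|` is at most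
`C^n ε ξ(∑ δ_i) δ_{n-1}^{-κ}`;

both for all increments `δ_i > 0` with sum at most `T` and all end points in the balls of radius
`r` about `z_0` and `z_n`. -/
def UniformIntegrability {d : ℕ} {F : Type*} [NormedAddCommGroup F] (T ζ κ : ℝ)
    (γ : ℝ → Space d → Space d → ℝ) (G : ℝ → Space d → Space d → F) : Prop :=
  ∃ r : ℝ, 0 < r ∧ ∃ ξ : ℝ → ℝ, (∀ s, 0 < s → 0 < ξ s) ∧
    (∀ z₀ z₁ : Space d, ∀ R : ℝ, 0 < R → ∃ C : ℝ, 0 < C ∧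
      ∀ m : ℕ, 1 ≤ m → ∀ δ : Fin (m + 1) → ℝ, (∀ i, 0 < δ i) → ∑ i, δ i ≤ T →
      ∀ y₀ ∈ Metric.ball z₀ r, ∀ y₁ ∈ Metric.ball z₁ r,
        ∫⁻ w in {w : Fin m → Space d | ∑ i, ‖w i‖ ≤ R},
            ENNReal.ofReal (chain γ δ y₀ w ^ ζ * ‖G (δ (Fin.last m)) (endPoint y₀ w) y₁‖ ^ ζ)
          ≤ ENNReal.ofReal
              (C ^ (m + 1) * ξ (∑ i, δ i) * δ (Fin.last m) ^ (-(κ * ζ)))) ∧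
    (∀ z₀ z₁ : Space d, ∃ C : ℝ, 0 < C ∧ ∀ ε : ℝ, 0 < ε → ∃ R : ℝ, 0 < R ∧
      ∀ (m : ℕ) (δ : Fin (m + 1) → ℝ), (∀ i, 0 < δ i) → ∑ i, δ i ≤ T →
      ∀ y₀ ∈ Metric.ball z₀ r, ∀ y₁ ∈ Metric.ball z₁ r,
        ∫⁻ w in {w : Fin m → Space d | R < ∑ i, ‖w i‖},
            ENNReal.ofReal (chain γ δ y₀ w * ‖G (δ (Fin.last m)) (endPoint y₀ w) y₁‖)
          ≤ ENNReal.ofReal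
              (C ^ (m + 1) * ε * ξ (∑ i, δ i) * δ (Fin.last m) ^ (-κ)))

/-! ### The expansion of the density -/

/-- `iterKernel a n t x y` is the `(n+1)`-fold iterated kernel `A_{n+1}((t, x), (0, y))` of `a`, so
that `A_{n+1}((t, x), (s, y)) = iterKernel a n (t - s) x y`. -/
def iterKernel {d : ℕ} (a : ℝ → Space d → Space d → ℝ) : ℕ → ℝ → Space d → Space d → ℝ
  | 0 => a
  | n + 1 => fun t x y => ∫ s in (0 : ℝ)..t, ∫ z, iterKernel a n (t - s) x z * a s z y

/-- `I_t^{n+1}(x, y) = ∫_0^t ds ∫ dz G_{t-s}(z, y) A_{n+1}((t, x), (t - s, z))`. -/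
def expansionTerm {d : ℕ} (a G : ℝ → Space d → Space d → ℝ) (n : ℕ) (t : ℝ) (x y : Space d) : ℝ :=
  ∫ s in (0 : ℝ)..t, ∫ z, G (t - s) z y * iterKernel a n s x z

/-- `p_t(x, y) = p_t^x(x, y) + ∑_{n ≥ 1} I_t^n(x, y)`. -/
def density {d : ℕ} (p : ℝ → Space d → Space d → Space d → ℝ) (θ : ℝ → Space d → Space d → ℝ)
    (t : ℝ) (x y : Space d) : ℝ :=
  diag p t x y + ∑' n : ℕ, expansionTerm (weightedKernel θ p) (diag p) n t x y

/-! ### The random grid and the process on it -/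

/-- `τ_0 = 0` and `τ_1 < τ_2 < ⋯` are the jump times of a Poisson process of rate one: the waiting
times are independent and exponential with parameter one. -/
structure IsPoissonTimes {Ω : Type*} [MeasurableSpace Ω] (μ : Measure Ω) (τ : ℕ → Ω → ℝ) :
    Prop where
  meas : ∀ k, Measurable (τ k)
  zero : ∀ ω, τ 0 ω = 0
  law : ∀ k, μ.map (fun ω => τ (k + 1) ω - τ k ω) = expMeasure 1
  indep : iIndepFun (fun k ω => τ (k + 1) ω - τ k ω) μ

/-- `J_T`, the number of jumps in `(0, T]`. -/
def jumpCount {Ω : Type*} (T : ℝ) (τ : ℕ → Ω → ℝ) (ω : Ω) : ℕ :=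
  {k : ℕ | 1 ≤ k ∧ τ k ω ≤ T}.ncard

/-- `τ_T = τ_{J_T}`, the last jump time up to `T` (zero if there is none). -/
def lastJump {Ω : Type*} (T : ℝ) (τ : ℕ → Ω → ℝ) (ω : Ω) : ℝ := τ (jumpCount T τ ω) ω

/-- The value of the process at the grid point `τ_k ∧ T`. -/
def gridState {d : ℕ} {Ω : Type*} (T : ℝ) (τ : ℕ → Ω → ℝ) (X : ℝ → Ω → Space d) (k : ℕ) (ω : Ω) :
    Space d :=
  X (min (τ k ω) T) ω

/-- The σ-algebra generated by all jump times and the states at the grid points `0, …, k`. -/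
@[reducible] def gridPast {d : ℕ} {Ω : Type*} (T : ℝ) (τ : ℕ → Ω → ℝ) (X : ℝ → Ω → Space d) (k : ℕ) :
    MeasurableSpace Ω :=
  (⨆ j : ℕ, MeasurableSpace.comap (τ j) inferInstance) ⊔
    ⨆ j : ℕ, ⨆ _ : j ≤ k, MeasurableSpace.comap (gridState T τ X j) inferInstance

/-- `X` starts at `x` and, given the jump times, is Markovian along the grid
`π = {τ_k ∧ T}`: given all jump times and its states at the grid points up to `t_k = τ_k ∧ T < T`,
its state at `t_{k+1}` has density `p_{t_{k+1} - t_k}^{X_{t_k}}(X_{t_k}, ·)`. -/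
structure IsGridProcess {d : ℕ} {Ω : Type*} [MeasurableSpace Ω] (μ : Measure Ω) (T : ℝ)
    (p : ℝ → Space d → Space d → Space d → ℝ) (x : Space d) (τ : ℕ → Ω → ℝ)
    (X : ℝ → Ω → Space d) : Prop where
  meas : ∀ k, Measurable (gridState T τ X k)
  init : ∀ ω, X 0 ω = x
  markov : ∀ (k : ℕ) (B : Set (Space d)), MeasurableSet B →
    μ⟦gridState T τ X (k + 1) ⁻¹' B|gridPast T τ X k⟧
      =ᵐ[μ.restrict {ω | τ k ω < T}] fun ω =>
        ∫ y in B, p (min (τ (k + 1) ω) T - τ k ω) (gridState T τ X k ω) (gridState T τ X k ω) y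

/-- `Γ_T(x) = ∏_{j=0}^{J_T - 1} θ_{τ_{j+1} - τ_j}(X_{τ_j}, X_{τ_{j+1}})`. -/
def pathWeight {d : ℕ} {Ω : Type*} (T : ℝ) (θ : ℝ → Space d → Space d → ℝ) (τ : ℕ → Ω → ℝ)
    (X : ℝ → Ω → Space d) (ω : Ω) : ℝ :=
  ∏ j ∈ Finset.range (jumpCount T τ ω),
    θ (τ (j + 1) ω - τ j ω) (X (τ j ω) ω) (X (τ (j + 1) ω) ω)

end Parametrix

end

open MeasureTheory ProbabilityTheory Filter Topology Set
open scoped ENNReal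

namespace Parametrix

/-! ### Products of kernels along paths -/

/-! Both sides of the identity are sums over m of integrals over space-time paths. `pathTerm a G m t
x y` integrates ∏_{i<m} a_{δ_i}(y_i, y_{i+1}) · G_{t-∑δ_i}(y_m, y) over all increments and all
intermediate points; kernels are cut off outside (0, T], so the constraints δ_i > 0 and ∑ δ_i < t
are built into the integrand. With G the frozen density this is the m-th correction I^m of the
expansion (`expansionTerm_eq_pathTerm`): the nested integrals are flattened by Fubini and the change
of variables `measurePreserving_extendPath`, which replaces an absolute time by the last increment.

Probabilistic side. On the event of exactly n jumps before T, the first n waiting times have density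
e^{-T} on the simplex, because the n exponential densities and the tail of the next waiting time
multiply to e^{-T}. Given the times, the grid states contribute ∏ p^{y_i}_{δ_i}(y_i, y_{i+1}), and
the weight turns this product into ∏ a. So the part of the expectation on n jumps is e^{-T} times
the n-th path term with G = ∇p (`map_waitingTimes_gridPath`, `setIntegral_gridIntegrand`), and
summing over n gives `integrable_and_hasSum_pathTerm`.

Analytic side. It remains to differentiate the expansion term by term. The estimate behind
everything is `PathBound`: for fixed increments the space integral is at most A^{m+1} ∏ δ_i^{-σ}
(t-∑δ_i)^{-σ} with σ < 1, and the time integral of this decays faster than any geometric sequence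
(`exists_lintegral_prod_timeSing_le`). Uniform integrability supplies such bounds, locally uniformly
in the end point (`UniformIntegrability.exists_pathBound`).

The derivative is moved inside in three layers. In space, at fixed increments, there is no pointwise
majorant for the gradients, only integral bounds, so a Vitali argument is used
(`hasGradientAt_integral_of_uniformly_integrable`). In time, `PathBound` is an integrable majorant
(`hasGradientAt_pathTerm`). For the series, the geometric bound is uniform on a ball
(`summable_and_hasGradientAt_expansion`). Splitting the space and time layers means that the ζ-th
powers of the time singularities never have to be integrated. -/

/-- The product `∏_{i < m} k_{δ_i}(y_i, y_{i+1})` along the path `y_0 = x, y_{i+1} = w i`. -/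
def pathProd {E M : Type*} [CommMonoid M] (k : ℝ → E → E → M) {m : ℕ} (x : E) (δ : Fin m → ℝ)
    (w : Fin m → E) : M :=
  ∏ i : Fin m, k (δ i) ((Fin.cons x w : Fin (m + 1) → E) i.castSucc) (w i)

/-- The last point of the path `x, w 0, …, w (m - 1)`. -/
def pathEnd {E : Type*} {m : ℕ} (x : E) (w : Fin m → E) : E :=
  (Fin.cons x w : Fin (m + 1) → E) (Fin.last m)

section PathProd

variable {E M : Type*} [CommMonoid M]

@[simp]
lemma pathProd_zero (k : ℝ → E → E → M) (x : E) (δ : Fin 0 → ℝ) (w : Fin 0 → E) :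
    pathProd k x δ w = 1 := by
  simp [pathProd]

@[simp]
lemma pathEnd_zero (x : E) (w : Fin 0 → E) : pathEnd x w = x := rfl

@[simp]
lemma pathEnd_snoc {m : ℕ} (x : E) (w : Fin m → E) (z : E) :
    pathEnd x (Fin.snoc w z : Fin (m + 1) → E) = z := by
  rw [pathEnd, Fin.cons_snoc_eq_snoc_cons, Fin.snoc_last]

lemma pathProd_snoc (k : ℝ → E → E → M) {m : ℕ} (x : E) (δ : Fin m → ℝ) (u : ℝ)
    (w : Fin m → E) (z : E) :
    pathProd k x (Fin.snoc δ u : Fin (m + 1) → ℝ) (Fin.snoc w z : Fin (m + 1) → E) =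
      pathProd k x δ w * k u (pathEnd x w) z := by
  simp only [pathProd, pathEnd, Fin.prod_univ_castSucc, Fin.cons_snoc_eq_snoc_cons,
    Fin.snoc_castSucc, Fin.snoc_last]

lemma pathProd_congr {k k' : ℝ → E → E → M} {m : ℕ} {x : E} {δ : Fin m → ℝ} {w : Fin m → E}
    (h : ∀ i y z, k (δ i) y z = k' (δ i) y z) : pathProd k x δ w = pathProd k' x δ w :=
  Finset.prod_congr rfl fun _ _ => h _ _ _

lemma pathProd_mul (k k' : ℝ → E → E → M) {m : ℕ} (x : E) (δ : Fin m → ℝ) (w : Fin m → E) :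
    pathProd (fun t y z => k t y z * k' t y z) x δ w = pathProd k x δ w * pathProd k' x δ w :=
  Finset.prod_mul_distrib

lemma chain_eq_pathProd {d m : ℕ} (γ : ℝ → Space d → Space d → ℝ) (δ : Fin m → ℝ) (u : ℝ)
    (x : Space d) (w : Fin m → Space d) :
    chain γ (Fin.snoc δ u : Fin (m + 1) → ℝ) x w = pathProd γ x δ w := by
  simp only [chain, pathProd, Fin.snoc_castSucc]

lemma endPoint_eq_pathEnd {d m : ℕ} (x : Space d) (w : Fin m → Space d) :
    endPoint x w = pathEnd x w := rfl

@[fun_prop]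
lemma measurable_pathEnd [MeasurableSpace E] {m : ℕ} (x : E) :
    Measurable fun w : Fin m → E => pathEnd x w := by
  cases m with
  | zero => exact measurable_const
  | succ m => exact measurable_pi_apply (Fin.last m)

@[fun_prop]
lemma measurable_pathProd [MeasurableSpace E] [MeasurableSpace M] [MeasurableMul₂ M]
    {k : ℝ → E → E → M}
    (hk : Measurable fun q : ℝ × E × E => k q.1 q.2.1 q.2.2) {m : ℕ} (x : E) :
    Measurable fun q : (Fin m → ℝ) × (Fin m → E) => pathProd k x q.1 q.2 := by
  refine Finset.measurable_fun_prod _ fun i _ => ?_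
  refine hk.comp (Measurable.prodMk (by fun_prop) (Measurable.prodMk ?_ (by fun_prop)))
  refine Fin.cases (motive := fun j => Measurable fun q : (Fin m → ℝ) × (Fin m → E) =>
    (Fin.cons x q.2 : Fin (m + 1) → E) j) ?_ (fun j => ?_) i.castSucc
  · simp only [Fin.cons_zero]; exact measurable_const
  · simp only [Fin.cons_succ]; fun_prop

end PathProd

/-! ### Integration over paths -/

section Snoc

variable {E : Type*} [MeasurableSpace E] (ν : Measure E) [SigmaFinite ν]

lemma measurePreserving_snoc (m : ℕ) :
    MeasurePreserving (fun q : (Fin m → E) × E => (Fin.snoc q.1 q.2 : Fin (m + 1) → E))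
      ((Measure.pi fun _ => ν).prod ν) (Measure.pi fun _ => ν) := by
  have h1 := (measurePreserving_piFinSuccAbove (fun _ : Fin (m + 1) => ν) (Fin.last m)).symm
  have h2 : MeasurePreserving (Prod.swap : (Fin m → E) × E → E × (Fin m → E))
    ((Measure.pi fun _ => ν).prod ν) (ν.prod (Measure.pi fun _ => ν)) :=
    Measure.measurePreserving_swap
  convert h1.comp h2 using 1
  ext q : 1
  exact (Fin.insertNth_last' _ _).symm

lemma lintegral_pi_snoc {m : ℕ} {f : (Fin (m + 1) → E) → ℝ≥0∞} (hf : Measurable f) :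
    ∫⁻ v, f v ∂(Measure.pi fun _ => ν) =
      ∫⁻ w, ∫⁻ z, f (Fin.snoc w z : Fin (m + 1) → E) ∂ν ∂(Measure.pi fun _ => ν) := by
  rw [← (measurePreserving_snoc ν m).lintegral_comp hf, lintegral_prod]
  exact (hf.comp (measurePreserving_snoc ν m).measurable).aemeasurable

lemma measurable_snoc {m : ℕ} :
    Measurable fun q : (Fin m → E) × E => (Fin.snoc q.1 q.2 : Fin (m + 1) → E) := by
  refine measurable_pi_iff.2 fun i => ?_
  refine Fin.lastCases ?_ (fun j => ?_) i
  · simp only [Fin.snoc_last]; fun_prop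
  · simp only [Fin.snoc_castSucc]; fun_prop

end Snoc

/-- For fixed δ the map is a translation s ↦ s - ∑ δ_i of the time variable, so translation
invariance and Tonelli suffice. It trades the time s at which the path sits at z for the length of
the step leading to z. -/
lemma measurePreserving_extendPath {E : Type*} [MeasureSpace E]
    [SigmaFinite (volume : Measure E)] (m : ℕ) :
    MeasurePreserving (fun q : (ℝ × E) × ((Fin m → ℝ) × (Fin m → E)) =>
      ((Fin.snoc q.2.1 (q.1.1 - ∑ i, q.2.1 i) : Fin (m + 1) → ℝ),
        (Fin.snoc q.2.2 q.1.2 : Fin (m + 1) → E))) volume volume := by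
  have hmeas : Measurable (fun q : (ℝ × E) × ((Fin m → ℝ) × (Fin m → E)) =>
      ((Fin.snoc q.2.1 (q.1.1 - ∑ i, q.2.1 i) : Fin (m + 1) → ℝ),
        (Fin.snoc q.2.2 q.1.2 : Fin (m + 1) → E))) := by
    refine Measurable.prodMk ?_ ?_
    · exact measurable_snoc.comp (f := fun q : (ℝ × E) × ((Fin m → ℝ) × (Fin m → E)) =>
        (q.2.1, q.1.1 - ∑ i, q.2.1 i)) (by fun_prop)
    · exact measurable_snoc.comp (f := fun q : (ℝ × E) × ((Fin m → ℝ) × (Fin m → E)) =>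
        (q.2.2, q.1.2)) (by fun_prop)
  refine ⟨hmeas, Measure.ext_of_lintegral _ fun f hf => ?_⟩
  have hF : Measurable (fun q : (ℝ × E) × ((Fin m → ℝ) × (Fin m → E)) =>
      f ((Fin.snoc q.2.1 (q.1.1 - ∑ i, q.2.1 i) : Fin (m + 1) → ℝ),
        (Fin.snoc q.2.2 q.1.2 : Fin (m + 1) → E))) := hf.comp hmeas
  rw [lintegral_map hf hmeas, Measure.volume_eq_prod, lintegral_prod_symm _ hF.aemeasurable,
    Measure.volume_eq_prod (Fin m → ℝ), lintegral_prod _ hF.lintegral_prod_left'.aemeasurable]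
  have hR : ∫⁻ q, f q ∂(volume : Measure ((Fin (m + 1) → ℝ) × (Fin (m + 1) → E))) =
      ∫⁻ δ : Fin m → ℝ, ∫⁻ u : ℝ, ∫⁻ w : Fin m → E, ∫⁻ z : E,
        f ((Fin.snoc δ u : Fin (m + 1) → ℝ), (Fin.snoc w z : Fin (m + 1) → E)) := by
    rw [Measure.volume_eq_prod, lintegral_prod _ hf.aemeasurable]
    rw [volume_pi, volume_pi, lintegral_pi_snoc _ hf.lintegral_prod_right']
    refine lintegral_congr fun δ => lintegral_congr fun u => ?_
    exact lintegral_pi_snoc _ (hf.comp measurable_prodMk_left)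
  rw [hR]
  refine lintegral_congr fun δ => ?_
  have hg : Measurable fun q : (Fin m → E) × ℝ × E =>
      f ((Fin.snoc δ (q.2.1 - ∑ i, δ i) : Fin (m + 1) → ℝ),
        (Fin.snoc q.1 q.2.2 : Fin (m + 1) → E)) :=
    (hf.comp hmeas).comp (g := fun r => _)
      (f := fun q : (Fin m → E) × ℝ × E => ((q.2.1, q.2.2), (δ, q.1))) (by fun_prop)
  calc _ = ∫⁻ w : Fin m → E, ∫⁻ s : ℝ, ∫⁻ z : E,
        f ((Fin.snoc δ (s - ∑ i, δ i) : Fin (m + 1) → ℝ),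
          (Fin.snoc w z : Fin (m + 1) → E)) := by
        refine lintegral_congr fun w => ?_
        rw [Measure.volume_eq_prod, lintegral_prod]
        exact (hg.comp (g := fun r => _) (f := fun q : ℝ × E => (w, q)) (by fun_prop)).aemeasurable
    _ = ∫⁻ s : ℝ, ∫⁻ w : Fin m → E, ∫⁻ z : E,
        f ((Fin.snoc δ (s - ∑ i, δ i) : Fin (m + 1) → ℝ),
          (Fin.snoc w z : Fin (m + 1) → E)) := by
        refine lintegral_lintegral_swap ?_
        refine (Measurable.lintegral_prod_right' (f := fun q : ((Fin m → E) × ℝ) × E =>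
          f ((Fin.snoc δ (q.1.2 - ∑ i, δ i) : Fin (m + 1) → ℝ),
          (Fin.snoc q.1.1 q.2 : Fin (m + 1) → E))) ?_).aemeasurable
        exact hg.comp (g := fun r => _)
          (f := fun q : ((Fin m → E) × ℝ) × E => (q.1.1, q.1.2, q.2)) (by fun_prop)
    _ = _ := lintegral_sub_right_eq_self (fun u => ∫⁻ w : Fin m → E, ∫⁻ z : E,
        f ((Fin.snoc δ u : Fin (m + 1) → ℝ), (Fin.snoc w z : Fin (m + 1) → E))) _

/-! ### Convolutions of time singularities -/

/-- The tilted time singularity `s^{-σ} e^{-λ s}` on `s > 0`, extended by zero. -/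
noncomputable def timeSing (σ lam s : ℝ) : ℝ≥0∞ :=
  if 0 < s then ENNReal.ofReal (s ^ (-σ) * Real.exp (-(lam * s))) else 0

lemma timeSing_of_pos {σ lam s : ℝ} (hs : 0 < s) :
    timeSing σ lam s = ENNReal.ofReal (s ^ (-σ) * Real.exp (-(lam * s))) := if_pos hs

lemma timeSing_of_nonpos {σ lam s : ℝ} (hs : s ≤ 0) : timeSing σ lam s = 0 := if_neg hs.not_gt

lemma timeSing_zero_of_pos {σ s : ℝ} (hs : 0 < s) :
    timeSing σ 0 s = ENNReal.ofReal (s ^ (-σ)) := by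
  simp [timeSing_of_pos hs]

lemma timeSing_ne_top (σ lam s : ℝ) : timeSing σ lam s ≠ ∞ := by
  unfold timeSing; split_ifs <;> simp

@[fun_prop]
lemma measurable_timeSing (σ lam : ℝ) : Measurable (timeSing σ lam) :=
  Measurable.ite measurableSet_Ioi (by fun_prop) measurable_const

lemma lintegral_timeSing {σ lam : ℝ} (hσ : σ < 1) (hl : 0 < lam) :
    ∫⁻ s, timeSing σ lam s = ENNReal.ofReal ((1 / lam) ^ (1 - σ) * Real.Gamma (1 - σ)) := by
  have hint := Real.integral_rpow_mul_exp_neg_mul_Ioi (a := 1 - σ) (r := lam) (by linarith) hl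
  have hnn : ∀ s ∈ Ioi (0 : ℝ), 0 ≤ s ^ (1 - σ - 1) * Real.exp (-(lam * s)) := fun s hs =>
    mul_nonneg (Real.rpow_nonneg (le_of_lt hs) _) (Real.exp_nonneg _)
  have hpos : 0 < (1 / lam) ^ (1 - σ) * Real.Gamma (1 - σ) :=
    mul_pos (Real.rpow_pos_of_pos (by positivity) _) (Real.Gamma_pos_of_pos (by linarith))
  have hI : Integrable (fun s => s ^ (1 - σ - 1) * Real.exp (-(lam * s)))
      (volume.restrict (Ioi 0)) := by
    -- A non-integrable function would have Bochner integral 0, while the Gamma value is positive.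
    by_contra h
    rw [integral_undef h] at hint
    exact hpos.ne hint
  rw [← hint, ofReal_integral_eq_lintegral_ofReal hI
    ((ae_restrict_iff' measurableSet_Ioi).2 (ae_of_all _ hnn)),
    ← lintegral_indicator measurableSet_Ioi]
  refine lintegral_congr fun s => ?_
  by_cases hs : 0 < s
  · rw [timeSing_of_pos hs, indicator_of_mem (mem_Ioi.2 hs)]; congr 3; ring
  · rw [timeSing_of_nonpos (not_lt.1 hs), indicator_of_notMem (by simpa using hs)]

/-- The integral scales like λ^{σ-1}. A large tilt makes one convolution factor as small as desired,
which is where the geometric decay comes from. -/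
lemma tendsto_lintegral_timeSing {σ : ℝ} (hσ : σ < 1) :
    Tendsto (fun lam => ∫⁻ s, timeSing σ lam s) atTop (𝓝 0) := by
  have h : Tendsto (fun lam : ℝ => ENNReal.ofReal (lam ^ (-(1 - σ)) * Real.Gamma (1 - σ)))
      atTop (𝓝 (ENNReal.ofReal (0 * Real.Gamma (1 - σ)))) :=
    ENNReal.tendsto_ofReal ((tendsto_rpow_neg_atTop (by linarith)).mul_const _)
  rw [zero_mul, ENNReal.ofReal_zero] at h
  refine h.congr' ?_
  filter_upwards [eventually_gt_atTop 0] with lam hl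
  rw [lintegral_timeSing hσ hl, Real.rpow_neg hl.le, one_div, Real.inv_rpow hl.le]

/-- One of s and t - s is at least t/2, and its singular factor is at most 2^σ t^{-σ}; the other
factor is kept. If s is the larger one, the tilt passes to t - s because e^{-λs} ≤ e^{-λ(t-s)}. -/
lemma timeSing_mul_le {σ lam : ℝ} (hσ : 0 ≤ σ) (hl : 0 ≤ lam) (s t : ℝ) :
    timeSing σ lam s * timeSing σ 0 (t - s) ≤
      ENNReal.ofReal (2 ^ σ) * timeSing σ 0 t * (timeSing σ lam s + timeSing σ lam (t - s)) := by
  rcases le_or_gt s 0 with hs | hs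
  · simp [timeSing_of_nonpos hs]
  rcases le_or_gt (t - s) 0 with hts | hts
  · simp [timeSing_of_nonpos hts]
  have ht : 0 < t := by linarith
  have key : ∀ u : ℝ, t / 2 ≤ u → u ^ (-σ) ≤ 2 ^ σ * t ^ (-σ) := fun u hu => by
    calc u ^ (-σ) ≤ (t / 2) ^ (-σ) :=
          Real.rpow_le_rpow_of_nonpos (by linarith) hu (by linarith)
      _ = 2 ^ σ * t ^ (-σ) := by
          rw [Real.div_rpow ht.le (by norm_num), Real.rpow_neg (by norm_num : (0 : ℝ) ≤ 2)]
          field_simp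
  rw [timeSing_of_pos hs, timeSing_zero_of_pos hts, timeSing_of_pos hts, timeSing_zero_of_pos ht,
    ← ENNReal.ofReal_mul (by positivity), ← ENNReal.ofReal_mul (by positivity),
    ← ENNReal.ofReal_add (by positivity) (by positivity), ← ENNReal.ofReal_mul (by positivity)]
  refine ENNReal.ofReal_le_ofReal ?_
  rw [mul_add]
  rcases le_total s (t / 2) with h | h
  · refine le_trans ?_ (le_add_of_nonneg_right (by positivity))
    rw [mul_comm]
    exact mul_le_mul_of_nonneg_right (key _ (by linarith)) (by positivity)
  · refine le_trans ?_ (le_add_of_nonneg_left (by positivity))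
    have h1 : Real.exp (-(lam * s)) ≤ Real.exp (-(lam * (t - s))) :=
      Real.exp_le_exp.2 (by nlinarith)
    calc s ^ (-σ) * Real.exp (-(lam * s)) * (t - s) ^ (-σ)
        ≤ (2 ^ σ * t ^ (-σ)) * Real.exp (-(lam * (t - s))) * (t - s) ^ (-σ) := by
          gcongr; exact key _ h
      _ = _ := by ring

lemma lintegral_timeSing_mul_le {σ lam : ℝ} (hσ : 0 ≤ σ) (hl : 0 ≤ lam) (t : ℝ) :
    ∫⁻ s, timeSing σ lam s * timeSing σ 0 (t - s) ≤
      (ENNReal.ofReal (2 ^ σ) * (2 * ∫⁻ s, timeSing σ lam s)) * timeSing σ 0 t := by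
  refine (lintegral_mono fun s => timeSing_mul_le hσ hl s t).trans_eq ?_
  rw [lintegral_const_mul _ (by fun_prop), lintegral_add_left (by fun_prop),
    lintegral_sub_left_eq_self (fun s => timeSing σ lam s), ← two_mul]
  ring

/-- Integrating out the last increment reproduces the untilted singularity at the remaining time and
costs one factor, so the estimate closes by induction. Only the increments are tilted, which keeps
the final factor of the same form. -/
lemma lintegral_prod_timeSing_le {σ lam : ℝ} (hσ : 0 ≤ σ) (hl : 0 ≤ lam) (m : ℕ) (t : ℝ) :
    ∫⁻ δ : Fin m → ℝ, (∏ i, timeSing σ lam (δ i)) * timeSing σ 0 (t - ∑ i, δ i) ≤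
      (ENNReal.ofReal (2 ^ σ) * (2 * ∫⁻ s, timeSing σ lam s)) ^ m * timeSing σ 0 t := by
  induction m with
  | zero => simp [volume_pi]
  | succ m ih =>
    rw [volume_pi, lintegral_pi_snoc _ (by fun_prop)]
    simp only [Fin.prod_univ_castSucc, Fin.sum_univ_castSucc, Fin.snoc_castSucc, Fin.snoc_last]
    have hr := lintegral_timeSing_mul_le hσ hl
    generalize ENNReal.ofReal (2 ^ σ) * (2 * ∫⁻ s, timeSing σ lam s) = r at hr ih ⊢
    calc _ ≤ ∫⁻ δ : Fin m → ℝ, r * ((∏ i, timeSing σ lam (δ i)) *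
            timeSing σ 0 (t - ∑ i, δ i)) := by
          rw [volume_pi]
          refine lintegral_mono fun δ => ?_
          simp only [mul_assoc, ← sub_sub]
          rw [lintegral_const_mul _ (by fun_prop), mul_left_comm r]
          gcongr
          exact hr _
      _ ≤ _ := by
          rw [lintegral_const_mul _ (by fun_prop), pow_succ', mul_assoc]
          gcongr

/-- Wherever the integrand is nonzero the increments sum to less than t, so removing all the tilts
together costs only e^{λt}, independently of m. -/
lemma lintegral_prod_timeSing_zero_le {σ lam : ℝ} (hσ : 0 ≤ σ) (hl : 0 ≤ lam) (m : ℕ) (t : ℝ) :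
    ∫⁻ δ : Fin m → ℝ, (∏ i, timeSing σ 0 (δ i)) * timeSing σ 0 (t - ∑ i, δ i) ≤
      ENNReal.ofReal (Real.exp (lam * t)) *
        ((ENNReal.ofReal (2 ^ σ) * (2 * ∫⁻ s, timeSing σ lam s)) ^ m * timeSing σ 0 t) := by
  refine le_trans ?_ (mul_le_mul_right (lintegral_prod_timeSing_le hσ hl m t) _)
  rw [← lintegral_const_mul _ (by fun_prop)]
  refine lintegral_mono fun δ => ?_
  rcases le_or_gt (t - ∑ i, δ i) 0 with h | h
  · simp [timeSing_of_nonpos h]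
  rw [← mul_assoc]
  gcongr
  have h0 : ∀ s, timeSing σ 0 s = ENNReal.ofReal (Real.exp (lam * s)) * timeSing σ lam s := by
    intro s
    rcases le_or_gt s 0 with hs | hs
    · simp [timeSing_of_nonpos hs]
    · rw [timeSing_zero_of_pos hs, timeSing_of_pos hs, ← ENNReal.ofReal_mul (by positivity),
        mul_left_comm, ← Real.exp_add]
      simp
  simp only [h0 (δ _), Finset.prod_mul_distrib]
  gcongr
  rw [← ENNReal.ofReal_prod_of_nonneg (fun _ _ => by positivity), ← Real.exp_sum,
    ← Finset.mul_sum]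
  exact ENNReal.ofReal_le_ofReal (Real.exp_le_exp.2 (by gcongr; linarith))

/-- Iterated convolutions of an integrable power singularity decay faster than any geometric
sequence. -/
lemma exists_lintegral_prod_timeSing_le {σ : ℝ} (hσ : 0 ≤ σ) (hσ1 : σ < 1) (t : ℝ) {A : ℝ≥0∞}
    (hA : A ≠ ∞) : ∃ C : ℝ≥0∞, C ≠ ∞ ∧ ∀ m : ℕ,
      A ^ m * ∫⁻ δ : Fin m → ℝ, (∏ i, timeSing σ 0 (δ i)) * timeSing σ 0 (t - ∑ i, δ i) ≤
        C * 2⁻¹ ^ m := by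
  have h : Tendsto (fun lam => A * (ENNReal.ofReal (2 ^ σ) * (2 * ∫⁻ s, timeSing σ lam s)))
      atTop (𝓝 (A * (ENNReal.ofReal (2 ^ σ) * (2 * 0)))) :=
    ENNReal.Tendsto.const_mul (ENNReal.Tendsto.const_mul (ENNReal.Tendsto.const_mul
      (tendsto_lintegral_timeSing hσ1) (Or.inr (by simp))) (Or.inr (by simp))) (Or.inr hA)
  simp only [mul_zero] at h
  -- λ is taken so large that A times the cost of one convolution is below 1/2; it depends on A but
  -- not on m.
  obtain ⟨lam, h1, h2⟩ := ((h.eventually_lt_const (by simp : (0 : ℝ≥0∞) < 2⁻¹)).and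
    (eventually_ge_atTop 0)).exists
  refine ⟨ENNReal.ofReal (Real.exp (lam * t)) * timeSing σ 0 t,
    ENNReal.mul_ne_top (by simp) (timeSing_ne_top _ _ _), fun m => ?_⟩
  calc _ ≤ A ^ m * _ := mul_le_mul_right (lintegral_prod_timeSing_zero_le hσ h2 m t) _
    _ = ENNReal.ofReal (Real.exp (lam * t)) * timeSing σ 0 t *
        (A * (ENNReal.ofReal (2 ^ σ) * (2 * ∫⁻ s, timeSing σ lam s))) ^ m := by
        rw [mul_pow]; ring
    _ ≤ _ := by gcongr

/-! ### A Vitali type theorem and differentiation under the integral sign -/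

/-- Hölder's inequality against the constant function 1. -/
lemma lintegral_le_rpow_lintegral {α : Type*} [MeasurableSpace α] (μ : Measure α) {ζ : ℝ}
    (hζ : 1 < ζ) {f : α → ℝ≥0∞} (hf : AEMeasurable f μ) :
    ∫⁻ w, f w ∂μ ≤ (∫⁻ w, f w ^ ζ ∂μ) ^ (1 / ζ) * μ univ ^ (1 - 1 / ζ) := by
  have hc := Real.HolderConjugate.conjExponent hζ
  have h := ENNReal.lintegral_mul_le_Lp_mul_Lq μ hc hf (aemeasurable_const (b := (1 : ℝ≥0∞)))
  have h2 : 1 / ζ.conjExponent = 1 - 1 / ζ := by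
    have := hc.inv_add_inv_eq_one
    simp only [one_div]; linarith
  simpa [h2] using h

lemma rpow_lintegral_le {α : Type*} [MeasurableSpace α] (μ : Measure α) [IsProbabilityMeasure μ]
    {ζ : ℝ} (hζ : 1 < ζ) {f : α → ℝ≥0∞} (hf : AEMeasurable f μ) :
    (∫⁻ w, f w ∂μ) ^ ζ ≤ ∫⁻ w, f w ^ ζ ∂μ := by
  have h := lintegral_le_rpow_lintegral μ hζ hf
  rw [measure_univ, ENNReal.one_rpow, mul_one, one_div] at h
  exact (ENNReal.le_rpow_inv_iff (by linarith)).1 h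

/-- Above the level M one has q = q^{1-ζ} q^ζ ≤ M^{1-ζ} q^ζ since 1 - ζ < 0. Thus an L^ζ bound
controls the part lost by truncation. -/
lemma ENNReal_le_min_add_rpow {ζ : ℝ} (hζ : 1 < ζ) (q : ℝ≥0∞) {M : ℝ≥0∞} (hM : M ≠ 0)
    (hM' : M ≠ ∞) : q ≤ min q M + M ^ (1 - ζ) * q ^ ζ := by
  rcases le_total q M with h | h
  · rw [min_eq_left h]; exact le_self_add
  · refine le_add_left ?_
    have hq0 : q ≠ 0 := fun h0 => hM (le_antisymm (h0 ▸ h) zero_le)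
    rcases eq_or_ne q ∞ with rfl | hq
    · rw [ENNReal.top_rpow_of_pos (by linarith), ENNReal.mul_top]
      exact (ENNReal.rpow_pos (pos_iff_ne_zero.2 hM) hM').ne'
    · calc q = M ^ (1 - ζ) * M ^ (ζ - 1) * q := by
            rw [← ENNReal.rpow_add _ _ hM hM']; simp
        _ ≤ M ^ (1 - ζ) * q ^ (ζ - 1) * q := by gcongr
        _ = M ^ (1 - ζ) * q ^ ζ := by
            rw [mul_assoc]; congr 1
            nth_rewrite 2 [← ENNReal.rpow_one q]
            rw [← ENNReal.rpow_add _ _ hq0 hq]; simp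

/-- Vitali: pointwise convergence to zero, boundedness in `L^ζ` on sets of finite measure and
uniformly small `L^1` norms off these sets give convergence in `L^1`. -/
lemma tendsto_lintegral_of_uniformly_integrable {α ι : Type*} [MeasurableSpace α] {μ : Measure α}
    {l : Filter ι} [l.IsCountablyGenerated] {Q : ι → α → ℝ≥0∞} {ζ : ℝ} (hζ : 1 < ζ)
    (hQm : ∀ i, Measurable (Q i)) (hQ : ∀ w, Tendsto (fun i => Q i w) l (𝓝 0))
    (hui : ∀ ε : ℝ≥0∞, 0 < ε → ∃ D : Set α, MeasurableSet D ∧ μ D ≠ ∞ ∧ ∃ B : ℝ≥0∞, B ≠ ∞ ∧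
      ∀ᶠ i in l, ∫⁻ w in D, Q i w ^ ζ ∂μ ≤ B ∧ ∫⁻ w in Dᶜ, Q i w ∂μ ≤ ε) :
    Tendsto (fun i => ∫⁻ w, Q i w ∂μ) l (𝓝 0) := by
  rw [ENNReal.tendsto_nhds_zero]
  intro ε hε
  have hε3 : 0 < ε / 3 := ENNReal.div_pos hε.ne' (by simp)
  obtain ⟨D, hD, hDfin, B, hB, hDB⟩ := hui (ε / 3) hε3
  have hlim : Tendsto (fun n : ℕ => (n : ℝ≥0∞) ^ (1 - ζ) * B) atTop (𝓝 (0 * B)) := by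
    refine ENNReal.Tendsto.mul_const ?_ (Or.inr hB)
    have h1 := ENNReal.tendsto_nat_nhds_top
    have h2 := (ENNReal.continuous_rpow_const (y := 1 - ζ)).tendsto ∞
    rw [ENNReal.top_rpow_of_neg (by linarith)] at h2
    exact h2.comp h1
  rw [zero_mul] at hlim
  -- Truncation level: the part above n contributes at most n^{1-ζ} B ≤ ε/3 on D.
  obtain ⟨n, hn1, hn2⟩ := ((hlim.eventually_le_const hε3).and (eventually_ge_atTop 1)).exists
  have hn0 : (n : ℝ≥0∞) ≠ 0 := by simp; omega
  -- The truncated functions are bounded by n on a set of finite measure, so dominated convergence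
  -- applies.
  have hmin : Tendsto (fun i => ∫⁻ w in D, min (Q i w) n ∂μ) l (𝓝 (∫⁻ w in D, 0 ∂μ)) := by
    refine tendsto_lintegral_filter_of_dominated_convergence (fun _ => (n : ℝ≥0∞)) ?_ ?_ ?_ ?_
    · exact Eventually.of_forall fun i => (hQm i).min measurable_const
    · exact Eventually.of_forall fun i => ae_of_all _ fun w => min_le_right _ _
    · simp [ENNReal.mul_eq_top, hDfin]
    · refine ae_of_all _ fun w => ?_
      have := (hQ w).min (tendsto_const_nhds (x := (n : ℝ≥0∞)))
      simpa using this
  rw [lintegral_zero] at hmin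
  filter_upwards [hDB, hmin.eventually_le_const hε3] with i hi1 hi2
  calc ∫⁻ w, Q i w ∂μ = ∫⁻ w in D, Q i w ∂μ + ∫⁻ w in Dᶜ, Q i w ∂μ :=
        (lintegral_add_compl _ hD).symm
    _ ≤ (∫⁻ w in D, (min (Q i w) n + (n : ℝ≥0∞) ^ (1 - ζ) * Q i w ^ ζ) ∂μ) + ε / 3 := by
        gcongr with w
        · exact ENNReal_le_min_add_rpow hζ _ hn0 (by simp)
        · exact hi1.2
    _ = (∫⁻ w in D, min (Q i w) n ∂μ) + (n : ℝ≥0∞) ^ (1 - ζ) * (∫⁻ w in D, Q i w ^ ζ ∂μ)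
          + ε / 3 := by
        rw [lintegral_add_left ((hQm i).min measurable_const),
          lintegral_const_mul _ ((hQm i).pow_const _)]
    _ ≤ ε / 3 + (n : ℝ≥0∞) ^ (1 - ζ) * B + ε / 3 := by gcongr; exact hi1.1
    _ ≤ ε / 3 + ε / 3 + ε / 3 := by gcongr
    _ = ε := ENNReal.add_thirds ε

section Gradient

variable {E : Type*} [NormedAddCommGroup E] [InnerProductSpace ℝ E] [CompleteSpace E]
  [MeasurableSpace E] [BorelSpace E] [SecondCountableTopology E]

/-- The increment of a differentiable function is at most the integral of the norm of its
gradient. -/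
lemma enorm_sub_le_lintegral_gradient {f : E → ℝ} {g : E → E}
    (hgrad : ∀ y, HasGradientAt f (g y) y) (hg : Measurable g) (y₀ h : E) :
    ‖f (y₀ + h) - f y₀‖ₑ ≤ ‖h‖ₑ * ∫⁻ u in Ioc (0 : ℝ) 1, ‖g (y₀ + u • h)‖ₑ := by
  rw [← lintegral_const_mul _ (by fun_prop)]
  set φ : ℝ → ℝ := fun u => inner ℝ (g (y₀ + u • h)) h with hφ
  have hle : ∀ u : ℝ, ‖φ u‖ₑ ≤ ‖h‖ₑ * ‖g (y₀ + u • h)‖ₑ := fun u => by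
    rw [← ofReal_norm, ← ofReal_norm, ← ofReal_norm,
      ← ENNReal.ofReal_mul (norm_nonneg _), mul_comm]
    exact ENNReal.ofReal_le_ofReal (norm_inner_le_norm _ _)
  have hφm : Measurable φ := Measurable.inner (by fun_prop) measurable_const
  have hder : ∀ u : ℝ, HasDerivAt (fun u : ℝ => f (y₀ + u • h)) (φ u) u := fun u => by
    have h1 := (hgrad (y₀ + u • h)).hasFDerivAt
    have h2 : HasDerivAt (fun u : ℝ => y₀ + u • h) h u := by
      simpa using ((hasDerivAt_id u).smul_const h).const_add y₀
    have h3 := h1.comp_hasDerivAt u h2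
    rwa [InnerProductSpace.toDual_apply_apply] at h3
  -- Continuity of the gradient is not available. If the right side is infinite there is nothing to
  -- prove; otherwise the derivative along the segment is integrable, and the fundamental theorem of
  -- calculus for everywhere differentiable functions applies.
  rcases eq_or_ne (∫⁻ u in Ioc (0 : ℝ) 1, ‖h‖ₑ * ‖g (y₀ + u • h)‖ₑ) ∞ with htop | htop
  · rw [htop]; exact le_top
  have hint : IntervalIntegrable φ volume 0 1 := by
    rw [intervalIntegrable_iff_integrableOn_Ioc_of_le zero_le_one]
    exact ⟨hφm.aestronglyMeasurable,
      (lintegral_mono fun u => hle u).trans_lt htop.lt_top⟩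
  have hftc := intervalIntegral.integral_eq_sub_of_hasDerivAt (fun u _ => hder u) hint
  simp only [one_smul, zero_smul, add_zero] at hftc
  rw [← hftc, intervalIntegral.integral_of_le zero_le_one]
  exact (enorm_integral_le_lintegral_enorm _).trans (lintegral_mono fun u => hle u)

/-- Differentiation under the integral sign for integrands that are only differentiable, when the
gradients are uniformly integrable near the base point. -/
lemma hasGradientAt_integral_of_uniformly_integrable {α : Type*} [MeasurableSpace α]
    {μ : Measure α} [SFinite μ] {f : α → E → ℝ} {g : α → E → E} {y₀ : E} {ζ r : ℝ}
    (hζ : 1 < ζ) (hr : 0 < r) (hf : ∀ y, Measurable fun w => f w y)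
    (hg : Measurable fun q : α × E => g q.1 q.2)
    (hgrad : ∀ w y, HasGradientAt (f w) (g w y) y)
    (hfint : ∀ y, Integrable (fun w => f w y) μ) (hgint : Integrable (fun w => g w y₀) μ)
    (hui : ∀ ε : ℝ≥0∞, 0 < ε → ∃ D : Set α, MeasurableSet D ∧ μ D ≠ ∞ ∧ ∃ B : ℝ≥0∞, B ≠ ∞ ∧
      ∀ y ∈ Metric.ball y₀ r, ∫⁻ w in D, ‖g w y‖ₑ ^ ζ ∂μ ≤ B ∧
        ∫⁻ w in Dᶜ, ‖g w y‖ₑ ∂μ ≤ ε) :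
    HasGradientAt (fun y => ∫ w, f w y ∂μ) (∫ w, g w y₀ ∂μ) y₀ := by
  have hg' : ∀ y, Measurable fun w => g w y := fun y => hg.comp measurable_prodMk_right
  rw [hasGradientAt_iff_hasFDerivAt, hasFDerivAt_iff_tendsto]
  set R : E → α → ℝ := fun y w => f w y - f w y₀ - inner ℝ (g w y₀) (y - y₀) with hR
  have hRm : ∀ y, Measurable (R y) := fun y =>
    ((hf y).sub (hf y₀)).sub ((hg' y₀).inner measurable_const)
  -- Q is the normalised first-order remainder. It tends to 0 pointwise by differentiability and is
  -- dominated by q, the average of the gradient norm over the segment plus its value at y₀, so it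
  -- inherits uniform integrability from the gradients.
  set Q : E → α → ℝ≥0∞ := fun y w => ‖‖y - y₀‖⁻¹ * R y w‖ₑ with hQ
  have hQm : ∀ y, Measurable (Q y) := fun y => ((hRm y).const_mul _).enorm
  set q : E → α → ℝ≥0∞ := fun y w =>
    (∫⁻ u in Ioc (0 : ℝ) 1, ‖g w (y₀ + u • (y - y₀))‖ₑ) + ‖g w y₀‖ₑ with hq
  have hgm3 : ∀ y, Measurable fun v : α × ℝ => ‖g v.1 (y₀ + v.2 • (y - y₀))‖ₑ := fun y =>
    (hg.comp (g := fun q => g q.1 q.2)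
      (f := fun v : α × ℝ => (v.1, y₀ + v.2 • (y - y₀))) (by fun_prop)).enorm
  have hQq : ∀ y w, Q y w ≤ q y w := fun y w => by
    rcases eq_or_ne y y₀ with rfl | hy
    · simp [hQ]
    have hn : ‖y - y₀‖ₑ ≠ 0 := by simpa [sub_eq_zero] using hy
    have h1 := enorm_sub_le_lintegral_gradient (hgrad w) (hg.comp measurable_prodMk_left) y₀
      (y - y₀)
    rw [add_sub_cancel] at h1
    have h2 : ‖inner ℝ (g w y₀) (y - y₀)‖ₑ ≤ ‖y - y₀‖ₑ * ‖g w y₀‖ₑ := by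
      rw [← ofReal_norm, ← ofReal_norm, ← ofReal_norm,
        ← ENNReal.ofReal_mul (norm_nonneg _), mul_comm]
      exact ENNReal.ofReal_le_ofReal (norm_inner_le_norm _ _)
    have h3 : ‖R y w‖ₑ ≤ ‖y - y₀‖ₑ * q y w := by
      refine (enorm_sub_le).trans ?_
      rw [hq, mul_add]
      gcongr
    simp only [hQ]
    rw [enorm_mul, enorm_inv (by simpa [sub_eq_zero] using hy), enorm_norm,
      mul_comm, ← div_eq_mul_inv]
    exact ENNReal.div_le_of_le_mul' h3
  have hball : ∀ y ∈ Metric.ball y₀ r, ∀ u ∈ Ioc (0 : ℝ) 1,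
      y₀ + u • (y - y₀) ∈ Metric.ball y₀ r := fun y hy u hu => by
    rw [Metric.mem_ball, dist_eq_norm] at hy ⊢
    rw [add_sub_cancel_left, norm_smul, Real.norm_of_nonneg hu.1.le]
    exact (mul_le_of_le_one_left (norm_nonneg _) hu.2).trans_lt hy
  -- Total mass one on the segment parameter permits Jensen's inequality for the ζ-th power of the
  -- average.
  have hP : IsProbabilityMeasure (volume.restrict (Ioc (0 : ℝ) 1)) := ⟨by simp⟩
  have hQlim : Tendsto (fun y => ∫⁻ w, Q y w ∂μ) (𝓝 y₀) (𝓝 0) := by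
    refine tendsto_lintegral_of_uniformly_integrable hζ hQm (fun w => ?_) fun ε hε => ?_
    · have h := hasFDerivAt_iff_tendsto.1 (hgrad w y₀).hasFDerivAt
      have h' := (ENNReal.continuous_ofReal.tendsto 0).comp h
      simp only [ENNReal.ofReal_zero] at h'
      refine h'.congr fun y => ?_
      simp only [hQ, hR, Function.comp]
      rw [← ofReal_norm, norm_mul, norm_inv, norm_norm]
      simp
    -- ε/2 for each of the two terms of q. The constant 2^{ζ-1}(B + B) comes from (a + b)^ζ ≤
    -- 2^{ζ-1}(a^ζ + b^ζ), Jensen, and Tonelli along the segment, which stays in the ball.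
    · obtain ⟨D, hD, hDfin, B, hB, hDB⟩ := hui (ε / 2) (ENNReal.half_pos hε.ne')
      refine ⟨D, hD, hDfin, 2 ^ (ζ - 1) * (B + B), ENNReal.mul_ne_top
        (ENNReal.rpow_ne_top_of_nonneg (by linarith) (by simp)) (by simp [hB]), ?_⟩
      filter_upwards [Metric.ball_mem_nhds y₀ hr] with y hy
      constructor
      · calc ∫⁻ w in D, Q y w ^ ζ ∂μ ≤ ∫⁻ w in D, 2 ^ (ζ - 1) *
              ((∫⁻ u in Ioc (0 : ℝ) 1, ‖g w (y₀ + u • (y - y₀))‖ₑ ^ ζ) + ‖g w y₀‖ₑ ^ ζ) ∂μ := by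
              refine lintegral_mono fun w => ?_
              refine (ENNReal.rpow_le_rpow (hQq y w) (by linarith)).trans ?_
              refine (ENNReal.rpow_add_le_mul_rpow_add_rpow _ _ hζ.le).trans ?_
              gcongr
              refine rpow_lintegral_le _ hζ ?_
              exact ((hgm3 y).comp measurable_prodMk_left).aemeasurable
          _ = 2 ^ (ζ - 1) * ((∫⁻ u in Ioc (0 : ℝ) 1, ∫⁻ w in D,
                ‖g w (y₀ + u • (y - y₀))‖ₑ ^ ζ ∂μ) + ∫⁻ w in D, ‖g w y₀‖ₑ ^ ζ ∂μ) := by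
              rw [lintegral_const_mul, lintegral_add_right, lintegral_lintegral_swap]
              · exact ((hgm3 y).pow_const ζ).aemeasurable
              · exact (hg' y₀).enorm.pow_const ζ
              · exact Measurable.add
                  (Measurable.lintegral_prod_right' ((hgm3 y).pow_const ζ))
                  ((hg' y₀).enorm.pow_const ζ)
          _ ≤ 2 ^ (ζ - 1) * ((∫⁻ u in Ioc (0 : ℝ) 1, B) + B) := by
              exact mul_le_mul_right (add_le_add (setLIntegral_mono measurable_const fun u hu =>
                (hDB _ (hball y hy u hu)).1) (hDB _ (Metric.mem_ball_self hr)).1) _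
          _ = 2 ^ (ζ - 1) * (B + B) := by simp
      · calc ∫⁻ w in Dᶜ, Q y w ∂μ ≤ ∫⁻ w in Dᶜ, q y w ∂μ := lintegral_mono fun w => hQq y w
          _ = (∫⁻ u in Ioc (0 : ℝ) 1, ∫⁻ w in Dᶜ, ‖g w (y₀ + u • (y - y₀))‖ₑ ∂μ) +
                ∫⁻ w in Dᶜ, ‖g w y₀‖ₑ ∂μ := by
              rw [lintegral_add_right, lintegral_lintegral_swap]
              · exact (hgm3 y).aemeasurable
              · exact (hg' y₀).enorm
          _ ≤ (∫⁻ u in Ioc (0 : ℝ) 1, ε / 2) + ε / 2 := by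
              exact add_le_add (setLIntegral_mono measurable_const fun u hu =>
                (hDB _ (hball y hy u hu)).2) (hDB _ (Metric.mem_ball_self hr)).2
          _ = ε := by simp
  have hreal := (ENNReal.tendsto_toReal (by simp : (0 : ℝ≥0∞) ≠ ∞)).comp hQlim
  simp only [ENNReal.toReal_zero] at hreal
  have hfin : ∀ᶠ y in 𝓝 y₀, ∫⁻ w, Q y w ∂μ < ∞ := hQlim.eventually_lt_const (by simp)
  refine squeeze_zero' (Eventually.of_forall fun y => by positivity) ?_ hreal
  filter_upwards [hfin] with y hy
  have e1 : (∫ w, f w y ∂μ) - (∫ w, f w y₀ ∂μ) -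
      (InnerProductSpace.toDual ℝ E (∫ w, g w y₀ ∂μ)) (y - y₀) = ∫ w, R y w ∂μ := by
    rw [InnerProductSpace.toDual_apply_apply, hR, integral_sub, integral_sub (hfint y) (hfint y₀)]
    · congr 1
      rw [real_inner_comm, ← integral_inner hgint]
      simp only [real_inner_comm]
    · exact (hfint y).sub (hfint y₀)
    · exact hgint.inner_const _
  rw [e1]
  calc ‖y - y₀‖⁻¹ * ‖∫ w, R y w ∂μ‖ = ‖∫ w, ‖y - y₀‖⁻¹ * R y w ∂μ‖ := by
        rw [integral_const_mul, norm_mul, norm_inv, norm_norm]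
    _ ≤ _ := by
        rw [← toReal_enorm]
        exact ENNReal.toReal_mono hy.ne (enorm_integral_le_lintegral_enorm _)

end Gradient

/-! ### Kernels cut off outside `(0, T]` -/

/-- The kernel `k` on times in `(0, T]`, extended by zero. -/
noncomputable def cut {E F : Type*} [Zero F] (T : ℝ) (k : ℝ → E → E → F) (t : ℝ) (x y : E) : F :=
  if 0 < t ∧ t ≤ T then k t x y else 0

section Cut

variable {E F : Type*}

lemma cut_of_mem [Zero F] {T t : ℝ} {k : ℝ → E → E → F} (ht : t ∈ Ioc 0 T) (x y : E) :
    cut T k t x y = k t x y := if_pos ht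

lemma cut_of_notMem [Zero F] {T t : ℝ} {k : ℝ → E → E → F} (ht : t ∉ Ioc 0 T) (x y : E) :
    cut T k t x y = 0 := if_neg ht

lemma measurable_cut [Zero F] [MeasurableSpace E] [MeasurableSpace F] {T : ℝ} {k : ℝ → E → E → F}
    (hk : Measurable fun q : ℝ × E × E => k q.1 q.2.1 q.2.2) :
    Measurable fun q : ℝ × E × E => cut T k q.1 q.2.1 q.2.2 :=
  Measurable.ite (measurable_fst measurableSet_Ioc) hk measurable_const

lemma enorm_pathProd (k : ℝ → E → E → ℝ) {m : ℕ} (x : E) (δ : Fin m → ℝ) (w : Fin m → E) :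
    ‖pathProd k x δ w‖ₑ = pathProd (fun t y z => ‖k t y z‖ₑ) x δ w := by
  simp only [pathProd, enorm_eq_nnnorm, nnnorm_prod, ENNReal.ofNNReal_finsetProd]

lemma pathProd_eq_zero {M : Type*} [CommMonoidWithZero M] {k : ℝ → E → E → M} {m : ℕ} {x : E}
    {δ : Fin m → ℝ} {w : Fin m → E} (i : Fin m) (h : ∀ y z, k (δ i) y z = 0) :
    pathProd k x δ w = 0 :=
  Finset.prod_eq_zero (Finset.mem_univ i) (h _ _)

end Cut

/-! ### Integrals over space-time paths -/

section PathTerm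

variable {E F : Type*} [MeasureSpace E] [NormedAddCommGroup F] [NormedSpace ℝ F]

/-- The integral of `∏ a_{δ_i}(y_i, y_{i+1}) G_{t - ∑ δ_i}(y_m, y)` over all increments `δ` and
all paths of `m` steps. -/
noncomputable def pathTerm (a : ℝ → E → E → ℝ) (G : ℝ → E → E → F) (m : ℕ) (t : ℝ) (x y : E) : F :=
  ∫ q : (Fin m → ℝ) × (Fin m → E),
    pathProd a x q.1 q.2 • G (t - ∑ i, q.1 i) (pathEnd x q.2) y

/-- A bound on space integrals of path products by time singularities. -/
def PathBound (σ : ℝ) (A : ℝ≥0∞) (a : ℝ → E → E → ℝ) (G : ℝ → E → E → F) (t : ℝ) (x y : E) :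
    Prop :=
  ∀ m : ℕ, 1 ≤ m → ∀ δ : Fin m → ℝ,
    ∫⁻ w : Fin m → E, ‖pathProd a x δ w • G (t - ∑ i, δ i) (pathEnd x w) y‖ₑ ≤
      A ^ (m + 1) * ((∏ i, timeSing σ 0 (δ i)) * timeSing σ 0 (t - ∑ i, δ i))

variable [MeasurableSpace F] [BorelSpace F] [SecondCountableTopology F]

lemma measurable_pathIntegrand {a : ℝ → E → E → ℝ} {G : ℝ → E → E → F}
    (ha : Measurable fun q : ℝ × E × E => a q.1 q.2.1 q.2.2)
    (hG : Measurable fun q : ℝ × E × E => G q.1 q.2.1 q.2.2) (m : ℕ) (t : ℝ) (x : E) :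
    Measurable fun q : ((Fin m → ℝ) × (Fin m → E)) × E =>
      pathProd a x q.1.1 q.1.2 • G (t - ∑ i, q.1.1 i) (pathEnd x q.1.2) q.2 := by
  refine Measurable.smul ?_ ?_
  · exact (measurable_pathProd ha x).comp measurable_fst
  · exact hG.comp (f := fun q : ((Fin m → ℝ) × (Fin m → E)) × E =>
      (t - ∑ i, q.1.1 i, pathEnd x q.1.2, q.2)) (by fun_prop)

variable [SigmaFinite (volume : Measure E)]

/-- Tonelli, integrating over the points of the path first; this reduces everything to the
convolution of time singularities. -/
lemma PathBound.lintegral_le {a : ℝ → E → E → ℝ} {G : ℝ → E → E → F}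
    (ha : Measurable fun q : ℝ × E × E => a q.1 q.2.1 q.2.2)
    (hG : Measurable fun q : ℝ × E × E => G q.1 q.2.1 q.2.2) {σ t : ℝ} {A : ℝ≥0∞} {x y : E}
    (h : PathBound σ A a G t x y) {m : ℕ} (hm : 1 ≤ m) :
    ∫⁻ q : (Fin m → ℝ) × (Fin m → E),
        ‖pathProd a x q.1 q.2 • G (t - ∑ i, q.1 i) (pathEnd x q.2) y‖ₑ ≤
      A ^ (m + 1) * ∫⁻ δ : Fin m → ℝ,
        (∏ i, timeSing σ 0 (δ i)) * timeSing σ 0 (t - ∑ i, δ i) := by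
  rw [Measure.volume_eq_prod, lintegral_prod, ← lintegral_const_mul _ (by fun_prop)]
  · exact lintegral_mono fun δ => h m hm δ
  · exact ((measurable_pathIntegrand ha hG m t x).comp
      (measurable_prodMk_right (y := y))).enorm.aemeasurable

/-- The path integrals are dominated by a geometric sequence. -/
lemma PathBound.exists_lintegral_le {a : ℝ → E → E → ℝ} {G : ℝ → E → E → F}
    (ha : Measurable fun q : ℝ × E × E => a q.1 q.2.1 q.2.2)
    (hG : Measurable fun q : ℝ × E × E => G q.1 q.2.1 q.2.2) {σ t : ℝ} (hσ : σ ∈ Ico (0 : ℝ) 1)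
    {A : ℝ≥0∞} (hA : A ≠ ∞) {x : E} :
    ∃ C : ℝ≥0∞, C ≠ ∞ ∧ ∀ y, PathBound σ A a G t x y → ∀ m : ℕ, 1 ≤ m →
      ∫⁻ q : (Fin m → ℝ) × (Fin m → E),
        ‖pathProd a x q.1 q.2 • G (t - ∑ i, q.1 i) (pathEnd x q.2) y‖ₑ ≤ C * 2⁻¹ ^ m := by
  obtain ⟨C, hC, hCm⟩ := exists_lintegral_prod_timeSing_le hσ.1 hσ.2 t hA
  refine ⟨A * C, ENNReal.mul_ne_top hA hC, fun y h m hm => (h.lintegral_le ha hG hm).trans ?_⟩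
  rw [pow_succ', mul_assoc, mul_assoc]
  exact mul_le_mul_right (hCm m) _

lemma PathBound.integrable {a : ℝ → E → E → ℝ} {G : ℝ → E → E → F}
    (ha : Measurable fun q : ℝ × E × E => a q.1 q.2.1 q.2.2)
    (hG : Measurable fun q : ℝ × E × E => G q.1 q.2.1 q.2.2) {σ t : ℝ} (hσ : σ ∈ Ico (0 : ℝ) 1)
    {A : ℝ≥0∞} (hA : A ≠ ∞) {x y : E} (h : PathBound σ A a G t x y) {m : ℕ} (hm : 1 ≤ m) :
    Integrable fun q : (Fin m → ℝ) × (Fin m → E) =>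
        pathProd a x q.1 q.2 • G (t - ∑ i, q.1 i) (pathEnd x q.2) y := by
  obtain ⟨C, hC, hCm⟩ := PathBound.exists_lintegral_le ha hG hσ hA (t := t) (x := x)
  refine ⟨((measurable_pathIntegrand ha hG m t x).comp
      (measurable_prodMk_right (y := y))).aestronglyMeasurable, (hCm y h m hm).trans_lt ?_⟩
  exact ENNReal.mul_lt_top hC.lt_top (ENNReal.pow_lt_top (by simp))

end PathTerm

/-! ### The iterated integrals as integrals over paths -/

section Flatten

variable {d : ℕ}

lemma pathTerm_eq_zero {a G : ℝ → Space d → Space d → ℝ} (ha : ∀ t ≤ 0, ∀ x y, a t x y = 0)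
    (hG : ∀ t ≤ 0, ∀ x y, G t x y = 0) (m : ℕ) {t : ℝ} (ht : t ≤ 0) (x y : Space d) :
    pathTerm a G m t x y = 0 := by
  refine integral_eq_zero_of_ae (ae_of_all _ fun q => ?_)
  simp only [Pi.zero_apply, smul_eq_mul, mul_eq_zero]
  by_cases h : ∃ i, q.1 i ≤ 0
  · obtain ⟨i, hi⟩ := h
    exact Or.inl (pathProd_eq_zero i (ha _ hi))
  · push Not at h
    exact Or.inr (hG _ (by linarith [Finset.sum_nonneg fun i (_ : i ∈ Finset.univ) => (h i).le]) _ _)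

lemma volume_prod_fin_zero :
    volume (univ : Set ((Fin 0 → ℝ) × (Fin 0 → Space d))) = 1 := by
  rw [Measure.volume_eq_prod, ← univ_prod_univ, Measure.prod_prod]
  simp [volume_pi]

/-- The space of paths with no step is a single point of mass one; this term accounts for the
leading term of the density and for the event of no jump. -/
lemma pathTerm_zero {F : Type*} [NormedAddCommGroup F] [NormedSpace ℝ F] [CompleteSpace F]
    (a : ℝ → Space d → Space d → ℝ) (G : ℝ → Space d → Space d → F) (t : ℝ) (x y : Space d) :
    pathTerm a G 0 t x y = G t x y := by
  have h : ∀ q : (Fin 0 → ℝ) × (Fin 0 → Space d),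
      pathProd a x q.1 q.2 • G (t - ∑ i, q.1 i) (pathEnd x q.2) y = G t x y := fun q => by simp
  simp only [pathTerm, h, integral_const]
  rw [measureReal_def, volume_prod_fin_zero, ENNReal.toReal_one, one_smul]

/-- In the flattened integral over n + 1 steps, the last step is parametrised by its arrival time s
and position z. Fubini then isolates the path integral over the first n increments and points, which
is the iterated kernel at (s, z). -/
lemma expansionTerm_eq_pathTerm_of_iterKernel {a G : ℝ → Space d → Space d → ℝ} {T : ℝ} {n : ℕ}
    (ha0 : ∀ t ≤ 0, ∀ x y, a t x y = 0) (hG0 : ∀ t ≤ 0, ∀ x y, G t x y = 0)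
    (hiter : ∀ s ∈ Ioc 0 T, ∀ x z, iterKernel a n s x z = pathTerm a a n s x z)
    {t : ℝ} (ht : t ∈ Ioc 0 T) {x y : Space d}
    (hint : Integrable fun q : (Fin (n + 1) → ℝ) × (Fin (n + 1) → Space d) =>
        pathProd a x q.1 q.2 • G (t - ∑ i, q.1 i) (pathEnd x q.2) y) :
    expansionTerm a G n t x y = pathTerm a G (n + 1) t x y := by
  have hΨ := measurePreserving_extendPath (E := Space d) n
  have hcomp : ∀ v : (ℝ × Space d) × ((Fin n → ℝ) × (Fin n → Space d)),
      pathProd a x (Fin.snoc v.2.1 (v.1.1 - ∑ i, v.2.1 i) : Fin (n + 1) → ℝ)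
        (Fin.snoc v.2.2 v.1.2 : Fin (n + 1) → Space d) •
        G (t - ∑ i, (Fin.snoc v.2.1 (v.1.1 - ∑ i, v.2.1 i) : Fin (n + 1) → ℝ) i)
          (pathEnd x (Fin.snoc v.2.2 v.1.2 : Fin (n + 1) → Space d)) y =
      G (t - v.1.1) v.1.2 y *
        (pathProd a x v.2.1 v.2.2 • a (v.1.1 - ∑ i, v.2.1 i) (pathEnd x v.2.2) v.1.2) := by
    intro v
    rw [pathProd_snoc, pathEnd_snoc, Fin.sum_univ_castSucc]
    simp only [Fin.snoc_castSucc, Fin.snoc_last, smul_eq_mul, add_sub_cancel]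
    ring
  have hint2 : Integrable fun v : (ℝ × Space d) × ((Fin n → ℝ) × (Fin n → Space d)) =>
      G (t - v.1.1) v.1.2 y *
        (pathProd a x v.2.1 v.2.2 • a (v.1.1 - ∑ i, v.2.1 i) (pathEnd x v.2.2) v.1.2) := by
    have := hΨ.integrable_comp_of_integrable hint
    refine this.congr (ae_of_all _ fun v => ?_)
    exact hcomp v
  have hmain : pathTerm a G (n + 1) t x y =
      ∫ s : ℝ, ∫ z, G (t - s) z y * pathTerm a a n s x z := by
    rw [pathTerm, ← hΨ.map_eq, integral_map hΨ.measurable.aemeasurable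
      (by rw [hΨ.map_eq]; exact hint.aestronglyMeasurable)]
    simp only [hcomp]
    rw [Measure.volume_eq_prod, integral_prod _ hint2]
    simp only [integral_const_mul]
    have := hint2.integral_prod_left
    simp only [integral_const_mul] at this
    rw [Measure.volume_eq_prod, integral_prod _ this]
    rfl
  rw [hmain, expansionTerm, intervalIntegral.integral_of_le ht.1.le,
    ← integral_indicator measurableSet_Ioc]
  refine integral_congr_ae (ae_of_all _ fun s => ?_)
  -- The flattened integral runs over all real s. Outside (0, t] it vanishes: for s ≤ 0 no
  -- admissible path exists, and for s > t the final kernel has negative time.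
  by_cases hs : s ∈ Ioc 0 t
  · rw [indicator_of_mem hs]
    simp only [hiter s ⟨hs.1, hs.2.trans ht.2⟩]
  · rw [indicator_of_notMem hs]
    symm
    refine integral_eq_zero_of_ae (ae_of_all _ fun z => ?_)
    simp only [Pi.zero_apply, mul_eq_zero]
    by_cases h0 : s ≤ 0
    · exact Or.inr (pathTerm_eq_zero ha0 ha0 n h0 x z)
    · refine Or.inl (hG0 _ ?_ _ _)
      simp only [mem_Ioc, not_and, not_le] at hs h0
      linarith [hs h0]

/-- The substitution s ↦ t - s exhibits the recursion for the iterated kernel as an expansion term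
with final kernel a, so one flattening lemma serves both. -/
lemma iterKernel_succ_eq_expansionTerm (a : ℝ → Space d → Space d → ℝ) (n : ℕ) (t : ℝ)
    (x y : Space d) : iterKernel a (n + 1) t x y = expansionTerm a a n t x y := by
  have h := intervalIntegral.integral_comp_sub_left
    (fun s => ∫ z, iterKernel a n s x z * a (t - s) z y) t (a := 0) (b := t)
  simp only [sub_sub_cancel, sub_self, sub_zero] at h
  refine h.trans ?_
  simp only [expansionTerm, mul_comm]

lemma iterKernel_eq_pathTerm {a : ℝ → Space d → Space d → ℝ} {T : ℝ}
    (ha0 : ∀ t ≤ 0, ∀ x y, a t x y = 0)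
    (hint : ∀ t ∈ Ioc 0 T, ∀ x y, ∀ m : ℕ, 1 ≤ m →
      Integrable fun q : (Fin m → ℝ) × (Fin m → Space d) =>
        pathProd a x q.1 q.2 • a (t - ∑ i, q.1 i) (pathEnd x q.2) y) (n : ℕ) :
    ∀ t ∈ Ioc 0 T, ∀ x y, iterKernel a n t x y = pathTerm a a n t x y := by
  induction n with
  | zero => intro t _ x y; rw [pathTerm_zero]; rfl
  | succ n ih =>
    intro t ht x y
    rw [iterKernel_succ_eq_expansionTerm]
    exact expansionTerm_eq_pathTerm_of_iterKernel ha0 ha0 ih ht (hint t ht x y _ (by omega))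

lemma expansionTerm_congr {a a' G G' : ℝ → Space d → Space d → ℝ} {T t : ℝ} {n : ℕ}
    (ht : t ∈ Ioc 0 T) (hG : ∀ s ∈ Ioc 0 T, ∀ x y, G s x y = G' s x y)
    (h : ∀ s ∈ Ioc 0 T, ∀ x y, iterKernel a n s x y = iterKernel a' n s x y) (x y : Space d) :
    expansionTerm a G n t x y = expansionTerm a' G' n t x y := by
  refine intervalIntegral.integral_congr_ae ?_
  -- The end point s = t must be discarded: there the final kernel is evaluated at time 0, where the
  -- kernels are not assumed to agree.
  filter_upwards [(measure_eq_zero_iff_ae_notMem.1 (measure_singleton t) :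
    ∀ᵐ s : ℝ, s ∉ ({t} : Set ℝ))] with s hs hst
  rw [uIoc_of_le ht.1.le] at hst
  have hlt : s < t := lt_of_le_of_ne hst.2 hs
  simp only [h s ⟨hst.1, hst.2.trans ht.2⟩, hG (t - s) ⟨by linarith, by linarith [hst.1, ht.2]⟩]

lemma iterKernel_congr {a a' : ℝ → Space d → Space d → ℝ} {T : ℝ}
    (ha : ∀ s ∈ Ioc 0 T, ∀ x y, a s x y = a' s x y) (n : ℕ) :
    ∀ t ∈ Ioc 0 T, ∀ x y, iterKernel a n t x y = iterKernel a' n t x y := by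
  induction n with
  | zero => exact ha
  | succ n ih =>
    intro t ht x y
    rw [iterKernel_succ_eq_expansionTerm, iterKernel_succ_eq_expansionTerm]
    exact expansionTerm_congr ht ha ih x y

/-- The terms of the expansion are integrals over paths. -/
lemma expansionTerm_eq_pathTerm {a G : ℝ → Space d → Space d → ℝ} {T : ℝ}
    (hint : ∀ t ∈ Ioc 0 T, ∀ x y, ∀ m : ℕ, 1 ≤ m →
      Integrable fun q : (Fin m → ℝ) × (Fin m → Space d) =>
        pathProd (cut T a) x q.1 q.2 • cut T a (t - ∑ i, q.1 i) (pathEnd x q.2) y)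
    (n : ℕ) {t : ℝ} (ht : t ∈ Ioc 0 T) {x y : Space d}
    (hintG : Integrable fun q : (Fin (n + 1) → ℝ) × (Fin (n + 1) → Space d) =>
        pathProd (cut T a) x q.1 q.2 • cut T G (t - ∑ i, q.1 i) (pathEnd x q.2) y) :
    expansionTerm a G n t x y = pathTerm (cut T a) (cut T G) (n + 1) t x y := by
  have h0 : ∀ k : ℝ → Space d → Space d → ℝ, ∀ t ≤ 0, ∀ x y, cut T k t x y = 0 :=
    fun k t ht x y => cut_of_notMem (fun h => ht.not_gt h.1) x y
  rw [expansionTerm_congr (a' := cut T a) (G' := cut T G) ht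
    (fun s hs x y => (cut_of_mem hs x y).symm)
    (iterKernel_congr (fun s hs x y => (cut_of_mem hs x y).symm) n)]
  exact expansionTerm_eq_pathTerm_of_iterKernel (h0 a) (h0 G)
    (iterKernel_eq_pathTerm (h0 a) hint n) ht hintG

end Flatten

/-! ### Bounds on path products from bounds on kernels -/

/-- Replaces different singularity exponents by a common larger one at the cost of a power of T. -/
lemma ofReal_rpow_neg_le_timeSing {κ σ T s : ℝ} (hκ : κ ≤ σ) (hs : s ∈ Ioc 0 T) :
    ENNReal.ofReal (s ^ (-κ)) ≤ ENNReal.ofReal (T ^ (σ - κ)) * timeSing σ 0 s := by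
  have hs0 : 0 < s := hs.1
  have hT : 0 < T := hs.1.trans_le hs.2
  rw [timeSing_zero_of_pos hs.1, ← ENNReal.ofReal_mul (by positivity)]
  refine ENNReal.ofReal_le_ofReal ?_
  calc s ^ (-κ) = s ^ (σ - κ) * s ^ (-σ) := by rw [← Real.rpow_add hs.1]; ring_nf
    _ ≤ T ^ (σ - κ) * s ^ (-σ) := by
        gcongr
        exact hs.2

section KernelBounds

variable {d : ℕ} {F : Type*} [NormedAddCommGroup F]

lemma sub_sum_mem_Ioc {m : ℕ} {δ : Fin m → ℝ} {t T : ℝ} (ht : t ∈ Ioc 0 T) (hδ : ∀ i, 0 < δ i)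
    (hsum : ∑ i, δ i < t) : t - ∑ i, δ i ∈ Ioc 0 T :=
  ⟨by linarith, by linarith [Finset.sum_nonneg fun i (_ : i ∈ Finset.univ) => (hδ i).le, ht.2]⟩

lemma increment_mem_Ioc {m : ℕ} {δ : Fin m → ℝ} {t T : ℝ} (ht : t ≤ T) (hδ : ∀ i, 0 < δ i)
    (hsum : ∑ i, δ i < t) (i : Fin m) : δ i ∈ Ioc 0 T :=
  ⟨hδ i, by linarith [Finset.single_le_sum (fun j _ => (hδ j).le) (Finset.mem_univ i)]⟩

lemma pathProd_nonneg {k : ℝ → Space d → Space d → ℝ} {m : ℕ} {x : Space d} {δ : Fin m → ℝ}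
    {w : Fin m → Space d} (h : ∀ i y z, 0 ≤ k (δ i) y z) : 0 ≤ pathProd k x δ w :=
  Finset.prod_nonneg fun _ _ => h _ _ _

lemma ofReal_pathProd {k : ℝ → Space d → Space d → ℝ} {m : ℕ} {x : Space d} {δ : Fin m → ℝ}
    {w : Fin m → Space d} (h : ∀ i y z, 0 ≤ k (δ i) y z) :
    ENNReal.ofReal (pathProd k x δ w) = pathProd (fun t y z => ENNReal.ofReal (k t y z)) x δ w :=
  ENNReal.ofReal_prod_of_nonneg fun _ _ => h _ _ _

lemma enorm_pathProd_cut_le {T σ : ℝ} {a γ : ℝ → Space d → Space d → ℝ} {A : ℝ≥0∞}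
    (hγ : ∀ t ∈ Ioc 0 T, ∀ x y, 0 ≤ γ t x y)
    (ha : ∀ s ∈ Ioc 0 T, ∀ x y, ‖a s x y‖ₑ ≤ A * timeSing σ 0 s * ENNReal.ofReal (γ s x y))
    {m : ℕ} (x : Space d) (δ : Fin m → ℝ) (w : Fin m → Space d) :
    ‖pathProd (cut T a) x δ w‖ₑ ≤
      A ^ m * (∏ i, timeSing σ 0 (δ i)) * ENNReal.ofReal (pathProd γ x δ w) := by
  by_cases hδ : ∀ i, δ i ∈ Ioc 0 T
  · rw [enorm_pathProd, ofReal_pathProd fun i => hγ _ (hδ i), pathProd, pathProd]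
    calc _ ≤ ∏ i, (A * timeSing σ 0 (δ i) * ENNReal.ofReal (γ (δ i)
            ((Fin.cons x w : Fin (m + 1) → Space d) i.castSucc) (w i))) :=
          Finset.prod_le_prod' fun i _ => by rw [cut_of_mem (hδ i)]; exact ha _ (hδ i) _ _
      _ = _ := by simp only [Finset.prod_mul_distrib, Finset.prod_const, Finset.card_univ,
            Fintype.card_fin]
  · push Not at hδ
    obtain ⟨i, hi⟩ := hδ
    rw [pathProd_eq_zero i (cut_of_notMem hi), enorm_zero]
    exact zero_le

lemma pathProd_smul_cut_eq_zero [NormedSpace ℝ F] {T t : ℝ} {a : ℝ → Space d → Space d → ℝ}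
    {G : ℝ → Space d → Space d → F} {m : ℕ} {δ : Fin m → ℝ}
    (h : ¬ ((∀ i, 0 < δ i) ∧ ∑ i, δ i < t)) (x y : Space d) (w : Fin m → Space d) :
    pathProd (cut T a) x δ w • cut T G (t - ∑ i, δ i) (pathEnd x w) y = 0 := by
  by_cases hδ : ∀ i, 0 < δ i
  · rw [cut_of_notMem (fun h' => h ⟨hδ, by linarith [h'.1]⟩), smul_zero]
  · push Not at hδ
    obtain ⟨i, hi⟩ := hδ
    rw [pathProd_eq_zero i (cut_of_notMem fun h' => hi.not_gt h'.1), zero_smul]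

lemma enorm_pathProd_smul_cut_le [NormedSpace ℝ F] {T σ : ℝ} {a γ : ℝ → Space d → Space d → ℝ} {A : ℝ≥0∞}
    {G : ℝ → Space d → Space d → F}
    (hγ : ∀ t ∈ Ioc 0 T, ∀ x y, 0 ≤ γ t x y)
    (ha : ∀ s ∈ Ioc 0 T, ∀ x y, ‖a s x y‖ₑ ≤ A * timeSing σ 0 s * ENNReal.ofReal (γ s x y))
    {t : ℝ} (ht : t ∈ Ioc 0 T) {m : ℕ} {δ : Fin m → ℝ} (hδ : ∀ i, 0 < δ i)
    (hsum : ∑ i, δ i < t) (x y : Space d) (w : Fin m → Space d) :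
    ‖pathProd (cut T a) x δ w • cut T G (t - ∑ i, δ i) (pathEnd x w) y‖ₑ ≤
      A ^ m * (∏ i, timeSing σ 0 (δ i)) *
        ENNReal.ofReal (pathProd γ x δ w * ‖cut T G (t - ∑ i, δ i) (pathEnd x w) y‖) := by
  rw [enorm_smul, ENNReal.ofReal_mul (pathProd_nonneg fun i =>
    hγ _ (increment_mem_Ioc ht.2 hδ hsum i)), ← mul_assoc, ofReal_norm]
  gcongr
  exact enorm_pathProd_cut_le hγ ha x δ w

/-- The factors of a contribute their time singularities, which are constants at fixed increments,
so only chains of γ ending in G need to be estimated. Off the simplex of admissible increments the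
integrand is zero. -/
lemma PathBound.of_lintegral_le [NormedSpace ℝ F] {T σ : ℝ} {a γ : ℝ → Space d → Space d → ℝ} {A B : ℝ≥0∞}
    {G : ℝ → Space d → Space d → F} (hA : A ≠ ∞) (hA1 : 1 ≤ A)
    (hγ : ∀ t ∈ Ioc 0 T, ∀ x y, 0 ≤ γ t x y)
    (ha : ∀ s ∈ Ioc 0 T, ∀ x y, ‖a s x y‖ₑ ≤ A * timeSing σ 0 s * ENNReal.ofReal (γ s x y))
    {t : ℝ} (ht : t ∈ Ioc 0 T) {x y : Space d}
    (h : ∀ m : ℕ, 1 ≤ m → ∀ δ : Fin m → ℝ, (∀ i, 0 < δ i) → ∑ i, δ i < t →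
      ∫⁻ w : Fin m → Space d, ENNReal.ofReal (pathProd γ x δ w *
        ‖cut T G (t - ∑ i, δ i) (pathEnd x w) y‖) ≤
        B ^ (m + 1) * timeSing σ 0 (t - ∑ i, δ i)) :
    PathBound σ (A * B) (cut T a) (cut T G) t x y := by
  intro m hm δ
  by_cases hδ : (∀ i, 0 < δ i) ∧ ∑ i, δ i < t
  · calc _ ≤ ∫⁻ w, A ^ m * (∏ i, timeSing σ 0 (δ i)) *
          ENNReal.ofReal (pathProd γ x δ w * ‖cut T G (t - ∑ i, δ i) (pathEnd x w) y‖) :=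
          lintegral_mono fun w => enorm_pathProd_smul_cut_le hγ ha ht hδ.1 hδ.2 x y w
      _ = A ^ m * (∏ i, timeSing σ 0 (δ i)) * ∫⁻ w, ENNReal.ofReal (pathProd γ x δ w *
            ‖cut T G (t - ∑ i, δ i) (pathEnd x w) y‖) := by
          refine lintegral_const_mul' _ _ (ENNReal.mul_ne_top (ENNReal.pow_ne_top hA) ?_)
          exact ENNReal.prod_ne_top fun i _ => timeSing_ne_top _ _ _
      _ ≤ A ^ (m + 1) * (∏ i, timeSing σ 0 (δ i)) *
            (B ^ (m + 1) * timeSing σ 0 (t - ∑ i, δ i)) := by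
          gcongr ?_ * _ * ?_
          · exact pow_le_pow_right₀ hA1 (by omega)
          · exact h m hm δ hδ.1 hδ.2
      _ = _ := by rw [mul_pow]; ring
  · simp only [pathProd_smul_cut_eq_zero hδ, enorm_zero, lintegral_zero]
    exact zero_le

/-- Absorbs a prefactor into the (m+1)-st power; raising it to at least 1 makes its powers
nondecreasing. -/
lemma ofReal_pow_mul_le {C X : ℝ} (hC : 0 ≤ C) (m : ℕ) :
    ENNReal.ofReal (C ^ (m + 1) * X) ≤
      (ENNReal.ofReal C * max 1 (ENNReal.ofReal X)) ^ (m + 1) := by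
  rw [ENNReal.ofReal_mul (by positivity), mul_pow, ENNReal.ofReal_pow hC]
  gcongr
  exact (le_max_right _ _).trans (le_self_pow₀ (le_max_left _ _) (by omega))

lemma exists_enorm_le_of_kernelHyp {T ρ σ : ℝ} {β γ a : ℝ → Space d → Space d → ℝ}
    (h : KernelHyp T ρ β γ a) (hσ : ρ ≤ σ) : ∃ A : ℝ≥0∞, A ≠ ∞ ∧ 1 ≤ A ∧
      ∀ s ∈ Ioc 0 T, ∀ x y, ‖a s x y‖ₑ ≤ A * timeSing σ 0 s * ENNReal.ofReal (γ s x y) := by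
  obtain ⟨C, hC, hb⟩ := h.bound
  refine ⟨max 1 (ENNReal.ofReal C * ENNReal.ofReal (T ^ (σ - ρ))), ?_, le_max_left _ _,
    fun s hs x y => ?_⟩
  · simp [ENNReal.mul_eq_top]
  · have hs0 : 0 < s := hs.1
    rw [← ofReal_norm, Real.norm_eq_abs]
    calc ENNReal.ofReal |a s x y| ≤ ENNReal.ofReal (C * s ^ (-ρ) * γ s x y) := by
          refine ENNReal.ofReal_le_ofReal ((hb s hs x y).trans_eq ?_)
          rw [Real.rpow_neg hs.1.le, div_eq_mul_inv]
      _ = ENNReal.ofReal C * ENNReal.ofReal (s ^ (-ρ)) * ENNReal.ofReal (γ s x y) := by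
          rw [ENNReal.ofReal_mul (by positivity), ENNReal.ofReal_mul (by positivity)]
      _ ≤ ENNReal.ofReal C * (ENNReal.ofReal (T ^ (σ - ρ)) * timeSing σ 0 s) *
            ENNReal.ofReal (γ s x y) := by
          gcongr; exact ofReal_rpow_neg_le_timeSing hσ hs
      _ ≤ _ := by
          rw [← mul_assoc]; gcongr; exact le_max_right _ _

/-- The class `Γ_β` bounds the path products of the kernel itself. -/
lemma exists_pathBound_of_kernelHyp {T ρ : ℝ} {β γ a : ℝ → Space d → Space d → ℝ}
    (h : KernelHyp T ρ β γ a) {t : ℝ} (ht : t ∈ Ioc 0 T) (x y : Space d) :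
    ∃ A : ℝ≥0∞, A ≠ ∞ ∧ PathBound ρ A (cut T a) (cut T a) t x y := by
  obtain ⟨A, hA, hA1, ha⟩ := exists_enorm_le_of_kernelHyp h le_rfl
  obtain ⟨C, hC, hcl⟩ := h.gamma_class
  -- The increments and the last step add up to t, so the class bound always involves the same
  -- number β_t(x, y). B depends on x and y, which is harmless since only integrability at each pair
  -- is needed.
  set B := ENNReal.ofReal C * max 1 (ENNReal.ofReal (β t x y)) with hB
  refine ⟨A * (A * B), ?_, PathBound.of_lintegral_le (B := A * B) hA hA1 h.gamma_nonneg ha ht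
    fun m hm δ hδ hsum => ?_⟩
  · simp [hB, ENNReal.mul_eq_top, hA]
  have hu := sub_sum_mem_Ioc ht hδ hsum
  have hγδ : ∀ w : Fin m → Space d, 0 ≤ pathProd γ x δ w := fun w =>
    pathProd_nonneg fun i => h.gamma_nonneg _ (increment_mem_Ioc ht.2 hδ hsum i)
  have hcl' := hcl m (Fin.snoc δ (t - ∑ i, δ i) : Fin (m + 1) → ℝ) ?_ ?_ x y
  rotate_left
  · intro i
    refine Fin.lastCases ?_ (fun j => ?_) i
    · simpa using hu.1
    · simpa using hδ j
  · simpa [Fin.sum_univ_castSucc] using ht.2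
  simp only [Fin.sum_univ_castSucc, Fin.snoc_castSucc, Fin.snoc_last, chain_eq_pathProd,
    endPoint_eq_pathEnd, add_sub_cancel] at hcl'
  calc _ ≤ ∫⁻ w : Fin m → Space d, A * timeSing ρ 0 (t - ∑ i, δ i) *
          ENNReal.ofReal (pathProd γ x δ w * γ (t - ∑ i, δ i) (pathEnd x w) y) := by
        refine lintegral_mono fun w => ?_
        simp only [ENNReal.ofReal_mul (hγδ w)]
        rw [cut_of_mem hu, mul_left_comm, ofReal_norm]
        exact mul_le_mul_right (ha _ hu _ _) _
    _ = A * timeSing ρ 0 (t - ∑ i, δ i) * ∫⁻ w : Fin m → Space d,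
          ENNReal.ofReal (pathProd γ x δ w * γ (t - ∑ i, δ i) (pathEnd x w) y) :=
        lintegral_const_mul' _ _ (ENNReal.mul_ne_top hA (timeSing_ne_top _ _ _))
    _ ≤ A ^ (m + 1) * timeSing ρ 0 (t - ∑ i, δ i) * B ^ (m + 1) := by
        gcongr ?_ * _ * ?_
        · exact le_self_pow₀ hA1 (by omega)
        · exact hcl'.trans (ofReal_pow_mul_le hC.le m)
    _ = _ := by rw [mul_pow]; ring

/-- Uniform integrability at a fixed total time and starting point. -/
lemma UniformIntegrability.exists_local {T ζ κ : ℝ} {γ : ℝ → Space d → Space d → ℝ}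
    {G : ℝ → Space d → Space d → F} (hUI : UniformIntegrability T ζ κ γ G) (hζ : 1 < ζ)
    (hγ : ∀ t ∈ Ioc 0 T, ∀ x y, 0 ≤ γ t x y) {t : ℝ} (ht : t ∈ Ioc 0 T) (x y₀ : Space d) :
    ∃ r : ℝ, 0 < r ∧ ∃ X : ℝ, 0 < X ∧
      (∀ R : ℝ, 0 < R → ∃ C : ℝ, 0 < C ∧ ∀ m : ℕ, 1 ≤ m → ∀ δ : Fin m → ℝ, (∀ i, 0 < δ i) →
        ∑ i, δ i < t → ∀ y ∈ Metric.ball y₀ r,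
        ∫⁻ w in {w : Fin m → Space d | ∑ i, ‖w i‖ ≤ R}, ENNReal.ofReal (pathProd γ x δ w *
          ‖cut T G (t - ∑ i, δ i) (pathEnd x w) y‖) ^ ζ ≤
          ENNReal.ofReal (C ^ (m + 1) * X * (t - ∑ i, δ i) ^ (-(κ * ζ)))) ∧
      (∃ C : ℝ, 0 < C ∧ ∀ ε : ℝ, 0 < ε → ∃ R : ℝ, 0 < R ∧ ∀ m : ℕ, ∀ δ : Fin m → ℝ,
        (∀ i, 0 < δ i) → ∑ i, δ i < t → ∀ y ∈ Metric.ball y₀ r,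
        ∫⁻ w in {w : Fin m → Space d | ∑ i, ‖w i‖ ≤ R}ᶜ, ENNReal.ofReal (pathProd γ x δ w *
          ‖cut T G (t - ∑ i, δ i) (pathEnd x w) y‖) ≤
          ENNReal.ofReal (C ^ (m + 1) * ε * X * (t - ∑ i, δ i) ^ (-κ))) := by
  obtain ⟨r, hr, ξ, hξ, h1, h2⟩ := hUI
  have hsnoc : ∀ (m : ℕ) (δ : Fin m → ℝ), (∀ i, 0 < δ i) → ∑ i, δ i < t →
      ∀ i, 0 < (Fin.snoc δ (t - ∑ i, δ i) : Fin (m + 1) → ℝ) i := fun m δ hδ hsum i => by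
    refine Fin.lastCases ?_ (fun j => ?_) i
    · simpa using (sub_sum_mem_Ioc ht hδ hsum).1
    · simpa using hδ j
  have hsum' : ∀ (m : ℕ) (δ : Fin m → ℝ),
      ∑ i, (Fin.snoc δ (t - ∑ i, δ i) : Fin (m + 1) → ℝ) i = t := fun m δ => by
    simp [Fin.sum_univ_castSucc]
  -- The last increment is t - ∑ δ_i, so the total time is always t and ξ enters only through the
  -- constant ξ t.
  refine ⟨r, hr, ξ t, hξ t ht.1, fun R hR => ?_, ?_⟩
  · obtain ⟨C, hC, h⟩ := h1 x y₀ R hR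
    refine ⟨C, hC, fun m hm δ hδ hsum y hy => ?_⟩
    have := h m hm _ (hsnoc m δ hδ hsum) ((hsum' m δ).trans_le ht.2) x (Metric.mem_ball_self hr)
      y hy
    rw [hsum'] at this
    simp only [Fin.snoc_last, chain_eq_pathProd, endPoint_eq_pathEnd] at this
    refine le_trans (lintegral_mono fun w => ?_) this
    have h0 : 0 ≤ pathProd γ x δ w := pathProd_nonneg fun i =>
      hγ _ (increment_mem_Ioc ht.2 hδ hsum i)
    simp only
    rw [cut_of_mem (sub_sum_mem_Ioc ht hδ hsum), ENNReal.ofReal_rpow_of_nonneg (by positivity)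
      (by linarith), Real.mul_rpow h0 (norm_nonneg _)]
  · obtain ⟨C, hC, h⟩ := h2 x y₀
    refine ⟨C, hC, fun ε hε => ?_⟩
    obtain ⟨R, hR, h⟩ := h ε hε
    refine ⟨R, hR, fun m δ hδ hsum y hy => ?_⟩
    have := h m _ (hsnoc m δ hδ hsum) ((hsum' m δ).trans_le ht.2) x (Metric.mem_ball_self hr)
      y hy
    rw [hsum'] at this
    simp only [Fin.snoc_last, chain_eq_pathProd, endPoint_eq_pathEnd] at this
    simp only [cut_of_mem (sub_sum_mem_Ioc ht hδ hsum), compl_ofPred, not_le]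
    exact this

lemma measurableSet_sum_norm_le (m : ℕ) (R : ℝ) :
    MeasurableSet {w : Fin m → Space d | ∑ i, ‖w i‖ ≤ R} :=
  measurableSet_le (by fun_prop) measurable_const

/-- The region lies in a product of m balls, so its volume grows at most geometrically in m and fits
into the constant of the path bound. -/
lemma volume_sum_norm_le (m : ℕ) (R : ℝ) :
    volume {w : Fin m → Space d | ∑ i, ‖w i‖ ≤ R} ≤
      volume (Metric.closedBall (0 : Space d) R) ^ m := by
  calc _ ≤ volume (Set.pi univ fun _ : Fin m => Metric.closedBall (0 : Space d) R) := by
        refine measure_mono fun w hw i _ => ?_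
        rw [mem_closedBall_zero_iff]
        exact (Finset.single_le_sum (fun j _ => norm_nonneg (w j)) (Finset.mem_univ i)).trans hw
    _ = _ := by simp [volume_pi_pi]

lemma volume_sum_norm_le_ne_top (m : ℕ) (R : ℝ) :
    volume {w : Fin m → Space d | ∑ i, ‖w i‖ ≤ R} ≠ ∞ :=
  ((volume_sum_norm_le m R).trans_lt
    (ENNReal.pow_lt_top (measure_closedBall_lt_top))).ne

variable [MeasurableSpace F] [BorelSpace F]

lemma measurable_pathProd_mul_norm {T t : ℝ} {γ : ℝ → Space d → Space d → ℝ}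
    {G : ℝ → Space d → Space d → F}
    (hγm : Measurable fun q : ℝ × Space d × Space d => γ q.1 q.2.1 q.2.2)
    (hGm : Measurable fun q : ℝ × Space d × Space d => cut T G q.1 q.2.1 q.2.2) {m : ℕ}
    (δ : Fin m → ℝ) (x y : Space d) :
    Measurable fun w : Fin m → Space d => ENNReal.ofReal (pathProd γ x δ w *
      ‖cut T G (t - ∑ i, δ i) (pathEnd x w) y‖) := by
  refine ENNReal.measurable_ofReal.comp (Measurable.mul ?_ (Measurable.norm ?_))
  · exact (measurable_pathProd hγm x).comp measurable_prodMk_left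
  · exact hGm.comp (f := fun w : Fin m → Space d => (t - ∑ i, δ i, pathEnd x w, y))
      (by fun_prop)

/-- Uniform integrability bounds path products, locally uniformly in the end point. -/
lemma UniformIntegrability.exists_pathBound [NormedSpace ℝ F] {T ρ ζ κ : ℝ} {β γ a : ℝ → Space d → Space d → ℝ}
    {G : ℝ → Space d → Space d → F} (ha : KernelHyp T ρ β γ a)
    (hUI : UniformIntegrability T ζ κ γ G) (hζ : 1 < ζ)
    (hGm : Measurable fun q : ℝ × Space d × Space d => cut T G q.1 q.2.1 q.2.2)
    {t : ℝ} (ht : t ∈ Ioc 0 T) (x y₀ : Space d) :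
    ∃ r : ℝ, 0 < r ∧ ∃ A : ℝ≥0∞, A ≠ ∞ ∧ ∀ y ∈ Metric.ball y₀ r,
      PathBound (max ρ κ) A (cut T a) (cut T G) t x y := by
  obtain ⟨A, hA, hA1, haA⟩ := exists_enorm_le_of_kernelHyp ha (le_max_left ρ κ)
  obtain ⟨r, hr, X, hX, h1, C₂, hC₂, h2⟩ := hUI.exists_local hζ ha.gamma_nonneg ht x y₀
  -- Only a bound is wanted here, not smallness, so one fixed radius with ε = 1 is enough.
  obtain ⟨R, hR, h2⟩ := h2 1 one_pos
  obtain ⟨C₁, hC₁, h1⟩ := h1 R hR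
  have hζ0 : 0 < ζ := by linarith
  have hζinv : 1 / ζ ≤ 1 := by rw [div_le_one hζ0]; exact hζ.le
  set V := max 1 (volume (Metric.closedBall (0 : Space d) R)) with hV
  set L := ENNReal.ofReal (T ^ (max ρ κ - κ)) with hL
  -- B₁ serves the bounded region and B₂ the tail. The maxima with 1 allow the exponents 1/ζ and 1 -
  -- 1/ζ produced by Hölder to be raised to 1.
  set B₁ := ENNReal.ofReal (max 1 C₁) * max 1 (ENNReal.ofReal (max 1 X)) * V with hB₁
  set B₂ := ENNReal.ofReal C₂ * max 1 (ENNReal.ofReal X) with hB₂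
  refine ⟨r, hr, A * (max 1 L * (B₁ + B₂)), ?_, fun y hy =>
    PathBound.of_lintegral_le hA hA1 ha.gamma_nonneg haA ht fun m hm δ hδ hsum => ?_⟩
  · have hVtop : V ≠ ∞ := by simp [hV, measure_closedBall_lt_top.ne]
    have hB₁top : B₁ ≠ ∞ := ENNReal.mul_ne_top (ENNReal.mul_ne_top (by simp) (by simp)) hVtop
    have hB₂top : B₂ ≠ ∞ := ENNReal.mul_ne_top (by simp) (by simp)
    exact ENNReal.mul_ne_top hA (ENNReal.mul_ne_top (by simp [hL])
      (ENNReal.add_ne_top.2 ⟨hB₁top, hB₂top⟩))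
  have hu := sub_sum_mem_Ioc ht hδ hsum
  have hmeas := measurable_pathProd_mul_norm (t := t) ha.meas_gamma hGm δ x y
  set u := t - ∑ i, δ i with hu_def
  have hu0 : 0 < u := hu.1
  set f : (Fin m → Space d) → ℝ≥0∞ := fun w =>
    ENNReal.ofReal (pathProd γ x δ w * ‖cut T G u (pathEnd x w) y‖) with hf
  set D : Set (Fin m → Space d) := {w | ∑ i, ‖w i‖ ≤ R} with hD
  -- Hölder on D turns the L^ζ bound into an L¹ bound, and the singularity u^{-κζ} becomes u^{-κ}.
  have e1 : ∫⁻ w in D, f w ≤ B₁ ^ (m + 1) * ENNReal.ofReal (u ^ (-κ)) := by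
    calc ∫⁻ w in D, f w ≤ (∫⁻ w in D, f w ^ ζ) ^ (1 / ζ) *
            (volume.restrict D) univ ^ (1 - 1 / ζ) :=
          lintegral_le_rpow_lintegral _ hζ hmeas.aemeasurable
      _ ≤ (ENNReal.ofReal (C₁ ^ (m + 1) * X * u ^ (-(κ * ζ)))) ^ (1 / ζ) *
            (V ^ (m + 1)) := by
          gcongr
          · exact h1 m hm δ hδ hsum y hy
          · rw [Measure.restrict_apply_univ]
            calc volume D ^ (1 - 1 / ζ) ≤ (V ^ m) ^ (1 - 1 / ζ) := by
                  refine ENNReal.rpow_le_rpow ((volume_sum_norm_le m R).trans ?_) (by linarith)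
                  gcongr; exact le_max_right _ _
              _ ≤ (V ^ m) ^ (1 : ℝ) := by
                  refine ENNReal.rpow_le_rpow_of_exponent_le (one_le_pow₀ (le_max_left _ _)) ?_
                  have : 0 < 1 / ζ := by positivity
                  linarith
              _ ≤ V ^ (m + 1) := by
                  rw [ENNReal.rpow_one]
                  exact pow_le_pow_right₀ (le_max_left _ _) (by omega)
      _ ≤ ENNReal.ofReal ((max 1 C₁) ^ (m + 1) * max 1 X) * ENNReal.ofReal (u ^ (-κ)) *
            V ^ (m + 1) := by
          gcongr
          rw [ENNReal.ofReal_rpow_of_nonneg (by positivity) (by positivity),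
            ← ENNReal.ofReal_mul (by positivity)]
          refine ENNReal.ofReal_le_ofReal ?_
          rw [Real.mul_rpow (by positivity) (by positivity), ← Real.rpow_mul hu0.le]
          have : -(κ * ζ) * (1 / ζ) = -κ := by field_simp
          rw [this]
          gcongr
          calc (C₁ ^ (m + 1) * X) ^ (1 / ζ) ≤ (max 1 C₁ ^ (m + 1) * max 1 X) ^ (1 / ζ) := by
                refine Real.rpow_le_rpow (by positivity) ?_ (by positivity)
                gcongr
                · exact le_max_right _ _
                · exact le_max_right _ _
            _ ≤ (max 1 C₁ ^ (m + 1) * max 1 X) ^ (1 : ℝ) := by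
                refine Real.rpow_le_rpow_of_exponent_le ?_ hζinv
                exact one_le_mul_of_one_le_of_one_le (one_le_pow₀ (le_max_left _ _))
                  (le_max_left _ _)
            _ = _ := Real.rpow_one _
      _ ≤ (ENNReal.ofReal (max 1 C₁) * max 1 (ENNReal.ofReal (max 1 X))) ^ (m + 1) *
            ENNReal.ofReal (u ^ (-κ)) * V ^ (m + 1) := by
          gcongr
          exact ofReal_pow_mul_le (by positivity) m
      _ = _ := by rw [hB₁, mul_pow _ V]; ring
  have e2 : ∫⁻ w in Dᶜ, f w ≤ B₂ ^ (m + 1) * ENNReal.ofReal (u ^ (-κ)) := by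
    refine (h2 m δ hδ hsum y hy).trans ?_
    rw [mul_one, ENNReal.ofReal_mul (by positivity)]
    gcongr
    exact ofReal_pow_mul_le hC₂.le m
  calc ∫⁻ w, f w = (∫⁻ w in D, f w) + ∫⁻ w in Dᶜ, f w :=
        (lintegral_add_compl _ (measurableSet_sum_norm_le m R)).symm
    _ ≤ (B₁ ^ (m + 1) + B₂ ^ (m + 1)) * ENNReal.ofReal (u ^ (-κ)) := by
        rw [add_mul]; exact add_le_add e1 e2
    _ ≤ (B₁ + B₂) ^ (m + 1) * (max 1 L ^ (m + 1) * timeSing (max ρ κ) 0 u) := by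
        refine mul_le_mul' (pow_add_pow_le zero_le zero_le (by omega)) ?_
        refine (ofReal_rpow_neg_le_timeSing (le_max_right ρ κ) hu).trans ?_
        gcongr
        exact (le_max_right _ _).trans (le_self_pow₀ (le_max_left _ _) (by omega))
    _ = _ := by rw [mul_pow (max 1 L)]; ring

end KernelBounds

/-! ### Gradients of path integrals -/

section GradientExpansion

variable {d : ℕ}

lemma hasGradientAt_const_smul {f : Space d → ℝ} {g y : Space d} (c : ℝ)
    (h : HasGradientAt f g y) : HasGradientAt (fun y => c • f y) (c • g) y := by
  rw [hasGradientAt_iff_hasFDerivAt, map_smulₛₗ]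
  exact h.hasFDerivAt.const_smul c

/-- Each coordinate of the gradient is a directional derivative, hence a pointwise limit of the
jointly measurable difference quotients with step 1/n. -/
lemma measurable_gradient_uncurry {α : Type*} [MeasurableSpace α] {f : α → Space d → ℝ}
    (hf : Measurable fun q : α × Space d => f q.1 q.2) (hd : ∀ a, Differentiable ℝ (f a)) :
    Measurable fun q : α × Space d => gradient (f q.1) q.2 := by
  have hrepr : ∀ q : α × Space d, gradient (f q.1) q.2 =
      ∑ i, fderiv ℝ (f q.1) q.2 (EuclideanSpace.basisFun (Fin d) ℝ i) •
        EuclideanSpace.basisFun (Fin d) ℝ i := fun q => by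
    conv_lhs => rw [← (EuclideanSpace.basisFun (Fin d) ℝ).sum_repr' (gradient (f q.1) q.2)]
    refine Finset.sum_congr rfl fun i _ => ?_
    rw [real_inner_comm, ← InnerProductSpace.toDual_apply_apply (𝕜 := ℝ), gradient,
      LinearIsometryEquiv.apply_symm_apply]
  simp only [hrepr]
  refine Finset.measurable_fun_sum _ fun i _ => Measurable.smul_const ?_ _
  set e := EuclideanSpace.basisFun (Fin d) ℝ i
  have hlim : ∀ q : α × Space d, Tendsto (fun n : ℕ => (n : ℝ) •
      (f q.1 (q.2 + (n : ℝ)⁻¹ • e) - f q.1 q.2)) atTop (𝓝 (fderiv ℝ (f q.1) q.2 e)) := fun q =>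
    (hd q.1 q.2).hasFDerivAt.lim e (by
      simpa using (tendsto_natCast_atTop_atTop (R := ℝ)))
  refine measurable_of_tendsto_metrizable (fun n => ?_) (tendsto_pi_nhds.2 hlim)
  refine Measurable.const_smul (Measurable.sub ?_ hf) (n : ℝ)
  exact hf.comp (f := fun q : α × Space d => (q.1, q.2 + (n : ℝ)⁻¹ • e)) (by fun_prop)

lemma measurable_cut_gradient {T : ℝ} {f : ℝ → Space d → Space d → ℝ}
    (hf : Measurable fun q : ℝ × Space d × Space d => f q.1 q.2.1 q.2.2)
    (hd : ∀ t ∈ Ioc 0 T, ∀ x, Differentiable ℝ (f t x)) :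
    Measurable fun q : ℝ × Space d × Space d =>
      cut T (fun t x y => gradient (f t x) y) q.1 q.2.1 q.2.2 := by
  have h := measurable_gradient_uncurry (α := ℝ × Space d) (f := fun v y => cut T f v.1 v.2 y)
    ((measurable_cut (T := T) hf).comp (f := fun q : (ℝ × Space d) × Space d =>
      (q.1.1, q.1.2, q.2)) (by fun_prop)) fun v => by
      by_cases hv : v.1 ∈ Ioc 0 T
      · simpa only [cut_of_mem hv] using hd _ hv v.2
      · simp only [cut_of_notMem hv]; exact differentiable_const _
  convert h.comp (f := fun q : ℝ × Space d × Space d => ((q.1, q.2.1), q.2.2))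
    (by fun_prop) using 1
  ext q : 1
  simp only [Function.comp]
  by_cases hv : q.1 ∈ Ioc 0 T
  · simp only [cut_of_mem hv]
  · simp only [cut_of_notMem hv]; exact (hasGradientAt_const q.2.2 (0 : ℝ)).gradient.symm

lemma hasGradientAt_cut {T : ℝ} {f : ℝ → Space d → Space d → ℝ}
    (hd : ∀ t ∈ Ioc 0 T, ∀ x, Differentiable ℝ (f t x)) (t : ℝ) (x y : Space d) :
    HasGradientAt (fun y => cut T f t x y) (cut T (fun t x y => gradient (f t x) y) t x y) y := by
  by_cases ht : t ∈ Ioc 0 T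
  · simp only [cut_of_mem ht]
    exact (hd t ht x y).hasGradientAt
  · simp only [cut_of_notMem ht]
    exact hasGradientAt_const _ _

variable {T ρ ζ κ : ℝ} {β γ a f : ℝ → Space d → Space d → ℝ}

/-- The space integral with fixed increments is differentiable in the end point. -/
lemma hasGradientAt_integral_pathProd (ha : KernelHyp T ρ β γ a)
    (ham : Measurable fun q : ℝ × Space d × Space d => a q.1 q.2.1 q.2.2)
    (hf : Measurable fun q : ℝ × Space d × Space d => f q.1 q.2.1 q.2.2)
    (hd : ∀ t ∈ Ioc 0 T, ∀ x, Differentiable ℝ (f t x))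
    (hζ : 1 < ζ) (hUI : UniformIntegrability T ζ κ γ fun t x y => gradient (f t x) y)
    {t : ℝ} (ht : t ∈ Ioc 0 T) (x : Space d) {σ : ℝ}
    (hfb : ∀ y, ∃ A : ℝ≥0∞, A ≠ ∞ ∧ PathBound σ A (cut T a) (cut T f) t x y)
    {m : ℕ} (hm : 1 ≤ m) (δ : Fin m → ℝ) (y₀ : Space d) :
    HasGradientAt (fun y => ∫ w : Fin m → Space d,
        pathProd (cut T a) x δ w • cut T f (t - ∑ i, δ i) (pathEnd x w) y)
      (∫ w : Fin m → Space d, pathProd (cut T a) x δ w •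
        cut T (fun t x y => gradient (f t x) y) (t - ∑ i, δ i) (pathEnd x w) y₀) y₀ := by
  set G : ℝ → Space d → Space d → Space d := fun t x y => gradient (f t x) y with hG
  have hGm : Measurable fun q : ℝ × Space d × Space d => cut T G q.1 q.2.1 q.2.2 :=
    measurable_cut_gradient hf hd
  by_cases hδ : ¬ ((∀ i, 0 < δ i) ∧ ∑ i, δ i < t)
  · simp only [pathProd_smul_cut_eq_zero hδ, integral_zero]
    exact hasGradientAt_const _ _
  rw [not_not] at hδ
  obtain ⟨hδ, hsum⟩ := hδ
  have hmf : ∀ y, Measurable fun w : Fin m → Space d =>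
      pathProd (cut T a) x δ w • cut T f (t - ∑ i, δ i) (pathEnd x w) y := fun y =>
    (measurable_pathIntegrand (measurable_cut ham) (measurable_cut hf) m t x).comp
      (f := fun w : Fin m → Space d => ((δ, w), y)) (by fun_prop)
  have hmg : Measurable fun q : (Fin m → Space d) × Space d =>
      pathProd (cut T a) x δ q.1 • cut T G (t - ∑ i, δ i) (pathEnd x q.1) q.2 :=
    (measurable_pathIntegrand (measurable_cut ham) hGm m t x).comp
      (f := fun q : (Fin m → Space d) × Space d => ((δ, q.1), q.2)) (by fun_prop)
  have hfin : ∀ {A : ℝ≥0∞} {σ : ℝ}, A ≠ ∞ →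
      A ^ (m + 1) * ((∏ i, timeSing σ 0 (δ i)) * timeSing σ 0 (t - ∑ i, δ i)) < ∞ :=
    fun hA => ENNReal.mul_lt_top (ENNReal.pow_lt_top hA.lt_top) (ENNReal.mul_lt_top
      (ENNReal.prod_ne_top fun i _ => timeSing_ne_top _ _ _).lt_top (timeSing_ne_top _ _ _).lt_top)
  obtain ⟨A, hA, -, haA⟩ := exists_enorm_le_of_kernelHyp ha le_rfl
  obtain ⟨r, hr, X, hX, h1, C₂, hC₂, h2⟩ := hUI.exists_local hζ ha.gamma_nonneg ht x y₀
  set c := A ^ m * (∏ i, timeSing ρ 0 (δ i)) with hc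
  have hctop : c ≠ ∞ := ENNReal.mul_ne_top (ENNReal.pow_ne_top hA)
    (ENNReal.prod_ne_top fun i _ => timeSing_ne_top _ _ _)
  have hle : ∀ (y : Space d) (w : Fin m → Space d),
      ‖pathProd (cut T a) x δ w • cut T G (t - ∑ i, δ i) (pathEnd x w) y‖ₑ ≤
        c * ENNReal.ofReal (pathProd γ x δ w * ‖cut T G (t - ∑ i, δ i) (pathEnd x w) y‖) :=
    fun y w => enorm_pathProd_smul_cut_le ha.gamma_nonneg haA ht hδ hsum x y w
  have hu0 : 0 < t - ∑ i, δ i := by linarith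
  refine hasGradientAt_integral_of_uniformly_integrable
    (f := fun w y => pathProd (cut T a) x δ w • cut T f (t - ∑ i, δ i) (pathEnd x w) y)
    (g := fun w y => pathProd (cut T a) x δ w • cut T G (t - ∑ i, δ i) (pathEnd x w) y)
    hζ hr hmf hmg (fun w y => ?_) (fun y => ?_) ?_ fun ε hε => ?_
  · exact hasGradientAt_const_smul _ (hasGradientAt_cut hd (t - ∑ i, δ i) (pathEnd x w) y)
  · obtain ⟨B, hB, hb⟩ := hfb y
    exact ⟨(hmf y).aestronglyMeasurable, (hb m hm δ).trans_lt (hfin hB)⟩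
  · obtain ⟨r', hr', B, hB, hb⟩ := hUI.exists_pathBound ha hζ hGm ht x y₀
    exact ⟨(hmg.comp measurable_prodMk_right).aestronglyMeasurable,
      (hb y₀ (Metric.mem_ball_self hr') m hm δ).trans_lt (hfin hB)⟩
  -- At fixed m and δ the factor accompanying ε′ in the tail bound is finite, so ε′ can be chosen to
  -- keep the product below ε. The radius R, and then C₁, depend on this choice.
  · obtain ⟨ε', hε', hlt⟩ := ENNReal.exists_nnreal_pos_mul_lt (b := ε)
      (a := c * ENNReal.ofReal (C₂ ^ (m + 1) * X * (t - ∑ i, δ i) ^ (-κ)))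
      (ENNReal.mul_ne_top hctop ENNReal.ofReal_ne_top) hε.ne'
    obtain ⟨R, hR, h2⟩ := h2 ε' hε'
    obtain ⟨C₁, hC₁, h1⟩ := h1 R hR
    refine ⟨{w | ∑ i, ‖w i‖ ≤ R}, measurableSet_sum_norm_le m R, volume_sum_norm_le_ne_top m R,
      c ^ ζ * ENNReal.ofReal (C₁ ^ (m + 1) * X * (t - ∑ i, δ i) ^ (-(κ * ζ))),
      ENNReal.mul_ne_top (ENNReal.rpow_ne_top_of_nonneg (by linarith) hctop)
        ENNReal.ofReal_ne_top, fun y hy => ⟨?_, ?_⟩⟩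
    · refine (lintegral_mono fun w => ENNReal.rpow_le_rpow (hle y w) (by linarith)).trans ?_
      simp only [ENNReal.mul_rpow_of_nonneg _ _ (by linarith : (0 : ℝ) ≤ ζ)]
      rw [lintegral_const_mul' _ _ (ENNReal.rpow_ne_top_of_nonneg (by linarith) hctop)]
      exact mul_le_mul_right (h1 m hm δ hδ hsum y hy) _
    · refine (lintegral_mono fun w => hle y w).trans ?_
      rw [lintegral_const_mul' _ _ hctop]
      refine (mul_le_mul_right (h2 m δ hδ hsum y hy) _).trans (le_trans (le_of_eq ?_) hlt.le)
      rw [show C₂ ^ (m + 1) * (ε' : ℝ) * X * (t - ∑ i, δ i) ^ (-κ) =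
        ε' * (C₂ ^ (m + 1) * X * (t - ∑ i, δ i) ^ (-κ)) by ring,
        ENNReal.ofReal_mul (NNReal.coe_nonneg ε'), ENNReal.ofReal_coe_nnreal]
      ring

/-- The path integrals are differentiable in the end point. -/
lemma hasGradientAt_pathTerm (ha : KernelHyp T ρ β γ a)
    (ham : Measurable fun q : ℝ × Space d × Space d => a q.1 q.2.1 q.2.2)
    (hf : Measurable fun q : ℝ × Space d × Space d => f q.1 q.2.1 q.2.2)
    (hd : ∀ t ∈ Ioc 0 T, ∀ x, Differentiable ℝ (f t x))
    (hζ : 1 < ζ) (hκ : κ < 1)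
    (hUI : UniformIntegrability T ζ κ γ fun t x y => gradient (f t x) y)
    {t : ℝ} (ht : t ∈ Ioc 0 T) (x : Space d) {σ : ℝ} (hσ : σ ∈ Ico (0 : ℝ) 1)
    (hfb : ∀ y, ∃ A : ℝ≥0∞, A ≠ ∞ ∧ PathBound σ A (cut T a) (cut T f) t x y)
    {m : ℕ} (hm : 1 ≤ m) (y₀ : Space d) :
    HasGradientAt (fun y => pathTerm (cut T a) (cut T f) m t x y)
      (pathTerm (cut T a) (cut T fun t x y => gradient (f t x) y) m t x y₀) y₀ := by
  set G : ℝ → Space d → Space d → Space d := fun t x y => gradient (f t x) y with hG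
  have hGm : Measurable fun q : ℝ × Space d × Space d => cut T G q.1 q.2.1 q.2.2 :=
    measurable_cut_gradient hf hd
  have hmf := measurable_pathIntegrand (measurable_cut (T := T) ham) (measurable_cut (T := T) hf)
    m t x
  have hmg := measurable_pathIntegrand (measurable_cut (T := T) ham) hGm m t x
  obtain ⟨r, hr, A, hA, hb⟩ := hUI.exists_pathBound ha hζ hGm ht x y₀
  have hσ' : max ρ κ ∈ Ico (0 : ℝ) 1 :=
    ⟨ha.rho_mem.1.trans (le_max_left _ _), max_lt ha.rho_mem.2 hκ⟩
  have hintf : ∀ y, Integrable fun q : (Fin m → ℝ) × (Fin m → Space d) =>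
      pathProd (cut T a) x q.1 q.2 • cut T f (t - ∑ i, q.1 i) (pathEnd x q.2) y := fun y => by
    obtain ⟨B, hB, hBb⟩ := hfb y
    exact hBb.integrable (measurable_cut ham) (measurable_cut hf) hσ hB hm
  have hintg := (hb y₀ (Metric.mem_ball_self hr)).integrable (measurable_cut ham) hGm hσ' hA hm
  set F : Space d → (Fin m → ℝ) → ℝ := fun y δ => ∫ w : Fin m → Space d,
    pathProd (cut T a) x δ w • cut T f (t - ∑ i, δ i) (pathEnd x w) y with hF
  set F' : Space d → (Fin m → ℝ) → Space d := fun y δ => ∫ w : Fin m → Space d,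
    pathProd (cut T a) x δ w • cut T G (t - ∑ i, δ i) (pathEnd x w) y with hF'
  have e1 : ∀ y, pathTerm (cut T a) (cut T f) m t x y = ∫ δ, F y δ := fun y =>
    integral_prod _ (hintf y)
  have e2 : pathTerm (cut T a) (cut T G) m t x y₀ = ∫ δ, F' y₀ δ := integral_prod _ hintg
  have hF'int : Integrable (F' y₀) := hintg.integral_prod_left
  simp only [e1]
  rw [e2, hasGradientAt_iff_hasFDerivAt]
  have e3 : InnerProductSpace.toDual ℝ (Space d) (∫ δ, F' y₀ δ) =
      ∫ δ, InnerProductSpace.toDual ℝ (Space d) (F' y₀ δ) :=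
    ((InnerProductSpace.toDual ℝ (Space d)).toLinearIsometry.toContinuousLinearMap.integral_comp_comm
      hF'int).symm
  rw [e3]
  -- This majorant bounds the norm of the gradient of the inner integral for all y in the ball, and
  -- it is integrable by the convolution estimate.
  set b : (Fin m → ℝ) → ℝ≥0∞ := fun δ =>
    A ^ (m + 1) * ((∏ i, timeSing (max ρ κ) 0 (δ i)) * timeSing (max ρ κ) 0 (t - ∑ i, δ i))
    with hbdef
  have hbtop : ∀ δ, b δ ≠ ∞ := fun δ => ENNReal.mul_ne_top (ENNReal.pow_ne_top hA)
    (ENNReal.mul_ne_top (ENNReal.prod_ne_top fun i _ => timeSing_ne_top _ _ _)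
      (timeSing_ne_top _ _ _))
  have hblint : ∫⁻ δ, b δ ≠ ∞ := by
    obtain ⟨C, hC, hCm⟩ := exists_lintegral_prod_timeSing_le hσ'.1 hσ'.2 t hA
    rw [hbdef, lintegral_const_mul _ (by fun_prop), pow_succ', mul_assoc]
    exact (ENNReal.mul_lt_top hA.lt_top ((hCm m).trans_lt (ENNReal.mul_lt_top hC.lt_top
      (ENNReal.pow_lt_top (by simp))))).ne
  refine hasFDerivAt_integral_of_dominated_of_fderiv_le (bound := fun δ => (b δ).toReal)
    (F' := fun y δ => InnerProductSpace.toDual ℝ (Space d) (F' y δ))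
    (Metric.ball_mem_nhds y₀ hr) ?_ ?_ ?_ ?_ ?_ ?_
  · exact Eventually.of_forall fun y => (hintf y).integral_prod_left.aestronglyMeasurable
  · exact (hintf y₀).integral_prod_left
  · exact (InnerProductSpace.toDual ℝ (Space d)).continuous.comp_aestronglyMeasurable
      hF'int.aestronglyMeasurable
  · refine ae_of_all _ fun δ y hy => ?_
    rw [LinearIsometryEquiv.norm_map, ← toReal_enorm]
    exact ENNReal.toReal_mono (hbtop δ)
      ((enorm_integral_le_lintegral_enorm _).trans (hb y hy m hm δ))
  · exact integrable_toReal_of_lintegral_ne_top (by rw [hbdef]; fun_prop) hblint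
  · exact ae_of_all _ fun δ y _ =>
      (hasGradientAt_integral_pathProd ha ham hf hd hζ hUI ht x hfb hm δ y).hasFDerivAt

lemma PathBound.exists_norm_pathTerm_le {F : Type*} [NormedAddCommGroup F] [NormedSpace ℝ F]
    [MeasurableSpace F] [BorelSpace F] [SecondCountableTopology F]
    {k : ℝ → Space d → Space d → ℝ} {G : ℝ → Space d → Space d → F}
    (hk : Measurable fun q : ℝ × Space d × Space d => k q.1 q.2.1 q.2.2)
    (hG : Measurable fun q : ℝ × Space d × Space d => G q.1 q.2.1 q.2.2) {σ t : ℝ}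
    (hσ : σ ∈ Ico (0 : ℝ) 1) {A : ℝ≥0∞} (hA : A ≠ ∞) (x : Space d) :
    ∃ C : ℝ, ∀ y, PathBound σ A k G t x y → ∀ m : ℕ, 1 ≤ m →
      ‖pathTerm k G m t x y‖ ≤ C * 2⁻¹ ^ m := by
  obtain ⟨C, hC, h⟩ := PathBound.exists_lintegral_le hk hG hσ hA (t := t) (x := x)
  refine ⟨C.toReal, fun y hy m hm => ?_⟩
  have := ENNReal.toReal_mono (ENNReal.mul_ne_top hC (ENNReal.pow_ne_top (by simp)))
    ((enorm_integral_le_lintegral_enorm _).trans (h y hy m hm))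
  simpa [pathTerm] using this

/-- The expansion converges and may be differentiated term by term. -/
lemma summable_and_hasGradientAt_expansion (ha : KernelHyp T ρ β γ a)
    (ham : Measurable fun q : ℝ × Space d × Space d => a q.1 q.2.1 q.2.2)
    (hf : Measurable fun q : ℝ × Space d × Space d => f q.1 q.2.1 q.2.2)
    (hd : ∀ t ∈ Ioc 0 T, ∀ x, Differentiable ℝ (f t x))
    (hUIf : ∃ ζ κ : ℝ, 1 < ζ ∧ κ < 1 ∧ UniformIntegrability T ζ κ γ f)
    (hUI : ∃ ζ κ : ℝ, 1 < ζ ∧ κ < 1 ∧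
      UniformIntegrability T ζ κ γ fun t x y => gradient (f t x) y)
    {t : ℝ} (ht : t ∈ Ioc 0 T) (x y₀ : Space d) :
    (Summable fun n : ℕ => expansionTerm a f n t x y₀) ∧
      HasGradientAt (fun y => ∑' n : ℕ, expansionTerm a f n t x y)
        (∑' n : ℕ, pathTerm (cut T a) (cut T fun t x y => gradient (f t x) y) (n + 1) t x y₀) y₀ :=
    by
  obtain ⟨ζ₀, κ₀, hζ₀, hκ₀, hUIf⟩ := hUIf
  obtain ⟨ζ, κ, hζ, hκ, hUI⟩ := hUI
  have hGm := measurable_cut_gradient hf hd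
  have hσ₀ : max ρ κ₀ ∈ Ico (0 : ℝ) 1 :=
    ⟨ha.rho_mem.1.trans (le_max_left _ _), max_lt ha.rho_mem.2 hκ₀⟩
  have hσ : max ρ κ ∈ Ico (0 : ℝ) 1 :=
    ⟨ha.rho_mem.1.trans (le_max_left _ _), max_lt ha.rho_mem.2 hκ⟩
  have hfb : ∀ y, ∃ A : ℝ≥0∞, A ≠ ∞ ∧ PathBound (max ρ κ₀) A (cut T a) (cut T f) t x y :=
    fun y => by
      obtain ⟨r, hr, A, hA, h⟩ := hUIf.exists_pathBound ha hζ₀ (measurable_cut hf) ht x y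
      exact ⟨A, hA, h y (Metric.mem_ball_self hr)⟩
  have hterm : ∀ n y, expansionTerm a f n t x y = pathTerm (cut T a) (cut T f) (n + 1) t x y := by
    intro n y
    obtain ⟨A, hA, h⟩ := hfb y
    refine expansionTerm_eq_pathTerm (fun s hs x y m hm => ?_) n ht
      (h.integrable (measurable_cut ham) (measurable_cut hf) hσ₀ hA (by omega))
    obtain ⟨B, hB, hb⟩ := exists_pathBound_of_kernelHyp ha hs x y
    exact hb.integrable (measurable_cut ham) (measurable_cut ham) ha.rho_mem hB hm
  simp only [hterm]
  have hgeom : ∀ C : ℝ, Summable fun n : ℕ => C * (2⁻¹ : ℝ) ^ (n + 1) := fun C =>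
    (((summable_nat_add_iff 1).2
      (summable_geometric_of_lt_one (r := (2⁻¹ : ℝ)) (by norm_num) (by norm_num))).mul_left C)
  have hsum : Summable fun n : ℕ => pathTerm (cut T a) (cut T f) (n + 1) t x y₀ := by
    obtain ⟨A, hA, h⟩ := hfb y₀
    obtain ⟨C, hC⟩ := PathBound.exists_norm_pathTerm_le (measurable_cut (T := T) ham)
      (measurable_cut (T := T) hf) hσ₀ hA x (t := t)
    exact Summable.of_norm_bounded (hgeom C) fun n => hC y₀ h (n + 1) (by omega)
  refine ⟨hsum, ?_⟩
  obtain ⟨r, hr, A, hA, hb⟩ := hUI.exists_pathBound ha hζ hGm ht x y₀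
  obtain ⟨C, hC⟩ := PathBound.exists_norm_pathTerm_le (measurable_cut (T := T) ham) hGm hσ hA x
    (t := t)
  have hgsum : Summable fun n : ℕ =>
      pathTerm (cut T a) (cut T fun t x y => gradient (f t x) y) (n + 1) t x y₀ :=
    Summable.of_norm_bounded (hgeom C) fun n =>
      hC y₀ (hb y₀ (Metric.mem_ball_self hr)) (n + 1) (by omega)
  rw [hasGradientAt_iff_hasFDerivAt]
  have e : InnerProductSpace.toDual ℝ (Space d) (∑' n : ℕ,
      pathTerm (cut T a) (cut T fun t x y => gradient (f t x) y) (n + 1) t x y₀) =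
      ∑' n : ℕ, InnerProductSpace.toDual ℝ (Space d)
        (pathTerm (cut T a) (cut T fun t x y => gradient (f t x) y) (n + 1) t x y₀) :=
    (InnerProductSpace.toDual ℝ (Space d)).toLinearIsometry.toContinuousLinearMap.map_tsum hgsum
  rw [e]
  -- The radius r and the constant C do not depend on the number of steps, so the gradients are
  -- dominated on one ball by a summable sequence.
  refine hasFDerivAt_tsum_of_isPreconnected (hgeom C) Metric.isOpen_ball
    (convex_ball y₀ r).isPreconnected (f' := fun n y => InnerProductSpace.toDual ℝ (Space d)
      (pathTerm (cut T a) (cut T fun t x y => gradient (f t x) y) (n + 1) t x y))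
    (fun n y hy => ?_) (fun n y hy => ?_) (Metric.mem_ball_self hr) hsum (Metric.mem_ball_self hr)
  · exact (hasGradientAt_pathTerm ha ham hf hd hζ hκ hUI ht x hσ₀ hfb (by omega) y).hasFDerivAt
  · rw [LinearIsometryEquiv.norm_map]
    exact hC y (hb y hy) (n + 1) (by omega)

end GradientExpansion

/-! ### Exponential waiting times -/

section Poisson

lemma expMeasure_eq_withDensity : expMeasure 1 = volume.withDensity (timeSing 0 1) := by
  rw [expMeasure, gammaMeasure]
  refine withDensity_congr_ae ?_
  -- The two densities disagree at s = 0: the exponential one is 1 there, `timeSing` is 0.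
  filter_upwards [measure_eq_zero_iff_ae_notMem.1 (measure_singleton (0 : ℝ))] with s hs
  change exponentialPDF 1 s = _
  rcases lt_or_gt_of_ne (show s ≠ 0 from hs) with h | h
  · rw [exponentialPDF_of_neg h, timeSing_of_nonpos h.le]
  · rw [exponentialPDF_of_nonneg h.le, timeSing_of_pos h]; simp

instance isProbabilityMeasure_expMeasure_one : IsProbabilityMeasure (expMeasure 1) :=
  isProbabilityMeasure_expMeasure one_pos

lemma expMeasure_Iic_nonpos {s : ℝ} (hs : s ≤ 0) : expMeasure 1 (Iic s) = 0 := by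
  rw [expMeasure_eq_withDensity, withDensity_apply _ measurableSet_Iic,
    setLIntegral_congr_fun measurableSet_Iic (g := fun _ => 0)
      (fun u hu => timeSing_of_nonpos ((mem_Iic.1 hu).trans hs)), lintegral_zero]

lemma expMeasure_Ioi {s : ℝ} (hs : 0 ≤ s) :
    expMeasure 1 (Ioi s) = ENNReal.ofReal (Real.exp (-s)) := by
  have h := cdf_expMeasure_eq one_pos s
  rw [if_pos hs, cdf_eq_real, one_mul] at h
  rw [← compl_Iic, ← ofReal_measureReal, probReal_compl_eq_one_sub measurableSet_Iic, h]
  ring_nf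

lemma lintegral_pi_expMeasure {m : ℕ} {f : (Fin m → ℝ) → ℝ≥0∞} (hf : Measurable f) :
    ∫⁻ δ, f δ ∂(Measure.pi fun _ => expMeasure 1) =
      ∫⁻ δ : Fin m → ℝ, (∏ i, timeSing 0 1 (δ i)) * f δ := by
  induction m with
  | zero =>
    simp only [Finset.univ_eq_empty, Finset.prod_empty, one_mul]
    rw [volume_pi, Measure.pi_of_empty, Measure.pi_of_empty]
  | succ m ih =>
    have hfs : Measurable fun q : (Fin m → ℝ) × ℝ => f (Fin.snoc q.1 q.2 : Fin (m + 1) → ℝ) :=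
      hf.comp measurable_snoc
    rw [lintegral_pi_snoc _ hf, ih hfs.lintegral_prod_right',
      volume_pi, volume_pi, lintegral_pi_snoc _ (by fun_prop)]
    refine lintegral_congr fun δ => ?_
    have hfδ : Measurable fun u : ℝ => f (Fin.snoc δ u : Fin (m + 1) → ℝ) :=
      hfs.comp measurable_prodMk_left
    simp only [Fin.prod_univ_castSucc, Fin.snoc_castSucc, Fin.snoc_last, mul_assoc]
    have hmul : Measurable fun u : ℝ => timeSing 0 1 u * f (Fin.snoc δ u : Fin (m + 1) → ℝ) :=
      (measurable_timeSing 0 1).mul hfδ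
    rw [lintegral_const_mul _ hmul, expMeasure_eq_withDensity,
      lintegral_withDensity_eq_lintegral_mul _ (measurable_timeSing 0 1) hfδ]
    rfl

variable {Ω : Type*} {T : ℝ} {τ : ℕ → Ω → ℝ}

/-- The first `n` waiting times. -/
def waitingTimes (τ : ℕ → Ω → ℝ) (n : ℕ) (ω : Ω) : Fin n → ℝ := fun i => τ (i + 1) ω - τ i ω

lemma waitingTimes_succ (τ : ℕ → Ω → ℝ) (n : ℕ) (ω : Ω) :
    waitingTimes τ (n + 1) ω =
      (Fin.snoc (waitingTimes τ n ω) (τ (n + 1) ω - τ n ω) : Fin (n + 1) → ℝ) := by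
  ext i
  refine Fin.lastCases ?_ (fun j => ?_) i <;> simp [waitingTimes]

/-- The event that there are exactly `n` jumps up to `T` and none at `T`. -/
def jumpEvent (T : ℝ) (τ : ℕ → Ω → ℝ) (n : ℕ) : Set Ω := {ω | τ n ω < T ∧ T < τ (n + 1) ω}

lemma jumpCount_eq_of_mem {ω : Ω} (hω : StrictMono fun k => τ k ω) {n : ℕ}
    (hn : ω ∈ jumpEvent T τ n) : jumpCount T τ ω = n := by
  have : {k : ℕ | 1 ≤ k ∧ τ k ω ≤ T} = ↑(Finset.Icc 1 n) := by
    ext k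
    simp only [mem_ofPred_eq, Finset.coe_Icc, mem_Icc, and_congr_right_iff]
    refine fun _ => ⟨fun h => ?_, fun h => (hω.monotone h).trans hn.1.le⟩
    by_contra hk
    exact (hn.2.trans_le (hω.monotone (by omega : n + 1 ≤ k))).not_ge h
  rw [jumpCount, this, ncard_coe_finset, Nat.card_Icc, Nat.add_sub_cancel]

variable [MeasurableSpace Ω] {μ : Measure Ω}

lemma IsPoissonTimes.measurable_waitingTimes (hτ : IsPoissonTimes μ τ) (n : ℕ) :
    Measurable (waitingTimes τ n) :=
  measurable_pi_iff.2 fun _ => (hτ.meas _).sub (hτ.meas _)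

lemma IsPoissonTimes.sum_waitingTimes (hτ : IsPoissonTimes μ τ) (n : ℕ) (ω : Ω) :
    ∑ i, waitingTimes τ n ω i = τ n ω := by
  simp only [waitingTimes]
  rw [Fin.sum_univ_eq_sum_range (fun i => τ (i + 1) ω - τ i ω), Finset.sum_range_sub (τ · ω),
    hτ.zero, sub_zero]

lemma IsPoissonTimes.measurableSet_jumpEvent (hτ : IsPoissonTimes μ τ) (n : ℕ) :
    MeasurableSet (jumpEvent T τ n) :=
  (measurableSet_lt (hτ.meas n) measurable_const).inter
    (measurableSet_lt measurable_const (hτ.meas (n + 1)))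

lemma IsPoissonTimes.map_waitingTimes (hτ : IsPoissonTimes μ τ) (n : ℕ) :
    μ.map (waitingTimes τ n) = Measure.pi fun _ => expMeasure 1 := by
  have h := hτ.indep.precomp (g := fun i : Fin n => (i : ℕ)) Fin.val_injective
  have h' := h.map_fun_eq_pi_map fun i => ((hτ.meas _).sub (hτ.meas _)).aemeasurable
  exact h'.trans (congrArg Measure.pi (funext fun i => hτ.law i))

lemma IsPoissonTimes.ae_lt_succ (hτ : IsPoissonTimes μ τ) :
    ∀ᵐ ω ∂μ, ∀ k, τ k ω < τ (k + 1) ω := by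
  refine ae_all_iff.2 fun k => ?_
  have h : μ.map (fun ω => τ (k + 1) ω - τ k ω) (Iic 0) = 0 := by
    rw [hτ.law, expMeasure_Iic_nonpos le_rfl]
  have hm : Measurable fun ω => τ (k + 1) ω - τ k ω := (hτ.meas _).sub (hτ.meas _)
  rw [Measure.map_apply hm measurableSet_Iic] at h
  filter_upwards [measure_eq_zero_iff_ae_notMem.1 h] with ω hω
  simpa using hω

lemma IsPoissonTimes.ae_strictMono (hτ : IsPoissonTimes μ τ) :
    ∀ᵐ ω ∂μ, StrictMono fun k => τ k ω :=
  hτ.ae_lt_succ.mono fun _ h => strictMono_nat_of_lt_succ h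

/-- Given the earlier waiting times, the last one has a density and would have to equal a single
number. This is why the event of n jumps may be taken with strict inequalities on both sides. -/
lemma IsPoissonTimes.ae_ne (hτ : IsPoissonTimes μ τ) (hT : 0 < T) :
    ∀ᵐ ω ∂μ, ∀ k, τ k ω ≠ T := by
  refine ae_all_iff.2 fun k => ?_
  cases k with
  | zero => exact ae_of_all _ fun ω => by rw [hτ.zero]; exact hT.ne
  | succ k =>
    have hms : MeasurableSet {δ : Fin (k + 1) → ℝ | ∑ i, δ i = T} :=
      measurableSet_eq_fun (by fun_prop) measurable_const
    have h : μ.map (waitingTimes τ (k + 1)) {δ | ∑ i, δ i = T} = 0 := by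
      rw [hτ.map_waitingTimes, ← lintegral_indicator_one hms,
        lintegral_pi_snoc _ (measurable_one.indicator hms)]
      refine (lintegral_congr fun δ => ?_).trans lintegral_zero
      rw [expMeasure_eq_withDensity]
      refine (lintegral_eq_zero_iff ((measurable_one.indicator hms).comp
        (measurable_snoc.comp measurable_prodMk_left))).2 ?_
      refine (withDensity_absolutelyContinuous _ _).ae_le ?_
      filter_upwards [measure_eq_zero_iff_ae_notMem.1 (measure_singleton (T - ∑ i, δ i))]
        with u hu
      refine indicator_of_notMem (fun h => hu ?_) _
      simp only [mem_ofPred_eq, Function.comp, Fin.sum_univ_castSucc, Fin.snoc_castSucc,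
        Fin.snoc_last] at h
      exact mem_singleton_iff.2 (by linarith)
    rw [Measure.map_apply (hτ.measurable_waitingTimes _) hms] at h
    filter_upwards [measure_eq_zero_iff_ae_notMem.1 h] with ω hω hT'
    exact hω (by simpa [hτ.sum_waitingTimes] using hT')

/-- If all jump times stayed below S, every waiting time would be at most S; for the first n this
has probability q^n with q < 1. -/
lemma IsPoissonTimes.ae_exists_gt (hτ : IsPoissonTimes μ τ) (T : ℝ) :
    ∀ᵐ ω ∂μ, ∃ n, T < τ n ω := by
  set S := max T 0 with hS
  have hq : expMeasure 1 (Iic S) < 1 := by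
    refine lt_of_le_of_ne prob_le_one fun h => ?_
    have h1 : expMeasure 1 (Ioi S) = 0 := by
      rw [← compl_Iic, prob_compl_eq_zero_iff measurableSet_Iic, h]
    rw [expMeasure_Ioi (le_max_right _ _), ENNReal.ofReal_eq_zero] at h1
    exact absurd h1 (not_le.2 (Real.exp_pos _))
  have hle : ∀ n : ℕ, μ {ω | (∀ k, τ k ω ≤ S) ∧ ∀ k, τ k ω < τ (k + 1) ω} ≤
      expMeasure 1 (Iic S) ^ n := fun n => by
    calc _ ≤ μ (waitingTimes τ n ⁻¹' (Set.pi univ fun _ => Iic S)) := by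
          refine measure_mono fun ω hω i _ => ?_
          have h0 : 0 ≤ τ i ω := by
            rw [← hτ.zero ω]
            exact (strictMono_nat_of_lt_succ hω.2).monotone (Nat.zero_le _)
          have := hω.1 (i + 1)
          simp only [waitingTimes, mem_Iic]
          linarith
      _ = _ := by
          rw [← Measure.map_apply (hτ.measurable_waitingTimes n)
            (MeasurableSet.univ_pi fun _ => measurableSet_Iic), hτ.map_waitingTimes,
            Measure.pi_pi]
          simp
  have h0 : μ {ω | (∀ k, τ k ω ≤ S) ∧ ∀ k, τ k ω < τ (k + 1) ω} = 0 :=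
    le_antisymm (ge_of_tendsto' (ENNReal.tendsto_pow_atTop_nhds_zero_of_lt_one hq) hle) zero_le
  filter_upwards [measure_eq_zero_iff_ae_notMem.1 h0, hτ.ae_lt_succ] with ω h1 h2
  by_contra hcon
  push Not at hcon
  exact h1 ⟨fun k => (hcon k).trans (le_max_left _ _), h2⟩

lemma IsPoissonTimes.ae_mem_iUnion_jumpEvent (hτ : IsPoissonTimes μ τ) (hT : 0 < T) :
    ∀ᵐ ω ∂μ, ω ∈ ⋃ n, jumpEvent T τ n := by
  filter_upwards [hτ.ae_exists_gt T, hτ.ae_ne hT] with ω h1 h2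
  classical
  have hpos : Nat.find h1 ≠ 0 := fun h0 => by
    have := Nat.find_spec h1
    rw [h0, hτ.zero] at this
    exact this.not_gt hT
  obtain ⟨n, hn⟩ := Nat.exists_eq_succ_of_ne_zero hpos
  refine mem_iUnion.2 ⟨n, ?_, ?_⟩
  · exact lt_of_le_of_ne (not_lt.1 (Nat.find_min h1 (by omega))) (h2 n)
  · have := Nat.find_spec h1
    rwa [hn] at this

lemma IsPoissonTimes.aedisjoint_jumpEvent (hτ : IsPoissonTimes μ τ) :
    Pairwise (Function.onFun (AEDisjoint μ) (jumpEvent T τ)) := by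
  intro m n hmn
  refine measure_mono_null (t := {ω | ¬ StrictMono fun k => τ k ω}) ?_ hτ.ae_strictMono
  intro ω hω hmono
  exact hmn ((jumpCount_eq_of_mem hmono hω.1).symm.trans (jumpCount_eq_of_mem hmono hω.2))

lemma measurableSet_increments (n : ℕ) (T : ℝ) :
    MeasurableSet {δ : Fin n → ℝ | (∀ i, 0 < δ i) ∧ ∑ i, δ i < T} := by
  have h : {δ : Fin n → ℝ | (∀ i, 0 < δ i) ∧ ∑ i, δ i < T} =
      (⋂ i, {δ | 0 < δ i}) ∩ {δ | ∑ i, δ i < T} := by ext; simp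
  rw [h]
  exact (MeasurableSet.iInter fun i => measurableSet_lt measurable_const
    (measurable_pi_apply i)).inter (measurableSet_lt (by fun_prop) measurable_const)

/-- The joint law of the waiting times on the event of exactly `n` jumps. -/
lemma IsPoissonTimes.lintegral_waitingTimes (hτ : IsPoissonTimes μ τ) (n : ℕ)
    {Ψ : (Fin n → ℝ) → ℝ≥0∞} (hΨ : Measurable Ψ) :
    ∫⁻ ω in jumpEvent T τ n, Ψ (waitingTimes τ n ω) ∂μ =
      ENNReal.ofReal (Real.exp (-T)) *
        ∫⁻ δ in {δ : Fin n → ℝ | (∀ i, 0 < δ i) ∧ ∑ i, δ i < T}, Ψ δ := by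
  have hD := measurableSet_increments n T
  -- The event of n jumps also involves the (n+1)-st waiting time, so it is written in terms of n +
  -- 1 of them and the last one is integrated out.
  set g : (Fin (n + 1) → ℝ) → ℝ≥0∞ := fun v =>
    {v : Fin (n + 1) → ℝ | ∑ i : Fin n, v i.castSucc < T ∧ T < ∑ i, v i}.indicator
      (fun v => Ψ fun i => v i.castSucc) v with hg
  have hgm : Measurable g := by
    refine Measurable.indicator (hΨ.comp
      (f := fun (v : Fin (n + 1) → ℝ) (i : Fin n) => v i.castSucc) (by fun_prop)) ?_
    have h1 : Measurable fun v : Fin (n + 1) → ℝ => ∑ i : Fin n, v i.castSucc := by fun_prop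
    have h2 : Measurable fun v : Fin (n + 1) → ℝ => ∑ i, v i := by fun_prop
    exact (measurableSet_lt h1 measurable_const).inter (measurableSet_lt measurable_const h2)
  have hT' : ∀ ω, (jumpEvent T τ n).indicator (fun ω => Ψ (waitingTimes τ n ω)) ω =
      g (waitingTimes τ (n + 1) ω) := fun ω => by
    have e : (fun i : Fin n => waitingTimes τ (n + 1) ω i.castSucc) = waitingTimes τ n ω := by
      rw [waitingTimes_succ]; simp
    simp only [hg, indicator, jumpEvent, mem_ofPred_eq, hτ.sum_waitingTimes, e]
    by_cases h : τ n ω < T ∧ T < τ (n + 1) ω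
    · exact (if_pos h).trans (if_pos h).symm
    · exact (if_neg h).trans (if_neg h).symm
  have hgs : Measurable fun q : (Fin n → ℝ) × ℝ => g (Fin.snoc q.1 q.2 : Fin (n + 1) → ℝ) :=
    hgm.comp measurable_snoc
  rw [← lintegral_indicator (hτ.measurableSet_jumpEvent n), lintegral_congr hT',
    ← lintegral_map hgm (hτ.measurable_waitingTimes _), hτ.map_waitingTimes,
    lintegral_pi_snoc _ hgm, lintegral_pi_expMeasure hgs.lintegral_prod_right',
    ← lintegral_indicator hD, ← lintegral_const_mul _ (hΨ.indicator hD)]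
  refine lintegral_congr fun δ => ?_
  by_cases hδ : (∀ i, 0 < δ i) ∧ ∑ i, δ i < T
  · rw [indicator_of_mem (show δ ∈ {δ : Fin n → ℝ | (∀ i, 0 < δ i) ∧ ∑ i, δ i < T} from hδ)]
    have e : ∀ u : ℝ, g (Fin.snoc δ u : Fin (n + 1) → ℝ) =
        (Ioi (T - ∑ i, δ i)).indicator (fun _ => Ψ δ) u := fun u => by
      simp only [hg, indicator, mem_ofPred_eq, Fin.snoc_castSucc, Fin.sum_univ_castSucc,
        Fin.snoc_last, mem_Ioi, hδ.2, true_and, sub_lt_iff_lt_add']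
    simp only [e]
    rw [lintegral_indicator measurableSet_Ioi, setLIntegral_const,
      expMeasure_Ioi (by linarith [hδ.2])]
    -- The densities multiply to e^{-∑δ_i} and the tail of the next waiting time is e^{-(T-∑δ_i)};
    -- together they give the constant e^{-T}.
    have e3 : ∏ i, timeSing 0 1 (δ i) = ENNReal.ofReal (Real.exp (-∑ i, δ i)) := by
      rw [← Finset.sum_neg_distrib, Real.exp_sum, ENNReal.ofReal_prod_of_nonneg
        fun _ _ => Real.exp_nonneg _]
      exact Finset.prod_congr rfl fun i _ => by simp [timeSing_of_pos (hδ.1 i)]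
    rw [e3, mul_left_comm, ← ENNReal.ofReal_mul (Real.exp_nonneg _), ← Real.exp_add, mul_comm]
    ring_nf
  · rw [indicator_of_notMem (show δ ∉ {δ : Fin n → ℝ | (∀ i, 0 < δ i) ∧ ∑ i, δ i < T} from hδ),
      mul_zero]
    by_cases hpos : ∀ i, 0 < δ i
    · have hsum : ¬ ∑ i, δ i < T := fun h => hδ ⟨hpos, h⟩
      have e : ∀ u : ℝ, g (Fin.snoc δ u : Fin (n + 1) → ℝ) = 0 := fun u => by
        refine indicator_of_notMem (fun h => hsum ?_) _
        simpa using h.1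
      simp only [e, lintegral_zero, mul_zero]
    · push Not at hpos
      obtain ⟨i, hi⟩ := hpos
      rw [Finset.prod_eq_zero (Finset.mem_univ i) (timeSing_of_nonpos hi), zero_mul]

end Poisson

/-! ### The law of the process on the random grid -/

section Grid

variable {d : ℕ} {Ω : Type*} {T : ℝ} {τ : ℕ → Ω → ℝ} {X : ℝ → Ω → Space d} {x : Space d}

/-- The states at the first `k` grid points after the starting point. -/
def gridPath (T : ℝ) (τ : ℕ → Ω → ℝ) (X : ℝ → Ω → Space d) (k : ℕ) (ω : Ω) : Fin k → Space d :=
  fun i => gridState T τ X (i + 1) ω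

/-- The jump times as a random sequence. -/
def jumpTimes (τ : ℕ → Ω → ℝ) (ω : Ω) : ℕ → ℝ := fun j => τ j ω

lemma gridPath_succ (T : ℝ) (τ : ℕ → Ω → ℝ) (X : ℝ → Ω → Space d) (k : ℕ) (ω : Ω) :
    gridPath T τ X (k + 1) ω =
      (Fin.snoc (gridPath T τ X k ω) (gridState T τ X (k + 1) ω) : Fin (k + 1) → Space d) := by
  ext i : 1
  refine Fin.lastCases ?_ (fun j => ?_) i <;> simp [gridPath]

lemma pathEnd_gridPath (hT : 0 < T) {ω : Ω} (h0 : τ 0 ω = 0) (hx : X 0 ω = x) (k : ℕ) :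
    pathEnd x (gridPath T τ X k ω) = gridState T τ X k ω := by
  cases k with
  | zero => rw [pathEnd_zero, gridState, h0, min_eq_left hT.le, hx]
  | succ k => rw [gridPath_succ, pathEnd_snoc]

lemma measurable_jumpTimes_gridPast (T : ℝ) (τ : ℕ → Ω → ℝ) (X : ℝ → Ω → Space d) (k j : ℕ) :
    Measurable[gridPast T τ X k] (τ j) :=
  Measurable.of_comap_le (le_trans (le_iSup (fun j => MeasurableSpace.comap (τ j) inferInstance) j)
    le_sup_left)

lemma measurable_gridState_gridPast (T : ℝ) (τ : ℕ → Ω → ℝ) (X : ℝ → Ω → Space d) {k j : ℕ}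
    (hj : j ≤ k) : Measurable[gridPast T τ X k] (gridState T τ X j) :=
  Measurable.of_comap_le (le_trans (le_iSup₂ (f := fun (j : ℕ) (_ : j ≤ k) =>
    MeasurableSpace.comap (gridState T τ X j) inferInstance) j hj) le_sup_right)

lemma measurable_jumpTimes_gridPath_gridPast (T : ℝ) (τ : ℕ → Ω → ℝ) (X : ℝ → Ω → Space d)
    (k : ℕ) : Measurable[gridPast T τ X k] fun ω => (jumpTimes τ ω, gridPath T τ X k ω) := by
  let : MeasurableSpace Ω := gridPast T τ X k
  exact Measurable.prodMk (measurable_pi_lambda _ fun j => measurable_jumpTimes_gridPast T τ X k j)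
    (measurable_pi_lambda _ fun i => measurable_gridState_gridPast T τ X i.2)

variable [MeasurableSpace Ω] {μ : Measure Ω}
  {p : ℝ → Space d → Space d → Space d → ℝ} {Pz : Space d → FunctionSemigroup d}

lemma gridPast_le (hτ : IsPoissonTimes μ τ) (hX : IsGridProcess μ T p x τ X) (k : ℕ) :
    gridPast T τ X k ≤ ‹MeasurableSpace Ω› :=
  sup_le (iSup_le fun j => (hτ.meas j).comap_le)
    (iSup_le fun j => iSup_le fun _ => (hX.meas j).comap_le)

lemma measurable_jumpTimes_gridPath (hτ : IsPoissonTimes μ τ) (hX : IsGridProcess μ T p x τ X)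
    (k : ℕ) : Measurable fun ω => (jumpTimes τ ω, gridPath T τ X k ω) :=
  (measurable_jumpTimes_gridPath_gridPast T τ X k).mono (gridPast_le hτ hX k) le_rfl

/-- The transition density from the grid point `k` as a function of the past. -/
noncomputable def gridDensity (T : ℝ) (p : ℝ → Space d → Space d → Space d → ℝ) (x : Space d)
    (k : ℕ) (q : ((ℕ → ℝ) × (Fin k → Space d)) × Space d) : ℝ≥0∞ :=
  ENNReal.ofReal (diag p (min (q.1.1 (k + 1)) T - q.1.1 k) (pathEnd x q.1.2) q.2)

lemma measurable_diag (hPz : FrozenHyp T Pz p) :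
    Measurable fun q : ℝ × Space d × Space d => diag p q.1 q.2.1 q.2.2 :=
  hPz.meas.comp (f := fun q : ℝ × Space d × Space d => (q.1, q.2.1, q.2.1, q.2.2)) (by fun_prop)

lemma measurable_gridDensity (hPz : FrozenHyp T Pz p) (k : ℕ) :
    Measurable (gridDensity T p x k) := by
  refine ENNReal.measurable_ofReal.comp ((measurable_diag hPz).comp
    (f := fun q : ((ℕ → ℝ) × (Fin k → Space d)) × Space d =>
      (min (q.1.1 (k + 1)) T - q.1.1 k, pathEnd x q.1.2, q.2)) ?_)
  refine Measurable.prodMk ?_ (by fun_prop)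
  have h : ∀ j : ℕ, Measurable fun q : ((ℕ → ℝ) × (Fin k → Space d)) × Space d => q.1.1 j :=
    fun j => (measurable_pi_apply j).comp (measurable_fst.comp measurable_fst)
  exact ((h _).min measurable_const).sub (h _)

variable [IsProbabilityMeasure μ]

/-- The defining property of conditional expectation, integrated over a past event on which the
Markov hypothesis is in force. On it the step length lies in (0, T], so the transition density is
nonnegative and integrable. -/
lemma measure_inter_gridState_succ (hT : 0 < T) (hPz : FrozenHyp T Pz p)
    (hτ : IsPoissonTimes μ τ) (hX : IsGridProcess μ T p x τ X) (k : ℕ)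
    {M : Set Ω} (hM : MeasurableSet[gridPast T τ X k] M) (hMT : M ⊆ {ω | τ k ω < T})
    {B : Set (Space d)} (hB : MeasurableSet B) :
    μ (gridState T τ X (k + 1) ⁻¹' B ∩ M) =
      ∫⁻ ω in M, (∫⁻ z in B,
        gridDensity T p x k ((jumpTimes τ ω, gridPath T τ X k ω), z)) ∂μ := by
  have hle := gridPast_le hτ hX k
  have hS : MeasurableSet (gridState T τ X (k + 1) ⁻¹' B) := hX.meas (k + 1) hB
  have hM' : MeasurableSet M := hle _ hM
  have hind : Integrable ((gridState T τ X (k + 1) ⁻¹' B).indicator fun _ => (1 : ℝ)) μ :=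
    (integrable_const 1).indicator hS
  have h1 := setIntegral_condExp hle hind hM
  rw [integral_indicator hS, setIntegral_const, smul_eq_mul, mul_one,
    measureReal_restrict_apply hS] at h1
  have hnn : 0 ≤ᵐ[μ.restrict M] μ⟦gridState T τ X (k + 1) ⁻¹' B|gridPast T τ X k⟧ :=
    ae_restrict_of_ae (condExp_nonneg (ae_of_all _ fun ω => indicator_nonneg (by simp) ω))
  rw [← ofReal_measureReal, ← h1,
    ofReal_integral_eq_lintegral_ofReal integrable_condExp.integrableOn hnn]
  refine lintegral_congr_ae ?_
  have hmk := ae_mono (Measure.restrict_mono hMT le_rfl) (hX.markov k B hB)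
  filter_upwards [hmk, ae_restrict_of_ae hτ.ae_strictMono, ae_restrict_mem hM'] with ω h2 h3 h4
  have h0 : 0 ≤ τ k ω := by rw [← hτ.zero ω]; exact h3.monotone (Nat.zero_le k)
  have hlt : τ k ω < τ (k + 1) ω := h3 (Nat.lt_succ_self k)
  have hmem : min (τ (k + 1) ω) T - τ k ω ∈ Ioc 0 T := by
    have := hMT h4
    exact ⟨by simpa using ⟨hlt, this⟩, by linarith [min_le_right (τ (k + 1) ω) T]⟩
  have hmeas : Measurable fun z => diag p (min (τ (k + 1) ω) T - τ k ω)
      (gridState T τ X k ω) z :=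
    (measurable_diag hPz).comp (f := fun z : Space d => (min (τ (k + 1) ω) T - τ k ω,
      gridState T τ X k ω, z)) (by fun_prop)
  have hnn' : ∀ z, 0 ≤ diag p (min (τ (k + 1) ω) T - τ k ω) (gridState T τ X k ω) z :=
    fun z => hPz.nonneg _ hmem _ _ _
  have hint : Integrable fun z => diag p (min (τ (k + 1) ω) T - τ k ω)
      (gridState T τ X k ω) z := by
    refine ⟨hmeas.aestronglyMeasurable, ?_⟩
    rw [hasFiniteIntegral_iff_ofReal (ae_of_all _ hnn')]
    exact (hPz.mass _ hmem _ _).trans_lt ENNReal.one_lt_top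
  rw [h2]
  refine (ofReal_integral_eq_lintegral_ofReal hint.integrableOn (ae_of_all _ hnn')).trans ?_
  simp only [gridDensity, pathEnd_gridPath hT (hτ.zero ω) (hX.init ω), jumpTimes]

/-- Both measures agree on rectangles by the Markov property. The past contains all jump times, so
the density may depend on τ_{k+1}. -/
lemma map_gridState_succ (hT : 0 < T) (hPz : FrozenHyp T Pz p)
    (hτ : IsPoissonTimes μ τ) (hX : IsGridProcess μ T p x τ X) (k : ℕ) :
    (μ.restrict {ω | τ k ω < T}).map
        (fun ω => ((jumpTimes τ ω, gridPath T τ X k ω), gridState T τ X (k + 1) ω)) =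
      (((μ.restrict {ω | τ k ω < T}).map fun ω => (jumpTimes τ ω, gridPath T τ X k ω)).prod
        volume).withDensity (gridDensity T p x k) := by
  have hY := measurable_jumpTimes_gridPath hτ hX k
  have hYS := hY.prodMk (hX.meas (k + 1))
  have hK := measurable_gridDensity (x := x) hPz k
  have := Measure.isFiniteMeasure_map (μ.restrict {ω | τ k ω < T})
    (fun ω => ((jumpTimes τ ω, gridPath T τ X k ω), gridState T τ X (k + 1) ω))
  refine Measure.ext_prod fun {A B} hA hB => ?_
  rw [Measure.map_apply hYS (hA.prod hB), withDensity_apply _ (hA.prod hB),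
    ← Measure.prod_restrict, lintegral_prod _ hK.aemeasurable, Measure.restrict_map hY hA,
    lintegral_map hK.lintegral_prod_right' hY, Measure.restrict_restrict (hY hA),
    Measure.restrict_apply (hYS (hA.prod hB)), ← measure_inter_gridState_succ hT hPz hτ hX k
      ?_ inter_subset_right hB]
  · congr 1
    ext ω
    simp only [mem_inter_iff, mem_preimage, mem_prod]
    tauto
  · exact MeasurableSet.inter (measurable_jumpTimes_gridPath_gridPast T τ X k hA)
      (measurable_jumpTimes_gridPast T τ X k k measurableSet_Iio)

lemma lintegral_gridState_succ (hT : 0 < T) (hPz : FrozenHyp T Pz p)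
    (hτ : IsPoissonTimes μ τ) (hX : IsGridProcess μ T p x τ X) (k : ℕ)
    {g : ((ℕ → ℝ) × (Fin k → Space d)) × Space d → ℝ≥0∞} (hg : Measurable g) :
    ∫⁻ ω in {ω | τ k ω < T},
        g ((jumpTimes τ ω, gridPath T τ X k ω), gridState T τ X (k + 1) ω) ∂μ =
      ∫⁻ ω in {ω | τ k ω < T}, (∫⁻ z,
        gridDensity T p x k ((jumpTimes τ ω, gridPath T τ X k ω), z) *
          g ((jumpTimes τ ω, gridPath T τ X k ω), z)) ∂μ := by
  have hY := measurable_jumpTimes_gridPath hτ hX k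
  have hYS := hY.prodMk (hX.meas (k + 1))
  have hK := measurable_gridDensity (x := x) hPz k
  have hKg : Measurable fun q => gridDensity T p x k q * g q := hK.mul hg
  rw [← lintegral_map hg hYS, map_gridState_succ hT hPz hτ hX k,
    lintegral_withDensity_eq_lintegral_mul _ hK hg]
  simp only [Pi.mul_apply]
  rw [lintegral_prod _ hKg.aemeasurable, lintegral_map hKg.lintegral_prod_right' hY]

/-- The joint law of the jump times and the first grid states. -/
lemma lintegral_gridPath (hT : 0 < T) (hPz : FrozenHyp T Pz p)
    (hτ : IsPoissonTimes μ τ) (hX : IsGridProcess μ T p x τ X) (k : ℕ)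
    {H : (ℕ → ℝ) × (Fin k → Space d) → ℝ≥0∞} (hH : Measurable H)
    (hv : ∀ t w, (∃ j ≤ k, T ≤ t j) → H (t, w) = 0) :
    ∫⁻ ω, H (jumpTimes τ ω, gridPath T τ X k ω) ∂μ =
      ∫⁻ ω, (∫⁻ w : Fin k → Space d, pathProd (fun t y z => ENNReal.ofReal (diag p t y z)) x
        (waitingTimes τ k ω) w * H (jumpTimes τ ω, w)) ∂μ := by
  induction k with
  | zero =>
    refine lintegral_congr fun ω => ?_
    rw [volume_pi, Measure.pi_of_empty _ (gridPath T τ X 0 ω), lintegral_dirac]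
    simp
  | succ k ih =>
    have hP : Measurable fun q : ℝ × Space d × Space d =>
        ENNReal.ofReal (diag p q.1 q.2.1 q.2.2) :=
      ENNReal.measurable_ofReal.comp (measurable_diag hPz)
    have hset : MeasurableSet {ω | τ k ω < T} := measurableSet_lt (hτ.meas k) measurable_const
    set g : ((ℕ → ℝ) × (Fin k → Space d)) × Space d → ℝ≥0∞ := fun q =>
      H (q.1.1, (Fin.snoc q.1.2 q.2 : Fin (k + 1) → Space d)) with hg_def
    have hg : Measurable g := hH.comp (Measurable.prodMk (by fun_prop)
      (measurable_snoc.comp (f := fun q : ((ℕ → ℝ) × (Fin k → Space d)) × Space d =>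
        (q.1.2, q.2)) (by fun_prop)))
    set H' : (ℕ → ℝ) × (Fin k → Space d) → ℝ≥0∞ := fun q => ∫⁻ z,
      ENNReal.ofReal (diag p (q.1 (k + 1) - q.1 k) (pathEnd x q.2) z) * g (q, z) with hH'_def
    have hH' : Measurable H' := by
      refine Measurable.lintegral_prod_right' (f := fun q : ((ℕ → ℝ) × (Fin k → Space d)) ×
        Space d => ENNReal.ofReal (diag p (q.1.1 (k + 1) - q.1.1 k) (pathEnd x q.1.2) q.2) *
          g q) (Measurable.mul ?_ hg)
      refine hP.comp (f := fun q : ((ℕ → ℝ) × (Fin k → Space d)) × Space d =>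
        (q.1.1 (k + 1) - q.1.1 k, pathEnd x q.1.2, q.2)) ?_
      have h : ∀ j : ℕ, Measurable fun q : ((ℕ → ℝ) × (Fin k → Space d)) × Space d => q.1.1 j :=
        fun j => (measurable_pi_apply j).comp (measurable_fst.comp measurable_fst)
      exact ((h _).sub (h _)).prodMk (by fun_prop)
    have hrestrict : ∀ f : Ω → ℝ≥0∞, (∀ ω, T ≤ τ k ω → f ω = 0) →
        ∫⁻ ω, f ω ∂μ = ∫⁻ ω in {ω | τ k ω < T}, f ω ∂μ := fun f hf => by
      rw [← lintegral_indicator hset]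
      refine lintegral_congr fun ω => ?_
      by_cases hω : τ k ω < T
      · exact (indicator_of_mem (show ω ∈ {ω | τ k ω < T} from hω) f).symm
      · rw [indicator_of_notMem (show ω ∉ {ω | τ k ω < T} from hω) f, hf ω (not_lt.1 hω)]
    have hH'v : ∀ t w, (∃ j ≤ k, T ≤ t j) → H' (t, w) = 0 := by
      rintro t w ⟨j, hj, hjt⟩
      refine (lintegral_congr fun z => ?_).trans lintegral_zero
      simp only [hg_def]
      rw [hv _ _ ⟨j, by omega, hjt⟩, mul_zero]
    calc ∫⁻ ω, H (jumpTimes τ ω, gridPath T τ X (k + 1) ω) ∂μ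
        = ∫⁻ ω in {ω | τ k ω < T},
            g ((jumpTimes τ ω, gridPath T τ X k ω), gridState T τ X (k + 1) ω) ∂μ := by
          rw [hrestrict _ fun ω hω => hv _ _ ⟨k, by omega, hω⟩]
          simp only [hg_def, gridPath_succ]
      _ = ∫⁻ ω in {ω | τ k ω < T}, H' (jumpTimes τ ω, gridPath T τ X k ω) ∂μ := by
          rw [lintegral_gridState_succ hT hPz hτ hX k hg]
          refine lintegral_congr fun ω => lintegral_congr fun z => ?_
          -- Where the next jump comes before T the cap at T is inactive; otherwise the integrand
          -- vanishes by `hv`.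
          by_cases hω : τ (k + 1) ω < T
          · simp only [gridDensity, jumpTimes, min_eq_left hω.le]
          · have : g ((jumpTimes τ ω, gridPath T τ X k ω), z) = 0 :=
              hv _ _ ⟨k + 1, le_rfl, not_lt.1 hω⟩
            rw [this, mul_zero, mul_zero]
      _ = ∫⁻ ω, H' (jumpTimes τ ω, gridPath T τ X k ω) ∂μ :=
          (hrestrict _ fun ω hω => hH'v _ _ ⟨k, le_rfl, hω⟩).symm
      _ = ∫⁻ ω, (∫⁻ w : Fin k → Space d, pathProd (fun t y z => ENNReal.ofReal (diag p t y z)) x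
            (waitingTimes τ k ω) w * H' (jumpTimes τ ω, w)) ∂μ := ih hH' hH'v
      _ = _ := by
          refine lintegral_congr fun ω => ?_
          have hF : Measurable fun w : Fin (k + 1) → Space d =>
              pathProd (fun t y z => ENNReal.ofReal (diag p t y z)) x
                (waitingTimes τ (k + 1) ω) w * H (jumpTimes τ ω, w) := by
            refine Measurable.mul ?_ (hH.comp measurable_prodMk_left)
            exact (measurable_pathProd (k := fun t y z => ENNReal.ofReal (diag p t y z)) hP x).comp
              (measurable_prodMk_left (x := waitingTimes τ (k + 1) ω))
          rw [volume_pi, volume_pi, lintegral_pi_snoc _ hF]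
          refine lintegral_congr fun w => ?_
          rw [hH'_def, waitingTimes_succ]
          simp only [pathProd_snoc, mul_assoc]
          rw [lintegral_const_mul]
          · rfl
          · exact (hP.comp (f := fun z : Space d => (τ (k + 1) ω - τ k ω, pathEnd x w, z))
              (by fun_prop)).mul (hg.comp (f := fun z : Space d => ((jumpTimes τ ω, w), z))
                (by fun_prop))

/-- The joint law of the waiting times and the grid states on the event of exactly `n` jumps. -/
lemma lintegral_waitingTimes_gridPath (hT : 0 < T) (hPz : FrozenHyp T Pz p)
    (hτ : IsPoissonTimes μ τ) (hX : IsGridProcess μ T p x τ X) (n : ℕ)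
    {F : (Fin n → ℝ) × (Fin n → Space d) → ℝ≥0∞} (hF : Measurable F) :
    ∫⁻ ω in jumpEvent T τ n, F (waitingTimes τ n ω, gridPath T τ X n ω) ∂μ =
      ENNReal.ofReal (Real.exp (-T)) *
        ∫⁻ δ in {δ : Fin n → ℝ | (∀ i, 0 < δ i) ∧ ∑ i, δ i < T}, ∫⁻ w : Fin n → Space d,
          pathProd (fun t y z => ENNReal.ofReal (diag p t y z)) x δ w * F (δ, w) := by
  have hP : Measurable fun q : ℝ × Space d × Space d => ENNReal.ofReal (diag p q.1 q.2.1 q.2.2) :=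
    ENNReal.measurable_ofReal.comp (measurable_diag hPz)
  -- All of t_0, …, t_n are required to be below T because `lintegral_gridPath` needs vanishing for
  -- arbitrary, possibly non-monotone, sequences. For the jump times this is almost surely the event
  -- of n jumps.
  set D : Set (ℕ → ℝ) := {t | (∀ j ≤ n, t j < T) ∧ T < t (n + 1)} with hD_def
  have hD : MeasurableSet D := by
    have : D = (⋂ j ∈ Iic n, {t | t j < T}) ∩ {t | T < t (n + 1)} := by ext; simp [hD_def]
    rw [this]
    exact (MeasurableSet.biInter (to_countable _) fun j _ => measurableSet_lt
      (measurable_pi_apply j) measurable_const).inter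
      (measurableSet_lt measurable_const (measurable_pi_apply _))
  set W : (ℕ → ℝ) → Fin n → ℝ := fun t i => t (i + 1) - t i with hW_def
  have hW : Measurable W :=
    measurable_pi_lambda _ fun i => (measurable_pi_apply _).sub (measurable_pi_apply _)
  set H : (ℕ → ℝ) × (Fin n → Space d) → ℝ≥0∞ := fun q =>
    (D ×ˢ univ).indicator (fun q => F (W q.1, q.2)) q with hH_def
  have hH : Measurable H := Measurable.indicator (hF.comp (by fun_prop)) (hD.prod .univ)
  have hv : ∀ t w, (∃ j ≤ n, T ≤ t j) → H (t, w) = 0 := by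
    rintro t w ⟨j, hj, hjt⟩
    exact indicator_of_notMem (fun h => (h.1.1 j hj).not_ge hjt) _
  have hmem : ∀ᵐ ω ∂μ, jumpTimes τ ω ∈ D ↔ ω ∈ jumpEvent T τ n := by
    filter_upwards [hτ.ae_strictMono] with ω hω
    refine ⟨fun h => ⟨h.1 n le_rfl, h.2⟩, fun h => ⟨fun j hj => ?_, h.2⟩⟩
    exact (hω.monotone hj).trans_lt h.1
  have hjm := hτ.measurableSet_jumpEvent (T := T) n
  have key := lintegral_gridPath hT hPz hτ hX n hH hv
  have e1 : ∫⁻ ω, H (jumpTimes τ ω, gridPath T τ X n ω) ∂μ =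
      ∫⁻ ω in jumpEvent T τ n, F (waitingTimes τ n ω, gridPath T τ X n ω) ∂μ := by
    rw [← lintegral_indicator hjm]
    refine lintegral_congr_ae ?_
    filter_upwards [hmem] with ω hω
    by_cases h : ω ∈ jumpEvent T τ n
    · rw [indicator_of_mem h]
      exact indicator_of_mem (show (jumpTimes τ ω, _) ∈ D ×ˢ univ from ⟨hω.2 h, mem_univ _⟩) _
    · rw [indicator_of_notMem h]
      exact indicator_of_notMem (fun h' => h (hω.1 h'.1)) _
  have hpF : Measurable fun q : (Fin n → ℝ) × (Fin n → Space d) =>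
      pathProd (fun t y z => ENNReal.ofReal (diag p t y z)) x q.1 q.2 * F q :=
    (measurable_pathProd hP x).mul hF
  rw [← hτ.lintegral_waitingTimes n hpF.lintegral_prod_right', ← e1, key,
    ← lintegral_indicator hjm]
  refine lintegral_congr_ae ?_
  filter_upwards [hmem] with ω hω
  by_cases h : ω ∈ jumpEvent T τ n
  · rw [indicator_of_mem h]
    refine lintegral_congr fun w => ?_
    congr 1
    exact indicator_of_mem (show (jumpTimes τ ω, _) ∈ D ×ˢ univ from ⟨hω.2 h, mem_univ _⟩) _
  · rw [indicator_of_notMem h]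
    refine (lintegral_congr fun w => ?_).trans lintegral_zero
    have : H (jumpTimes τ ω, w) = 0 := indicator_of_notMem (fun h' => h (hω.1 h'.1)) _
    rw [this, mul_zero]

end Grid

/-! ### The probabilistic representation of the gradient -/

section Representation

variable {d : ℕ} {Ω : Type*} {T : ℝ} {τ : ℕ → Ω → ℝ} {X : ℝ → Ω → Space d} {x : Space d}
  {p : ℝ → Space d → Space d → Space d → ℝ} {Pz : Space d → FunctionSemigroup d}
  {θ : ℝ → Space d → Space d → ℝ}

lemma cons_gridPath_castSucc (hT : 0 < T) {ω : Ω} (h0 : τ 0 ω = 0) (hx : X 0 ω = x) {n : ℕ}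
    (i : Fin n) : (Fin.cons x (gridPath T τ X n ω) : Fin (n + 1) → Space d) i.castSucc =
      gridState T τ X i ω := by
  obtain ⟨i, hi⟩ := i
  cases i with
  | zero =>
    rw [gridState, h0, min_eq_left hT.le, hx]
    rfl
  | succ i => rfl

lemma pathProd_cut_weightedKernel (hPz : FrozenHyp T Pz p) {n : ℕ} {δ : Fin n → ℝ}
    (hδ : ∀ i, δ i ∈ Ioc 0 T) (w : Fin n → Space d) :
    pathProd (cut T (weightedKernel θ p)) x δ w =
      (pathProd (fun t y z => ENNReal.ofReal (diag p t y z)) x δ w).toReal *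
        pathProd θ x δ w := by
  have hp : ∀ i y z, 0 ≤ diag p (δ i) y z := fun i y z => hPz.nonneg _ (hδ i) _ _ _
  rw [← ofReal_pathProd hp, ENNReal.toReal_ofReal (pathProd_nonneg hp), ← pathProd_mul]
  refine pathProd_congr fun i y z => ?_
  rw [cut_of_mem (hδ i), weightedKernel, mul_comm]

/-- The integrand of the representation as a function of the waiting times and grid states. -/
noncomputable def gridIntegrand {F : Type*} [NormedAddCommGroup F] [NormedSpace ℝ F] (T : ℝ)
    (θ : ℝ → Space d → Space d → ℝ) (G : ℝ → Space d → Space d → F) (x y : Space d) (n : ℕ)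
    (q : (Fin n → ℝ) × (Fin n → Space d)) : F :=
  pathProd θ x q.1 q.2 • cut T G (T - ∑ i, q.1 i) (pathEnd x q.2) y

/-- The joint density of the waiting times and grid states, without the factor `e^{-T}`. -/
noncomputable def gridLaw (T : ℝ) (p : ℝ → Space d → Space d → Space d → ℝ) (x : Space d) (n : ℕ) :
    (Fin n → ℝ) × (Fin n → Space d) → ℝ≥0∞ :=
  ({δ : Fin n → ℝ | (∀ i, 0 < δ i) ∧ ∑ i, δ i < T} ×ˢ univ).indicator fun q =>
    pathProd (fun t y z => ENNReal.ofReal (diag p t y z)) x q.1 q.2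

lemma measurable_gridLaw (hPz : FrozenHyp T Pz p) (n : ℕ) : Measurable (gridLaw T p x n) :=
  (measurable_pathProd (k := fun t y z => ENNReal.ofReal (diag p t y z))
    (ENNReal.measurable_ofReal.comp (measurable_diag hPz)) x).indicator
    ((measurableSet_increments n T).prod .univ)

lemma gridLaw_ne_top (n : ℕ) (q : (Fin n → ℝ) × (Fin n → Space d)) :
    gridLaw T p x n q ≠ ∞ := by
  unfold gridLaw indicator
  split_ifs
  · exact ENNReal.prod_ne_top fun _ _ => ENNReal.ofReal_ne_top
  · exact ENNReal.zero_ne_top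

/-- The meeting point of the two sides: the transition densities in the law combine with the weights
θ into a = θ p, and off the simplex both sides are zero. -/
lemma gridLaw_toReal_smul_gridIntegrand {F : Type*} [NormedAddCommGroup F] [NormedSpace ℝ F]
    (hPz : FrozenHyp T Pz p) (G : ℝ → Space d → Space d → F) (y : Space d) (n : ℕ)
    (q : (Fin n → ℝ) × (Fin n → Space d)) :
    (gridLaw T p x n q).toReal • gridIntegrand T θ G x y n q =
      pathProd (cut T (weightedKernel θ p)) x q.1 q.2 •
        cut T G (T - ∑ i, q.1 i) (pathEnd x q.2) y := by
  by_cases hq : (∀ i, 0 < q.1 i) ∧ ∑ i, q.1 i < T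
  · have h : gridLaw T p x n q =
        pathProd (fun t y z => ENNReal.ofReal (diag p t y z)) x q.1 q.2 :=
      indicator_of_mem (show q ∈ _ ×ˢ _ from ⟨hq, mem_univ _⟩) _
    rw [h, gridIntegrand, smul_smul, ← pathProd_cut_weightedKernel hPz
      (increment_mem_Ioc le_rfl hq.1 hq.2)]
  · have h : gridLaw T p x n q = 0 := indicator_of_notMem (fun h => hq h.1) _
    rw [h, ENNReal.toReal_zero, zero_smul, pathProd_smul_cut_eq_zero hq]

variable [MeasurableSpace Ω] {μ : Measure Ω}

lemma measurable_waitingTimes_gridPath (hτ : IsPoissonTimes μ τ)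
    (hX : IsGridProcess μ T p x τ X) (n : ℕ) :
    Measurable fun ω => (waitingTimes τ n ω, gridPath T τ X n ω) :=
  (hτ.measurable_waitingTimes n).prodMk (measurable_jumpTimes_gridPath hτ hX n).snd

lemma pathWeight_smul_eq_gridIntegrand (hT : 0 < T) (hτ : IsPoissonTimes μ τ)
    (hX : IsGridProcess μ T p x τ X) {F : Type*} [NormedAddCommGroup F] [NormedSpace ℝ F]
    (G : ℝ → Space d → Space d → F) (y : Space d) {n : ℕ} {ω : Ω}
    (hω : StrictMono fun k => τ k ω) (hn : ω ∈ jumpEvent T τ n) :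
    pathWeight T θ τ X ω • G (T - lastJump T τ ω) (X (lastJump T τ ω) ω) y =
      gridIntegrand T θ G x y n (waitingTimes τ n ω, gridPath T τ X n ω) := by
  have hcount := jumpCount_eq_of_mem hω hn
  have hX' : ∀ j ≤ n, X (τ j ω) ω = gridState T τ X j ω := fun j hj => by
    rw [gridState, min_eq_left ((hω.monotone hj).trans hn.1.le)]
  have h0 : 0 ≤ τ n ω := by rw [← hτ.zero ω]; exact hω.monotone (Nat.zero_le n)
  have hmem : T - τ n ω ∈ Ioc 0 T := ⟨by linarith [hn.1], by linarith⟩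
  rw [gridIntegrand, hτ.sum_waitingTimes, cut_of_mem hmem, pathEnd_gridPath hT (hτ.zero ω)
    (hX.init ω), lastJump, hcount, hX' n le_rfl, pathWeight, hcount, Finset.prod_range, pathProd]
  congr 1
  refine Finset.prod_congr rfl fun i _ => ?_
  rw [cons_gridPath_castSucc hT (hτ.zero ω) (hX.init ω), hX' i i.2.le, hX' (i + 1) i.2]
  rfl

variable [IsProbabilityMeasure μ]

lemma map_waitingTimes_gridPath (hT : 0 < T) (hPz : FrozenHyp T Pz p)
    (hτ : IsPoissonTimes μ τ) (hX : IsGridProcess μ T p x τ X) (n : ℕ) :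
    (μ.restrict (jumpEvent T τ n)).map (fun ω => (waitingTimes τ n ω, gridPath T τ X n ω)) =
      ENNReal.ofReal (Real.exp (-T)) • volume.withDensity (gridLaw T p x n) := by
  refine Measure.ext_of_lintegral _ fun F hF => ?_
  have hL := measurable_gridLaw (x := x) hPz n
  rw [lintegral_map hF (measurable_waitingTimes_gridPath hτ hX n),
    lintegral_waitingTimes_gridPath hT hPz hτ hX n hF, lintegral_smul_measure,
    lintegral_withDensity_eq_lintegral_mul _ hL hF, smul_eq_mul, Measure.volume_eq_prod,
    lintegral_prod _ (hL.mul hF).aemeasurable, ← lintegral_indicator (measurableSet_increments n T)]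
  congr 1
  refine lintegral_congr fun δ => ?_
  by_cases hδ : δ ∈ {δ : Fin n → ℝ | (∀ i, 0 < δ i) ∧ ∑ i, δ i < T}
  · rw [indicator_of_mem hδ]
    refine lintegral_congr fun w => ?_
    rw [Pi.mul_apply, gridLaw, indicator_of_mem (show (δ, w) ∈ _ ×ˢ _ from ⟨hδ, mem_univ _⟩)]
  · rw [indicator_of_notMem hδ]
    refine ((lintegral_congr fun w => ?_).trans lintegral_zero).symm
    rw [Pi.mul_apply, gridLaw, indicator_of_notMem (fun h => hδ h.1), zero_mul]

variable {F : Type*} [NormedAddCommGroup F] [NormedSpace ℝ F] [MeasurableSpace F] [BorelSpace F]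
  [SecondCountableTopology F]

lemma measurable_gridIntegrand {G : ℝ → Space d → Space d → F}
    (hθ : Measurable fun q : ℝ × Space d × Space d => θ q.1 q.2.1 q.2.2)
    (hG : Measurable fun q : ℝ × Space d × Space d => cut T G q.1 q.2.1 q.2.2) (y : Space d)
    (n : ℕ) : Measurable (gridIntegrand T θ G x y n) :=
  (measurable_pathIntegrand hθ hG n T x).comp (measurable_prodMk_right (y := y))

lemma setLIntegral_gridIntegrand (hT : 0 < T) (hPz : FrozenHyp T Pz p)
    (hτ : IsPoissonTimes μ τ) (hX : IsGridProcess μ T p x τ X)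
    (hθ : Measurable fun q : ℝ × Space d × Space d => θ q.1 q.2.1 q.2.2)
    {G : ℝ → Space d → Space d → F}
    (hG : Measurable fun q : ℝ × Space d × Space d => cut T G q.1 q.2.1 q.2.2)
    (y : Space d) (n : ℕ) :
    ∫⁻ ω in jumpEvent T τ n,
        ‖gridIntegrand T θ G x y n (waitingTimes τ n ω, gridPath T τ X n ω)‖ₑ ∂μ =
      ENNReal.ofReal (Real.exp (-T)) * ∫⁻ q : (Fin n → ℝ) × (Fin n → Space d),
        ‖pathProd (cut T (weightedKernel θ p)) x q.1 q.2 •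
          cut T G (T - ∑ i, q.1 i) (pathEnd x q.2) y‖ₑ := by
  have hF := measurable_gridIntegrand (x := x) hθ hG y n
  rw [← lintegral_map (f := fun q => ‖gridIntegrand T θ G x y n q‖ₑ) hF.enorm
    (measurable_waitingTimes_gridPath hτ hX n), map_waitingTimes_gridPath hT hPz hτ hX n,
    lintegral_smul_measure, smul_eq_mul,
    lintegral_withDensity_eq_lintegral_mul _ (measurable_gridLaw hPz n) hF.enorm]
  congr 1
  refine lintegral_congr fun q => ?_
  rw [← gridLaw_toReal_smul_gridIntegrand hPz G y n q, enorm_smul, Pi.mul_apply,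
    Real.enorm_of_nonneg ENNReal.toReal_nonneg, ENNReal.ofReal_toReal (gridLaw_ne_top n q)]

lemma setIntegral_gridIntegrand (hT : 0 < T) (hPz : FrozenHyp T Pz p)
    (hτ : IsPoissonTimes μ τ) (hX : IsGridProcess μ T p x τ X)
    (hθ : Measurable fun q : ℝ × Space d × Space d => θ q.1 q.2.1 q.2.2)
    {G : ℝ → Space d → Space d → F}
    (hG : Measurable fun q : ℝ × Space d × Space d => cut T G q.1 q.2.1 q.2.2)
    (y : Space d) (n : ℕ) :
    ∫ ω in jumpEvent T τ n,
        gridIntegrand T θ G x y n (waitingTimes τ n ω, gridPath T τ X n ω) ∂μ =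
      Real.exp (-T) • pathTerm (cut T (weightedKernel θ p)) (cut T G) n T x y := by
  have hF := measurable_gridIntegrand (x := x) hθ hG y n
  rw [← integral_map (f := gridIntegrand T θ G x y n)
    (measurable_waitingTimes_gridPath hτ hX n).aemeasurable hF.aestronglyMeasurable,
    map_waitingTimes_gridPath hT hPz hτ hX n, integral_smul_measure,
    ENNReal.toReal_ofReal (Real.exp_nonneg _),
    integral_withDensity_eq_integral_toReal_smul (measurable_gridLaw hPz n)
      (ae_of_all _ fun q => (gridLaw_ne_top n q).lt_top)]
  simp only [gridLaw_toReal_smul_gridIntegrand hPz G y n, pathTerm]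

/-- The expectation over the random grid is the sum of the path integrals. -/
lemma integrable_and_hasSum_pathTerm [CompleteSpace F] (hT : 0 < T) (hPz : FrozenHyp T Pz p)
    (hτ : IsPoissonTimes μ τ) (hX : IsGridProcess μ T p x τ X)
    (hθ : Measurable fun q : ℝ × Space d × Space d => θ q.1 q.2.1 q.2.2)
    {G : ℝ → Space d → Space d → F}
    (hG : Measurable fun q : ℝ × Space d × Space d => cut T G q.1 q.2.1 q.2.2)
    {σ : ℝ} (hσ : σ ∈ Ico (0 : ℝ) 1) {A : ℝ≥0∞} (hA : A ≠ ∞) (y : Space d)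
    (hb : PathBound σ A (cut T (weightedKernel θ p)) (cut T G) T x y) :
    Integrable (fun ω => pathWeight T θ τ X ω • G (T - lastJump T τ ω) (X (lastJump T τ ω) ω) y)
        μ ∧
      HasSum (fun n => pathTerm (cut T (weightedKernel θ p)) (cut T G) n T x y)
        (Real.exp T • ∫ ω, pathWeight T θ τ X ω •
          G (T - lastJump T τ ω) (X (lastJump T τ ω) ω) y ∂μ) := by
  set Φ : Ω → F := fun ω => pathWeight T θ τ X ω •
    G (T - lastJump T τ ω) (X (lastJump T τ ω) ω) y with hΦ
  have ham : Measurable fun q : ℝ × Space d × Space d =>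
      cut T (weightedKernel θ p) q.1 q.2.1 q.2.2 := measurable_cut (hθ.mul (measurable_diag hPz))
  have hms : ∀ n, NullMeasurableSet (jumpEvent T τ n) μ := fun n =>
    (hτ.measurableSet_jumpEvent n).nullMeasurableSet
  have hU : μ.restrict (⋃ n, jumpEvent T τ n) = μ :=
    Measure.restrict_eq_self_of_ae_mem (hτ.ae_mem_iUnion_jumpEvent hT)
  have hΦn : ∀ n, Φ =ᵐ[μ.restrict (jumpEvent T τ n)] fun ω =>
      gridIntegrand T θ G x y n (waitingTimes τ n ω, gridPath T τ X n ω) := fun n => by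
    filter_upwards [ae_restrict_of_ae hτ.ae_strictMono,
      ae_restrict_mem (hτ.measurableSet_jumpEvent n)] with ω h1 h2
    exact pathWeight_smul_eq_gridIntegrand hT hτ hX G y h1 h2
  have hint : Integrable Φ μ := by
    refine ⟨?_, ?_⟩
    -- The process is measurable only at grid points, so measurability is checked on each event of n
    -- jumps, where the random index of the last jump is fixed.
    · rw [← hU, aestronglyMeasurable_iUnion_iff]
      exact fun n => ((measurable_gridIntegrand hθ hG y n).comp
        (measurable_waitingTimes_gridPath hτ hX n)).aestronglyMeasurable.congr (hΦn n).symm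
    · obtain ⟨C, hC, hCn⟩ := PathBound.exists_lintegral_le ham hG hσ hA (t := T) (x := x)
      have hle : ∀ n, ∫⁻ ω in jumpEvent T τ n, ‖Φ ω‖ₑ ∂μ ≤
          ENNReal.ofReal (Real.exp (-T)) * ((C + ‖cut T G T x y‖ₑ) * 2⁻¹ ^ n) := fun n => by
        rw [lintegral_congr_ae ((hΦn n).mono fun ω h => by rw [h]),
          setLIntegral_gridIntegrand hT hPz hτ hX hθ hG y n]
        gcongr
        rcases Nat.eq_zero_or_pos n with rfl | hn
        -- The path bound starts at one step; the event of no jump is covered by the summand ‖G_T(x,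
        -- y)‖ in the constant.
        · simp [volume_prod_fin_zero]
        · refine (hCn y hb n hn).trans ?_
          gcongr
          exact le_self_add
      rw [HasFiniteIntegral, ← hU, lintegral_iUnion₀ hms hτ.aedisjoint_jumpEvent]
      refine (ENNReal.tsum_le_tsum hle).trans_lt ?_
      rw [ENNReal.tsum_mul_left, ENNReal.tsum_mul_left, ENNReal.tsum_geometric]
      refine ENNReal.mul_lt_top ENNReal.ofReal_lt_top (ENNReal.mul_lt_top
        (ENNReal.add_lt_top.2 ⟨hC.lt_top, enorm_lt_top⟩) ?_)
      simp
  refine ⟨hint, ?_⟩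
  have hsum := hasSum_integral_iUnion_ae hms hτ.aedisjoint_jumpEvent
    (hint.integrableOn (s := ⋃ n, jumpEvent T τ n))
  rw [hU] at hsum
  have hn : ∀ n, ∫ ω in jumpEvent T τ n, Φ ω ∂μ =
      Real.exp (-T) • pathTerm (cut T (weightedKernel θ p)) (cut T G) n T x y := fun n => by
    rw [integral_congr_ae (hΦn n), setIntegral_gridIntegrand hT hPz hτ hX hθ hG y n]
  simp only [hn] at hsum
  have := hsum.const_smul (Real.exp T)
  simpa only [smul_smul, ← Real.exp_add, add_neg_cancel, Real.exp_zero, one_smul] using this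

end Representation

end Parametrix

theorem mainTheorem8 {d : ℕ} {T ρ : ℝ} (hT : 0 < T)
    (P : Parametrix.FunctionSemigroup d)
    (Pz : Parametrix.Space d → Parametrix.FunctionSemigroup d)
    (p : ℝ → Parametrix.Space d → Parametrix.Space d → Parametrix.Space d → ℝ)
    (θ β γ : ℝ → Parametrix.Space d → Parametrix.Space d → ℝ)
    (hP : Parametrix.SemigroupHyp T P)
    (hPz : Parametrix.FrozenHyp T Pz p)
    (hL : Parametrix.LinkHyp P Pz)
    (hdom : Parametrix.DomainHyp T P Pz)
    (hθ : Parametrix.WeightHyp T Pz p θ)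
    (ha : Parametrix.KernelHyp T ρ β γ (Parametrix.weightedKernel θ p))
    (hM : Parametrix.ClassM T β (Parametrix.diag p))
    (hUI : ∃ ζ κ : ℝ, 1 < ζ ∧ ζ * ρ < 1 ∧ κ ∈ Set.Ico (0 : ℝ) 1 ∧
      Parametrix.UniformIntegrability T ζ κ γ (Parametrix.diag p))
    (hdiff : ∀ t ∈ Set.Ioc (0 : ℝ) T, ∀ x, Differentiable ℝ (fun y => p t x x y))
    (hUIgrad : ∃ ζ κ : ℝ, 1 < ζ ∧ κ ∈ Set.Ico (0 : ℝ) 1 ∧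
      Parametrix.UniformIntegrability T ζ κ γ (Parametrix.diagGrad p)) :
    (∀ t ∈ Set.Ioc (0 : ℝ) T, ∀ x,
      (∀ y, Summable fun n : ℕ =>
        Parametrix.expansionTerm (Parametrix.weightedKernel θ p) (Parametrix.diag p) n t x y) ∧
      Differentiable ℝ (fun y => Parametrix.density p θ t x y)) ∧
    (∀ {Ω : Type*} [MeasurableSpace Ω] (μ : MeasureTheory.Measure Ω)
      [MeasureTheory.IsProbabilityMeasure μ] (τ : ℕ → Ω → ℝ) (X : ℝ → Ω → Parametrix.Space d)
      (x : Parametrix.Space d),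
      Parametrix.IsPoissonTimes μ τ → Parametrix.IsGridProcess μ T p x τ X →
      ∀ y,
        MeasureTheory.Integrable (fun ω => Parametrix.pathWeight T θ τ X ω •
          Parametrix.diagGrad p (T - Parametrix.lastJump T τ ω)
            (X (Parametrix.lastJump T τ ω) ω) y) μ ∧
        HasGradientAt (fun y' => Parametrix.density p θ T x y')
          (Real.exp T • ∫ ω, Parametrix.pathWeight T θ τ X ω •
            Parametrix.diagGrad p (T - Parametrix.lastJump T τ ω)
              (X (Parametrix.lastJump T τ ω) ω) y ∂μ) y) := by
  have ham : Measurable fun q : ℝ × Parametrix.Space d × Parametrix.Space d =>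
      Parametrix.weightedKernel θ p q.1 q.2.1 q.2.2 :=
    hθ.meas.mul (Parametrix.measurable_diag hPz)
  have hGm : Measurable fun q : ℝ × Parametrix.Space d × Parametrix.Space d =>
      Parametrix.cut T (Parametrix.diagGrad p) q.1 q.2.1 q.2.2 :=
    Parametrix.measurable_cut_gradient (Parametrix.measurable_diag hPz) hdiff
  have hexp : ∀ t ∈ Set.Ioc (0 : ℝ) T, ∀ x y,
      (Summable fun n : ℕ => Parametrix.expansionTerm (Parametrix.weightedKernel θ p)
        (Parametrix.diag p) n t x y) ∧
      HasGradientAt (fun y' => Parametrix.density p θ t x y')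
        (Parametrix.diagGrad p t x y + ∑' n : ℕ, Parametrix.pathTerm
          (Parametrix.cut T (Parametrix.weightedKernel θ p))
          (Parametrix.cut T (Parametrix.diagGrad p)) (n + 1) t x y) y := by
    intro t ht x y
    obtain ⟨ζ, κ, hζ, -, hκ, h⟩ := hUI
    obtain ⟨ζ', κ', hζ', hκ', h'⟩ := hUIgrad
    obtain ⟨h1, h2⟩ := Parametrix.summable_and_hasGradientAt_expansion ha ham
      (Parametrix.measurable_diag hPz) hdiff ⟨ζ, κ, hζ, hκ.2, h⟩ ⟨ζ', κ', hζ', hκ'.2, h'⟩ ht x y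
    refine ⟨h1, ?_⟩
    have h3 : HasGradientAt (fun y' => Parametrix.diag p t x y') (Parametrix.diagGrad p t x y) y :=
      (hdiff t ht x y).hasGradientAt
    rw [hasGradientAt_iff_hasFDerivAt, map_add]
    exact h3.hasFDerivAt.add h2.hasFDerivAt
  refine ⟨fun t ht x => ⟨fun y => (hexp t ht x y).1, fun y => (hexp t ht x y).2.differentiableAt⟩,
    fun μ _ τ X x hτ hX y => ?_⟩
  have hTmem : T ∈ Set.Ioc (0 : ℝ) T := ⟨hT, le_rfl⟩
  obtain ⟨ζ, κ, hζ, hκ, h⟩ := hUIgrad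
  obtain ⟨r, hr, A, hA, hb⟩ := h.exists_pathBound ha hζ hGm hTmem x y
  obtain ⟨hint, hsum⟩ := Parametrix.integrable_and_hasSum_pathTerm hT hPz hτ hX hθ.meas hGm
    ⟨ha.rho_mem.1.trans (le_max_left _ _), max_lt ha.rho_mem.2 hκ.2⟩ hA y
    (hb y (Metric.mem_ball_self hr))
  refine ⟨hint, ?_⟩
  have hgrad := (hexp T hTmem x y).2
  have hzero : Parametrix.diagGrad p T x y = Parametrix.pathTerm
      (Parametrix.cut T (Parametrix.weightedKernel θ p))
      (Parametrix.cut T (Parametrix.diagGrad p)) 0 T x y := by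
    rw [Parametrix.pathTerm_zero, Parametrix.cut_of_mem hTmem]
  -- The gradient of the frozen density is the path term with no step; with it the differentiated
  -- expansion becomes the full series summed by the expectation.
  rwa [hzero, ← hsum.summable.tsum_eq_zero_add, hsum.tsum_eq] at hgrad
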